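/- Setting. Let $(\mathbb X,d)$ be a complete, locally compact metric space in which any two points have a midpoint. A set $A\subseteq\mathbb X$ is strongly convex if any two of its points are joined by a unique shortest path, which lies in $A$ and depends continuously on the end points. Assume that all sufficiently small open balls at any point of $\mathbb X$ are strongly convex; let $\mathrm{conv}(x)$ be the supremum of all $\delta$ such that the open balls $B_{\delta'}(x)$, $0<\delta'\le\delta$, are strongly convex, and $\mathrm{conv}(A)=\inf_{x\in A}\mathrm{conv}(x)$. Write $B_a(A)$, $D_a(A)$ for the open and closed $a$-neighbourhoods of a set (or point) $A$. Homology is singular (for spaces) or simplicial (for complexes), with coefficients in $\mathbb Z$; all statements on homology are meant in every degree. Let $K\subseteq\mathbb X$ be compact, let $\varepsilon>0$, and let $P\subset\mathbb X$ be a nonempty finite set with Hausdorff distance $d_H(K,P)<\varepsilon$. Put $t=0$ if $P\subseteq K$ and $t=1$ otherwise; $s=\sqrt2$ if $\mathbb X$ is a Euclidean space and $s=2$ otherwise. Let $p\in P$, and let $x\in K$ be the point of $K$ closest to $p$ if $P\subseteq K$, and any point of $K$ with $d(x,p)<\varepsilon$ otherwise. For $Q\subseteq P$ let $\mathcal C_a(Q)$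 be the Čech complex (finite nonempty $\sigma\subseteq Q$ with $\bigcap_{q\in\sigma}D_a(q)\ne\emptyset$) and $\mathcal R_a(Q)$ the Vietoris–Rips complex (finite nonempty $\sigma\subseteq Q$ all of whose edges are in $\mathcal C_a(Q)$). Let $$F(a,b)=H(D_a(K),D_a(K)-B_b(x))\ \ ((a,b)\neq(0,0)),\qquad F(0,0)=H(K,K-\{x\}),$$ $$C(a,b)=H(\mathcal C_a(P),\mathcal C_a(P-B_b(p))),\qquad V(a,b)=H(\mathcal R_a(P),\mathcal R_a(P-B_b(p))).$$ Seemliness. For $e\ge0$ let $A_x(e)$ be the set of triples of reals $(R,r,\alpha)$ with $R\ge r>\alpha\ge e$ such that: (1) for all $\rho\in(0,R]$, $D_\rho(x)$ is homeomorphic to a closed Euclidean ball (and, if $\mathbb X$ is a smooth Riemannian manifold with its geodesic distance and $K$ is given with a Whitney stratification, the sphere $S_\rho(x)$ is a smooth submanifold transverse to all strata); (2) the inclusion induced maps $F(0,R)\to F(0,\rho)\to F(0,0)$ are isomorphisms for all $\rho\in(0,R]$, and, with $i_*:F(0,R)\to F(e,R)$, $j_*:F(e,R)\to F(\alpha,r)$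 induced by inclusions, $j_*\circ i_*$ is an isomorphism of $F(0,R)$ onto $\mathrm{im}\,j_*$. Put $A_x(e\mid\alpha)=\{(R,r):(R,r,\alpha)\in A_x(e)\}$. $K$ is strongly homologically seemly at $x$ if there are $\varepsilon_x>0$ and functions $\rho^l_x(e,\alpha)\in[0,\infty)$, $\rho^u_x(e,\alpha)\in[0,\infty]$, $0\le e\le\alpha\le\varepsilon_x$, such that (i) $A_x(e\mid\alpha)\ne\emptyset$ for all $0\le e\le\alpha\le\varepsilon_x$, and $\sup_{\alpha\in[e,\varepsilon_x]}d_H(A_x(0\mid\alpha),A_x(e\mid\alpha))\to0$ as $e\to0$; (ii) $\rho^l_x$ is non-decreasing and $\rho^u_x$ is non-increasing in $e$ and in $\alpha$, and $\rho^l_x<\rho^u_x$; (iii) as $e\to0$, $\rho^l_x(e,\alpha)\to\inf\{r: \exists R,\ (R,r)\in\bigcap_{\alpha'\in[0,\alpha]}A_x(0\mid\alpha')\}$ and $\rho^u_x(e,\alpha)\to\sup\{R: \exists r,\ (R,r)\in\bigcap_{\alpha'\in[0,\alpha]}A_x(0\mid\alpha')\}$; (iv) $(\rho,\rho,\alpha)\in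 A_x(e)$ for all $0<e\le\alpha\le\varepsilon_x$ and all real $\rho\in[\rho^l_x(e,\alpha),\rho^u_x(e,\alpha)]$. Theorem. Let $K$ be strongly homologically seemly at $x$, with $\varepsilon_x,\rho^l_x,\rho^u_x$ as above, let $c\in\{1,s\}$ and $$\beta=(c^2+(t+1)c+t)\varepsilon,\qquad \gamma=(c^2+(t+3)c+5t+2)\varepsilon ,$$ and suppose that $\beta\le\varepsilon_x$ and $c(1+c+t)\varepsilon<\mathrm{conv}(P)$. Put $\bar r_x(\beta)=\rho^l_x((c+t)\varepsilon,\beta)$, $\bar R_x(\beta)=\rho^u_x((c+t)\varepsilon,\beta)$, $\tau_x(\beta)=\bar R_x(\beta)-\bar r_x(\beta)$, and suppose $\tau_x(\beta)>\gamma$. Then for all reals $R'\in(\bar r_x(\beta)+\gamma,\bar R_x(\beta))$, $r'\in(\bar r_x(\beta),R'-\gamma)$, and $R=R'-(1+t)\varepsilon$, $r=r'+\beta$, the images of the inclusion induced homomorphisms satisfy, in every degree, $$\mathrm{im}\big(C(\varepsilon,R)\to C((1+c+t)\varepsilon,r)\big)\cong H(K,K-\{x\})\quad\text{if }c=1,$$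 $$\mathrm{im}\big(V(\varepsilon,R)\to V((1+c+t)\varepsilon,r)\big)\cong H(K,K-\{x\})\quad\text{if }c=s.$$ -/

import Mathlib

open CategoryTheory CategoryTheory.Limits Set Filter Topology
open scoped Manifold ContDiff Bundle

universe u

namespace LocalHomology

/-! ### Relative homology with integer coefficients -/

/-- The chain complex functor of simplicial sets with coefficients in `ℤ`. -/
noncomputable def intChains : SSet.{u} ⥤ ChainComplex (ModuleCat.{u} ℤ) ℕ :=
  (SSet.chainComplexFunctor (ModuleCat.{u} ℤ)).obj (ModuleCat.of ℤ (ULift.{u} ℤ))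

/-- The `n`-th relative homology `H_n(B, A)` of a map of simplicial sets `A ⟶ B` (in practice an
inclusion): the homology of the quotient of the chains of `B` by the chains of `A`. -/
noncomputable def relHomology (n : ℕ) : Arrow SSet.{u} ⥤ ModuleCat.{u} ℤ :=
  intChains.mapArrow ⋙ coker _ ⋙ HomologicalComplex.homologyFunctor _ _ n

section Singular

variable {X : Type u} [TopologicalSpace X]

/-- The inclusion of subspaces `S ⊆ T` of `X`. -/
def incl {S T : Set X} (h : S ⊆ T) : TopCat.of S ⟶ TopCat.of T :=
  TopCat.ofHom ⟨Set.inclusion h, continuous_inclusion h⟩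

/-- The pair `(A, A - U)`, as a map of singular simplicial sets. -/
noncomputable def spacePair (A U : Set X) : Arrow SSet.{u} :=
  Arrow.mk (TopCat.toSSet.map (incl (sdiff_subset : A \ U ⊆ A)))

/-- The inclusion `(A, A - U) ⟶ (A', A' - U')` for `A ⊆ A'` and `U' ⊆ U`. -/
noncomputable def spacePairHom {A U A' U' : Set X} (hA : A ⊆ A') (hU : U' ⊆ U) :
    spacePair A U ⟶ spacePair A' U' :=
  Arrow.homMk (TopCat.toSSet.map (incl (sdiff_subset_sdiff hA hU)))
    (TopCat.toSSet.map (incl hA))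
    (by
      dsimp [spacePair]
      rw [← Functor.map_comp, ← Functor.map_comp]
      rfl)

/-- Singular homology `H_n(A, A - U)`. -/
noncomputable def spaceH (n : ℕ) (A U : Set X) : ModuleCat.{u} ℤ :=
  (relHomology n).obj (spacePair A U)

/-- The inclusion induced homomorphism `H_n(A, A - U) → H_n(A', A' - U')`. -/
noncomputable def spaceHMap (n : ℕ) {A U A' U' : Set X} (hA : A ⊆ A') (hU : U' ⊆ U) :
    spaceH n A U →ₗ[ℤ] spaceH n A' U' :=
  ((relHomology n).map (spacePairHom hA hU)).hom

/-- `(A, A - U)` is contained in `(A', A' - U')` and the inclusion induces isomorphisms in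
homology in all degrees. -/
def InclusionIso (A U A' U' : Set X) : Prop :=
  ∃ (hA : A ⊆ A') (hU : U' ⊆ U), ∀ n, Function.Bijective (spaceHMap n hA hU)

end Singular

section Simplicial

variable {V : Type u}

/-- The simplicial set of ordered simplices of an abstract simplicial complex: an `n`-simplex is a
tuple `(v₀, …, vₙ)` of vertices, repetitions allowed, which all lie in one face. Its chain complex
is the ordered simplicial chain complex. -/
def orderedSSet (L : PreAbstractSimplicialComplex V) : SSet.{u} where
  obj Δ := {f : Fin (Δ.unop.len + 1) → V // ∃ σ ∈ L.faces, ∀ i, f i ∈ σ}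
  map θ := TypeCat.ofHom fun f =>
    ⟨f.1 ∘ θ.unop.toOrderHom, f.2.imp fun _ h => ⟨h.1, fun _ => h.2 _⟩⟩

/-- The map of ordered simplices induced by the inclusion of a subcomplex. -/
def orderedSSetMap {L M : PreAbstractSimplicialComplex V} (h : L ≤ M) :
    orderedSSet L ⟶ orderedSSet M where
  app _ := TypeCat.ofHom fun f => ⟨f.1, f.2.imp fun _ hσ => ⟨h hσ.1, hσ.2⟩⟩

/-- The inclusion of pairs of complexes `(M, L) ⟶ (M', L')`. -/
def complexPairHom {L M L' M' : PreAbstractSimplicialComplex V} (h : L ≤ M) (h' : L' ≤ M')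
    (hL : L ≤ L') (hM : M ≤ M') :
    Arrow.mk (orderedSSetMap h) ⟶ Arrow.mk (orderedSSetMap h') :=
  Arrow.homMk (orderedSSetMap hL) (orderedSSetMap hM) rfl

/-- Simplicial homology `H_n(M, L)` of a pair of complexes `L ≤ M`. -/
noncomputable def complexH (n : ℕ) {L M : PreAbstractSimplicialComplex V} (h : L ≤ M) :
    ModuleCat.{u} ℤ :=
  (relHomology n).obj (Arrow.mk (orderedSSetMap h))

/-- The inclusion induced homomorphism `H_n(M, L) → H_n(M', L')`. -/
noncomputable def complexHMap (n : ℕ) {L M L' M' : PreAbstractSimplicialComplex V} (h : L ≤ M)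
    (h' : L' ≤ M') (hL : L ≤ L') (hM : M ≤ M') : complexH n h →ₗ[ℤ] complexH n h' :=
  ((relHomology n).map (complexPairHom h h' hL hM)).hom

end Simplicial

/-! ### Čech and Vietoris-Rips complexes, convexity radius -/

section Metric

variable {X : Type u} [MetricSpace X]

/-- The Čech complex of `Q` at scale `a`. -/
def cech (a : ℝ) (Q : Set X) : PreAbstractSimplicialComplex X where
  faces := {σ | σ.Nonempty ∧ (σ : Set X) ⊆ Q ∧ (⋂ x ∈ σ, Metric.closedBall x a).Nonempty}
  isRelLowerSet_faces := by
    rintro σ ⟨h1, h2, h3⟩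
    refine ⟨h1, fun τ hτ hne => ⟨hne, fun x hx => h2 (hτ hx), h3.mono ?_⟩⟩
    exact biInter_subset_biInter_left fun x hx => hτ hx

open Classical in
/-- The Vietoris-Rips complex of `Q` at scale `a`: all simplices whose edges are in the Čech
complex. -/
def rips (a : ℝ) (Q : Set X) : PreAbstractSimplicialComplex X where
  faces := {σ | σ.Nonempty ∧ (σ : Set X) ⊆ Q ∧
    ∀ x ∈ σ, ∀ y ∈ σ, ({x, y} : Finset X) ∈ (cech a Q).faces}
  isRelLowerSet_faces := by
    rintro σ ⟨h1, h2, h3⟩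
    exact ⟨h1, fun τ hτ hne => ⟨hne, fun x hx => h2 (hτ hx),
      fun x hx y hy => h3 x (hτ hx) y (hτ hy)⟩⟩

theorem cech_mono (a : ℝ) {Q Q' : Set X} (h : Q ⊆ Q') : cech a Q ≤ cech a Q' :=
  fun _ hσ => ⟨hσ.1, hσ.2.1.trans h, hσ.2.2⟩

theorem rips_mono (a : ℝ) {Q Q' : Set X} (h : Q ⊆ Q') : rips a Q ≤ rips a Q' :=
  fun _ hσ => ⟨hσ.1, hσ.2.1.trans h, fun x hx y hy => cech_mono a h (hσ.2.2 x hx y hy)⟩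

/-- The subcomplex inclusion `𝒞_a(P - B_b(p)) ≤ 𝒞_a(P)`. -/
theorem cech_diff_le (P : Set X) (p : X) (a b : ℝ) :
    cech a (P \ Metric.ball p b) ≤ cech a P := cech_mono a sdiff_subset

/-- The subcomplex inclusion `ℛ_a(P - B_b(p)) ≤ ℛ_a(P)`. -/
theorem rips_diff_le (P : Set X) (p : X) (a b : ℝ) :
    rips a (P \ Metric.ball p b) ≤ rips a P := rips_mono a sdiff_subset

/-- A shortest path from `x` to `y`, parametrized proportionally to arc length. -/
def IsShortestPath (γ : unitInterval → X) (x y : X) : Prop :=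
  γ 0 = x ∧ γ 1 = y ∧ ∀ s t : unitInterval, dist (γ s) (γ t) = |(s : ℝ) - t| * dist x y

/-- Any two points of `A` are joined by a unique shortest path, which lies in `A` and depends
continuously on the end points. -/
def StronglyConvex (A : Set X) : Prop :=
  ∃ Γ : X → X → unitInterval → X,
    (∀ x ∈ A, ∀ y ∈ A, IsShortestPath (Γ x y) x y ∧
      (∀ γ, IsShortestPath γ x y → γ = Γ x y) ∧ ∀ t, Γ x y t ∈ A) ∧
    ContinuousOn (fun q : X × X × unitInterval => Γ q.1 q.2.1 q.2.2) (A ×ˢ A ×ˢ univ)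

variable (X) in
/-- All sufficiently small open balls at any point are strongly convex. -/
def LocallyStronglyConvex : Prop :=
  ∀ x : X, ∃ δ₀ > 0, ∀ δ, 0 < δ → δ < δ₀ → StronglyConvex (Metric.ball x δ)

/-- The convexity radius at a point: the supremum of the radii up to which all open balls are
strongly convex. -/
noncomputable def convAt (x : X) : EReal :=
  sSup ((fun δ : ℝ => (δ : EReal)) ''
    {δ : ℝ | ∀ δ', 0 < δ' → δ' ≤ δ → StronglyConvex (Metric.ball x δ')})

/-- The convexity radius of a set. -/
noncomputable def conv (A : Set X) : EReal := ⨅ x ∈ A, convAt x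

/-- `P` is an `ε`-sample of `K`. -/
def IsSample (ε : ℝ) (K P : Set X) : Prop :=
  0 < ε ∧ P.Finite ∧ P.Nonempty ∧ Metric.hausdorffDist K P < ε

open Classical in
/-- The constant `t`: `0` for noise-free samples, `1` otherwise. -/
noncomputable def noiseConst (K P : Set X) : ℝ := if P ⊆ K then 0 else 1

open Classical in
variable (X) in
/-- The constant `s`: `√2` for a Euclidean space, `2` otherwise. -/
noncomputable def ripsConst : ℝ :=
  if ∃ n : ℕ, Nonempty (X ≃ᵢ EuclideanSpace ℝ (Fin n)) then √2 else 2

/-- The points `x` of `K` that are associated with a sample point `p`: the closest point to `p` if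
the sample is noise-free, and any point at distance less than `ε` otherwise. -/
def IsAssociated (ε : ℝ) (K P : Set X) (p x : X) : Prop :=
  x ∈ K ∧ (P ⊆ K → ∀ z ∈ K, dist p x ≤ dist p z) ∧ (¬ P ⊆ K → dist x p < ε)

/-- The closed ball of radius `ρ` at `x` is a topological ball. -/
def IsTopologicalBall (x : X) (ρ : ℝ) : Prop :=
  ∃ n : ℕ, Nonempty (Metric.closedBall x ρ ≃ₜ
    Metric.closedBall (0 : EuclideanSpace ℝ (Fin n)) 1)

end Metric

/-! ### Whitney stratifications -/

section Whitney

/-- The tangent space at `a` of a subset of a normed space: the span of the velocities at `a` of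
curves in the subset. -/
noncomputable def velocitySpan {E : Type*} [NormedAddCommGroup E] [NormedSpace ℝ E] (A : Set E) (a : E) :
    Submodule ℝ E :=
  Submodule.span ℝ {v | ∃ γ : ℝ → E, γ 0 = a ∧ (∀ᶠ s in 𝓝 0, γ s ∈ A) ∧ HasDerivAt γ v 0}

variable {X : Type u} {d : ℕ}

/-- The tangent space of `S` at `y`, expressed in the coordinate system `φ`. -/
noncomputable def tangentIn [TopologicalSpace X] (φ : OpenPartialHomeomorph X (EuclideanSpace ℝ (Fin d)))
    (S : Set X) (y : X) : Submodule ℝ (EuclideanSpace ℝ (Fin d)) :=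
  velocitySpan (φ '' (S ∩ φ.source)) (φ y)

/-- Convergence of linear subspaces in the Grassmannian. -/
def GrassmannTendsto (U : ℕ → Submodule ℝ (EuclideanSpace ℝ (Fin d)))
    (τ : Submodule ℝ (EuclideanSpace ℝ (Fin d))) : Prop :=
  Tendsto (fun i => (U i).starProjection) atTop (𝓝 τ.starProjection)

/-- Embedded smooth submanifolds, through slice charts. -/
def IsSmoothSubmanifold [TopologicalSpace X] [ChartedSpace (EuclideanSpace ℝ (Fin d)) X]
    (S : Set X) : Prop :=
  ∀ y ∈ S, ∃ φ ∈ IsManifold.maximalAtlas (𝓡 d) ∞ X, y ∈ φ.source ∧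
    ∃ W : Submodule ℝ (EuclideanSpace ℝ (Fin d)), ∀ z ∈ φ.source, z ∈ S ↔ φ z - φ y ∈ W

/-- A locally finite partition into locally closed sets with the Frontier Condition. -/
structure IsStratification [TopologicalSpace X] (K : Set X) (𝒮 : Set (Set X)) : Prop where
  locallyFinite : LocallyFinite (fun S : 𝒮 => (S : Set X))
  disjoint : 𝒮.PairwiseDisjoint id
  locallyClosed : ∀ S ∈ 𝒮, IsLocallyClosed S
  sUnion_eq : ⋃₀ 𝒮 = K
  frontier : ∀ S ∈ 𝒮, ∀ T ∈ 𝒮, (S ∩ closure T).Nonempty → S ⊆ closure T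

/-- Whitney's conditions (a) and (b) for a pair of strata `T ≤ S`. -/
def WhitneyConditions [TopologicalSpace X] [ChartedSpace (EuclideanSpace ℝ (Fin d)) X]
    (S T : Set X) : Prop :=
  ∀ y ∈ T, ∀ (u v : ℕ → X) (τ l : Submodule ℝ (EuclideanSpace ℝ (Fin d))),
    (∀ i, u i ∈ S) → (∀ i, v i ∈ T) → (∀ i, u i ≠ v i) →
    Tendsto u atTop (𝓝 y) → Tendsto v atTop (𝓝 y) →
    GrassmannTendsto (fun i => tangentIn (chartAt (EuclideanSpace ℝ (Fin d)) y) S (u i)) τ →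
    GrassmannTendsto (fun i => Submodule.span ℝ
      {chartAt (EuclideanSpace ℝ (Fin d)) y (u i) -
        chartAt (EuclideanSpace ℝ (Fin d)) y (v i)}) l →
    tangentIn (chartAt (EuclideanSpace ℝ (Fin d)) y) T y ≤ τ ∧ l ≤ τ

/-- A Whitney stratification of `K`, together with the structure of a smooth Riemannian manifold
on the metric space `X`. -/
structure WhitneyStratification (X : Type u) [MetricSpace X] (K : Set X) where
  dim : ℕ
  [charted : ChartedSpace (EuclideanSpace ℝ (Fin dim)) X]
  [smooth : IsManifold (𝓡 dim) ∞ X]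
  [bundle : Bundle.RiemannianBundle (fun y : X => TangentSpace (𝓡 dim) y)]
  [smoothMetric : IsContMDiffRiemannianBundle (𝓡 dim) ∞ (EuclideanSpace ℝ (Fin dim))
    (fun y : X => TangentSpace (𝓡 dim) y)]
  [riemannian : IsRiemannianManifold (𝓡 dim) X]
  strata : Set (Set X)
  isStratification : IsStratification K strata
  isSmooth : ∀ S ∈ strata, IsSmoothSubmanifold (d := dim) S
  whitney : ∀ S ∈ strata, ∀ T ∈ strata, T ⊆ closure S → WhitneyConditions (d := dim) S T

/-- The sphere of radius `ρ` at `x` is transverse to all the strata. -/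
def WhitneyStratification.SphereTransverse {X : Type u} [MetricSpace X] {K : Set X}
    (w : WhitneyStratification X K) (x : X) (ρ : ℝ) : Prop :=
  letI := w.charted
  IsSmoothSubmanifold (d := w.dim) (Metric.sphere x ρ) ∧
    ∀ S ∈ w.strata, ∀ y ∈ S ∩ Metric.sphere x ρ,
      tangentIn (chartAt (EuclideanSpace ℝ (Fin w.dim)) y) (Metric.sphere x ρ) y ⊔
        tangentIn (chartAt (EuclideanSpace ℝ (Fin w.dim)) y) S y = ⊤

end Whitney

/-! ### Homological seemliness -/

section Seemly

variable {X : Type u} [MetricSpace X] (K : Set X) (W : Option (WhitneyStratification X K)) (x : X)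

/-- The set `A_x(ε)` of triples `(R, r, α)`. Here `F(a, b) = H(D_a(K), D_a(K) - B_b(x))` for
`(a, b) ≠ (0, 0)` and `F(0, 0) = H(K, K - {x})`. The transversality requirement is present exactly
when `K` is equipped with a Whitney stratification `W`. -/
structure MemA (ε R r α : ℝ) : Prop where
  eps_nonneg : 0 ≤ ε
  eps_le : ε ≤ α
  alpha_lt : α < r
  r_le : r ≤ R
  ball : ∀ ρ, 0 < ρ → ρ ≤ R → IsTopologicalBall x ρ
  transverse : ∀ w ∈ W, ∀ ρ, 0 < ρ → ρ ≤ R → w.SphereTransverse x ρ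
  /-- `F(0, R) → F(0, ρ)` and `F(0, ρ) → F(0, 0)` are isomorphisms. -/
  bottom_row : ∀ ρ, 0 < ρ → ρ ≤ R →
    InclusionIso (Metric.cthickening 0 K) (Metric.ball x R)
      (Metric.cthickening 0 K) (Metric.ball x ρ) ∧
    InclusionIso (Metric.cthickening 0 K) (Metric.ball x ρ) K {x}
  /-- With `i_* : F(0, R) → F(ε, R)` and `j_* : F(ε, R) → F(α, r)`, the map `j_* ∘ i_*` is an
  isomorphism from `F(0, R)` onto the image of `j_*`. -/
  diagonal : ∃ (h₁ : Metric.cthickening 0 K ⊆ Metric.cthickening ε K)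
    (h₂ : Metric.cthickening ε K ⊆ Metric.cthickening α K)
    (h₃ : Metric.ball x r ⊆ Metric.ball x R), ∀ n,
      Function.Injective (spaceHMap n h₂ h₃ ∘ spaceHMap n h₁ (subset_refl (Metric.ball x R))) ∧
      range (spaceHMap n h₂ h₃ ∘ spaceHMap n h₁ (subset_refl (Metric.ball x R))) =
        range (spaceHMap n h₂ h₃)

/-- The `α`-section `A_x(ε | α = α')`. -/
def alphaSection (ε α : ℝ) : Set (ℝ × ℝ) := {q | MemA K W x ε q.1 q.2 α}

/-- `A_x(ε)` is weakly seemly, with witnesses `ε_x`, `α_x^l`, `α_x^u`. -/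
structure WeaklySeemly (εx : ℝ) (αl αu : ℝ → ℝ) : Prop where
  pos : 0 < εx
  l_nonneg : ∀ ε ∈ Icc 0 εx, 0 ≤ αl ε
  u_nonneg : ∀ ε ∈ Icc 0 εx, 0 ≤ αu ε
  l_mono : MonotoneOn αl (Icc 0 εx)
  u_anti : AntitoneOn αu (Icc 0 εx)
  l_zero : αl 0 = 0
  l_tendsto : Tendsto αl (𝓝[>] 0) (𝓝 0)
  u_tendsto : Tendsto αu (𝓝[>] 0) (𝓝 (αu 0))
  nonempty : ∀ ε ∈ Icc 0 εx, ∀ α ∈ Icc (αl ε) (αu ε), (alphaSection K W x ε α).Nonempty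
  hausdorff : Tendsto (fun ε => ⨆ α ∈ Icc (αl ε) (αu ε),
    Metric.hausdorffEDist (alphaSection K W x 0 α) (alphaSection K W x ε α)) (𝓝[>] 0) (𝓝 0)

/-- The intersection `A_x([0, ε] | α ≤ β)` of `α`-sections. -/
def slabInter (αl : ℝ → ℝ) (ε β : ℝ) : Set (ℝ × ℝ) :=
  ⋂ ε' ∈ Icc 0 ε, ⋂ α ∈ Icc (αl ε') β, alphaSection K W x ε' α

/-- The supremum of the first coordinates of `A_x([0, ε] | α ≤ β)`. -/
noncomputable def slabSup (αl : ℝ → ℝ) (ε β : ℝ) : EReal :=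
  sSup ((fun q : ℝ × ℝ => (q.1 : EReal)) '' slabInter K W x αl ε β)

/-- The infimum of the second coordinates of `A_x([0, ε] | α ≤ β)`. -/
noncomputable def slabInf (αl : ℝ → ℝ) (ε β : ℝ) : EReal :=
  sInf ((fun q : ℝ × ℝ => (q.2 : EReal)) '' slabInter K W x αl ε β)

/-- `A_x(ε)` is moderately seemly, with witnesses `ε_x`, `α_x^l`, `α_x^u`, `ρ_x^l`, `ρ_x^u`. The
upper bound `ρ_x^u` may be infinite. -/
structure ModeratelySeemly (εx : ℝ) (αl αu : ℝ → ℝ) (ρl : ℝ → ℝ → ℝ) (ρu : ℝ → ℝ → EReal) : Prop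
    extends WeaklySeemly K W x εx αl αu where
  rho_nonneg : ∀ ε ∈ Icc 0 εx, ∀ α ∈ Icc (αl ε) (αu ε), 0 ≤ ρl ε α
  rho_lt : ∀ ε ∈ Icc 0 εx, ∀ α ∈ Icc (αl ε) (αu ε), (ρl ε α : EReal) < ρu ε α
  rho_mono_eps : ∀ ε₁ ∈ Icc 0 εx, ∀ ε₂ ∈ Icc 0 εx, ε₁ ≤ ε₂ →
    ∀ α ∈ Icc (αl ε₁) (αu ε₁) ∩ Icc (αl ε₂) (αu ε₂), ρl ε₁ α ≤ ρl ε₂ α ∧ ρu ε₂ α ≤ ρu ε₁ α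
  rho_mono_alpha : ∀ ε ∈ Icc 0 εx, ∀ α₁ ∈ Icc (αl ε) (αu ε), ∀ α₂ ∈ Icc (αl ε) (αu ε), α₁ ≤ α₂ →
    ρl ε α₁ ≤ ρl ε α₂ ∧ ρu ε α₂ ≤ ρu ε α₁
  l_tendsto_inf : ∀ α, Tendsto (fun ε => (ρl ε α : EReal))
    (𝓝[{ε | 0 < ε ∧ ε ≤ εx ∧ α ∈ Icc (αl ε) (αu ε)}] 0) (𝓝 (slabInf K W x αl 0 α))
  u_tendsto_sup : ∀ α, Tendsto (fun ε => ρu ε α)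
    (𝓝[{ε | 0 < ε ∧ ε ≤ εx ∧ α ∈ Icc (αl ε) (αu ε)}] 0) (𝓝 (slabSup K W x αl 0 α))
  mem : ∀ ε ∈ Icc 0 εx, 0 < ε → ∀ α ∈ Icc (αl ε) (αu ε), ∀ ρ : ℝ, ρl ε α ≤ ρ →
    (ρ : EReal) ≤ ρu ε α → MemA K W x ε ρ ρ α

/-- `A_x(ε)` is strongly seemly (`K` is strongly homologically seemly at `x`): moderately seemly
with `α_x^l(ε) = ε` and `α_x^u(ε) = ε_x`. -/
def StronglySeemly (εx : ℝ) (ρl : ℝ → ℝ → ℝ) (ρu : ℝ → ℝ → EReal) : Prop :=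
  ModeratelySeemly K W x εx (fun ε => ε) (fun _ => εx) ρl ρu

end Seemly

/-! ### Scales -/

/-- `β = (c² + (t + 1)c + t)ε`. -/
noncomputable def scaleBeta (c t ε : ℝ) : ℝ := (c ^ 2 + (t + 1) * c + t) * ε

/-- `γ = (c² + (t + 3)c + 5t + 2)ε`. -/
noncomputable def scaleGamma (c t ε : ℝ) : ℝ := (c ^ 2 + (t + 3) * c + 5 * t + 2) * ε

end LocalHomology

open LocalHomology

open LocalHomology

universe v w

/-! Put e = (c + t)ε and b = R - (c + t)ε. Let B be the pair of complexes at scale ε with hole of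
radius R, and D the pair at scale (1 + c + t)ε with hole of radius r. The theorem follows from a
zigzag of homomorphisms F(0, R') → H(B) → F(e, b) → H(D) → F(β, r') in which any two consecutive
maps compose to the map induced by inclusion.

Seemliness makes F(0, R') → F(e, b) bijective and F(e, b) → F(β, r') injective
(`exists_inclMap_of_memA`). So H(B) → F(e, b) is onto and F(e, b) → H(D) is injective, and the image
of H(B) → H(D) is isomorphic to F(e, b), hence to F(0, R') and to H(K, K - {x}). This chase is
`nonempty_range_equiv`.

The maps from spaces to complexes send a singular simplex to the sample points nearest to its
vertices; this is possible when the simplex is close to all these points, and subdivision provides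
such simplices (`bijective_singSmall`). The maps from complexes to spaces fill the flags of the
barycentric subdivision by singular chains inside intersections of balls around sample points. Below
the convexity radius such intersections contract along geodesics, so they are acyclic. All maps and
homotopies come from acyclic carriers (`exists_chainMap`, `exists_chainHomotopy`); the composites
are compared in `IsRealization.sub_mem_relB` and `IsRealization.vertMap_sub_mem_relB`.

Vietoris-Rips complexes enter only by being squeezed between the Čech complexes at scales a and s·a;
for Euclidean spaces this is a form of Jung's theorem (`exists_dist_le_sqrt_two`).

The radii drop by (1 + t)ε, (c + t)ε, (1 + c + 2t)ε and β along the four maps, by the triangle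
inequality with d(x, p) ≤ tε. These four numbers add up to γ. -/

/-- An augmented semi-simplicial set; `G m` is the type of simplices with `m` vertices. -/
structure FaceSystem where
  G : ℕ → Type v
  d : ∀ {m : ℕ}, Fin (m + 1) → G (m + 1) → G m
  d_d : ∀ {m : ℕ} (i j : Fin (m + 1)) (_ : i ≤ j) (σ : G (m + 2)),
    d i (d j.succ σ) = d j (d i.castSucc σ)

/-! ### Chains, acyclic families, acyclic carriers and relative homology of face systems. -/

namespace FaceSystem

variable (E : FaceSystem.{v}) (F : FaceSystem.{w})

/-- Chains spanned by the simplices with `m` vertices. -/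
abbrev Ch (m : ℕ) : Type v := E.G m →₀ ℤ

/-- The boundary. -/
noncomputable def bd (m : ℕ) : E.Ch (m + 1) →ₗ[ℤ] E.Ch m :=
  Finsupp.lift _ ℤ _ fun σ => ∑ i : Fin (m + 1), (-1 : ℤ) ^ (i : ℕ) • Finsupp.single (E.d i σ) 1

theorem bd_single (m : ℕ) (σ : E.G (m + 1)) :
    E.bd m (Finsupp.single σ 1) =
      ∑ i : Fin (m + 1), (-1 : ℤ) ^ (i : ℕ) • Finsupp.single (E.d i σ) 1 := by
  simp [bd]

theorem bd_bd (m : ℕ) (z : E.Ch (m + 2)) : E.bd m (E.bd (m + 1) z) = 0 := by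
  suffices h : E.bd m ∘ₗ E.bd (m + 1) = 0 from LinearMap.congr_fun h z
  refine Finsupp.lhom_ext' fun σ => LinearMap.ext_ring ?_
  simp only [LinearMap.comp_apply, Finsupp.lsingle_apply, LinearMap.zero_apply]
  rw [bd_single, map_sum]
  simp only [map_smul, bd_single, Finset.smul_sum, smul_smul]
  rw [← Finset.sum_product', Finset.univ_product_univ]
  let S : Finset (Fin (m + 2) × Fin (m + 1)) := {ij | (ij.1 : ℕ) ≤ (ij.2 : ℕ)}
  rw [← Finset.sum_add_sum_compl S, ← eq_neg_iff_add_eq_zero, ← Finset.sum_neg_distrib]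
  -- The terms with i ≤ j cancel against those with i > j through (i, j) ↦ (j + 1, i): `d_d`
  -- identifies the simplices, and the sum of the indices changes parity.
  let φ : ∀ ij : Fin (m + 2) × Fin (m + 1), ij ∈ S → Fin (m + 2) × Fin (m + 1) := fun ij hij =>
    (ij.2.succ, Fin.castLT ij.1 (lt_of_le_of_lt (Finset.mem_filter.mp hij).right (Fin.is_lt ij.2)))
  apply Finset.sum_bij φ
  · intro ij hij
    simp_rw [S, φ, Finset.compl_filter, Finset.mem_filter_univ, Fin.val_succ,
      Fin.val_castLT] at hij ⊢
    lia
  · rintro ⟨i, j⟩ hij ⟨i', j'⟩ hij' h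
    simp only [φ, Prod.mk.injEq, Fin.ext_iff, Fin.val_castLT, Fin.val_succ] at h ⊢
    omega
  · rintro ⟨i', j'⟩ hij'
    simp_rw [S, Finset.compl_filter, Finset.mem_filter_univ, not_le] at hij'
    refine ⟨(Fin.castSucc j', i'.pred <| ?_), ?_, ?_⟩
    · rintro rfl
      simp only [Fin.val_zero, not_lt_zero] at hij'
    · simpa [S] using Nat.le_sub_one_of_lt hij'
    · simp only [φ, Fin.castLT_castSucc, Fin.succ_pred]
  · rintro ⟨i, j⟩ hij
    simp only [S, Finset.mem_filter_univ] at hij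
    rw [← neg_smul]
    congr 1
    · simp only [φ, Fin.val_succ, Fin.val_castLT, pow_add, pow_one, mul_neg, mul_one, neg_mul,
        neg_neg]
      apply mul_comm
    · have := E.d_d (Fin.castLT i (lt_of_le_of_lt hij j.is_lt)) j (by
        simpa [Fin.le_def] using hij) σ
      simp only [Fin.castSucc_castLT] at this
      rw [← this]

/-- A family of simplices. -/
abbrev Fam := ∀ m, Set (E.G m)

variable {E F}

/-- The chains supported by a family of simplices. -/
noncomputable def ch (S : E.Fam) (m : ℕ) : Submodule ℤ (E.Ch m) := Finsupp.supported ℤ ℤ (S m)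

theorem single_mem_ch {S : E.Fam} {m : ℕ} {σ : E.G m} (h : σ ∈ S m) :
    Finsupp.single σ (1 : ℤ) ∈ ch S m := Finsupp.single_mem_supported ℤ _ h

theorem ch_mono {S T : E.Fam} {m : ℕ} (h : S m ⊆ T m) : ch S m ≤ ch T m :=
  Finsupp.supported_mono h

theorem ch_induction {S : E.Fam} {m : ℕ} {M : Type*} [AddCommGroup M] (N : Submodule ℤ M)
    (f : E.Ch m →ₗ[ℤ] M) (h : ∀ σ ∈ S m, f (Finsupp.single σ 1) ∈ N) {z : E.Ch m}
    (hz : z ∈ ch S m) : f z ∈ N := by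
  have : ch S m ≤ N.comap f := by
    rw [ch, Finsupp.supported_eq_span_single, Submodule.span_le]
    rintro _ ⟨σ, hσ, rfl⟩
    exact h σ hσ
  exact this hz

theorem ch_eqOn {S : E.Fam} {m : ℕ} {M : Type*} [AddCommGroup M]
    (f g : E.Ch m →ₗ[ℤ] M) (h : ∀ σ ∈ S m, f (Finsupp.single σ 1) = g (Finsupp.single σ 1))
    {z : E.Ch m} (hz : z ∈ ch S m) : f z = g z := by
  have := ch_induction (S := S) ⊥ (f - g) (fun σ hσ => by simp [h σ hσ]) hz
  simpa [sub_eq_zero] using this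

/-- A family that is stable under faces. -/
def Closed (S : E.Fam) : Prop := ∀ ⦃m⦄ (i : Fin (m + 1)), ∀ σ ∈ S (m + 1), E.d i σ ∈ S m

theorem bd_single_mem {S : E.Fam} {m : ℕ} {σ : E.G (m + 1)} (h : ∀ i, E.d i σ ∈ S m) :
    E.bd m (Finsupp.single σ 1) ∈ ch S m := by
  rw [bd_single]
  exact Submodule.sum_mem _ fun i _ => Submodule.smul_mem _ _ (single_mem_ch (h i))

theorem Closed.bd_mem {S : E.Fam} (hS : Closed S) {m : ℕ} {z : E.Ch (m + 1)}
    (hz : z ∈ ch S (m + 1)) : E.bd m z ∈ ch S m :=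
  ch_induction _ _ (fun σ hσ => bd_single_mem fun i => hS i σ hσ) hz

variable (E) in
/-- Cycles of the augmented complex. -/
noncomputable def cyc : ∀ m, Submodule ℤ (E.Ch m)
  | 0 => ⊤
  | m + 1 => LinearMap.ker (E.bd m)

theorem bd_mem_cyc (m : ℕ) (z : E.Ch (m + 1)) : E.bd m z ∈ E.cyc m := by
  cases m with
  | zero => trivial
  | succ m => exact E.bd_bd m z

/-- The vanishing of the augmented homology of a family. -/
def Acyclic (S : E.Fam) : Prop :=
  ∀ m, ∀ z ∈ ch S m, z ∈ E.cyc m → ∃ w ∈ ch S (m + 1), E.bd m w = z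

/-- A cone operator proves acyclicity. -/
theorem acyclic_of_cone {S : E.Fam} (k : ∀ m, E.G m → E.G (m + 1))
    (hk : ∀ m, ∀ σ ∈ S m, k m σ ∈ S (m + 1)) (h0 : ∀ m, ∀ σ ∈ S m, E.d 0 (k m σ) = σ)
    (hs : ∀ m, ∀ σ ∈ S (m + 1), ∀ i : Fin (m + 1), E.d i.succ (k (m + 1) σ) = k m (E.d i σ)) :
    Acyclic S := by
  intro m z hz hc
  let f : ∀ m, E.Ch m →ₗ[ℤ] E.Ch (m + 1) := fun m => Finsupp.lmapDomain ℤ ℤ (k m)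
  have hf : ∀ m σ, f m (Finsupp.single σ 1) = Finsupp.single (k m σ) 1 := fun m σ => by
    simp [f]
  refine ⟨f m z, ch_induction _ _ (fun σ hσ => ?_) hz, ?_⟩
  · rw [hf]; exact single_mem_ch (hk m σ hσ)
  cases m with
  | zero =>
    refine ch_eqOn (E.bd 0 ∘ₗ f 0) LinearMap.id (fun σ hσ => ?_) hz
    simp [hf, bd_single, h0 0 σ hσ]
  | succ m =>
    -- The face identities of `k` amount to ∂k + k∂ = id; on a cycle the second term vanishes.
    have := ch_eqOn (E.bd (m + 1) ∘ₗ f (m + 1) + f m ∘ₗ E.bd m) LinearMap.id (fun σ hσ => ?_) hz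
    · have hc' : E.bd m z = 0 := hc
      simpa [hc'] using this
    simp only [LinearMap.add_apply, LinearMap.comp_apply, hf, bd_single, map_sum, map_smul,
      LinearMap.id_apply]
    rw [Fin.sum_univ_succ]
    simp [h0 _ σ hσ, hs _ σ hσ, pow_succ]

/-- Mayer-Vietoris for acyclic families. -/
theorem Acyclic.union {S T : E.Fam} (hS : Acyclic S) (hT : Acyclic T) (cS : Closed S)
    (cT : Closed T) (hST : Acyclic fun m => S m ∩ T m) : Acyclic fun m => S m ∪ T m := by
  intro m z hz hc
  have hun : ∀ m, ch (fun m => S m ∪ T m) m = ch S m ⊔ ch T m :=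
    fun m => Finsupp.supported_union _ _
  have hin : ∀ m, ch (fun m => S m ∩ T m) m = ch S m ⊓ ch T m :=
    fun m => Finsupp.supported_inter _ _
  rw [hun] at hz ⊢
  obtain ⟨a, ha, b, hb, rfl⟩ := Submodule.mem_sup.1 hz
  cases m with
  | zero =>
    obtain ⟨w, hw, hw'⟩ := hS 0 a ha trivial
    obtain ⟨w', hw1, hw1'⟩ := hT 0 b hb trivial
    exact ⟨w + w', Submodule.add_mem_sup hw hw1, by rw [map_add, hw', hw1']⟩
  | succ m =>
    have hc' : E.bd m a + E.bd m b = 0 := by rw [← map_add]; exact hc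
    have hab : E.bd m a = - E.bd m b := eq_neg_of_add_eq_zero_left hc'
    -- The boundary of `a` lies in both families and bounds a chain `k` of the intersection. Then `a
    -- - k` and `b + k` are cycles of the two families with the same sum as `a` and `b`.
    have hmem : E.bd m a ∈ ch (fun m => S m ∩ T m) m := by
      rw [hin]
      exact ⟨cS.bd_mem ha, by rw [hab]; exact Submodule.neg_mem _ (cT.bd_mem hb)⟩
    obtain ⟨k, hk, hk'⟩ := hST m _ hmem (bd_mem_cyc m a)
    rw [hin] at hk
    obtain ⟨w, hw, hw'⟩ := hS (m + 1) (a - k) (Submodule.sub_mem _ ha hk.1)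
      (by show E.bd m _ = 0; rw [map_sub, hk', sub_self])
    obtain ⟨w', hw1, hw1'⟩ := hT (m + 1) (b + k) (Submodule.add_mem _ hb hk.2)
      (by show E.bd m _ = 0; rw [map_add, hk', hab, add_neg_cancel])
    exact ⟨w + w', Submodule.add_mem_sup hw hw1, by rw [map_add, hw', hw1']; abel⟩

/-! ### Acyclic carriers -/

section Carriers

variable (S : E.Fam) (Φ : ∀ m, E.G m → F.Fam)

/-- `Φ` is an acyclic carrier on `S`. -/
structure IsCarrier : Prop where
  closed : Closed S
  mono : ∀ ⦃m⦄, ∀ σ ∈ S (m + 1), ∀ i k, Φ m (E.d i σ) k ⊆ Φ (m + 1) σ k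
  acyclic : ∀ ⦃m⦄, ∀ σ ∈ S (m + 1), Acyclic (Φ (m + 1) σ)

/-- `f` is a chain map on `S`. -/
def IsChainMap (f : ∀ m, E.Ch m →ₗ[ℤ] F.Ch m) : Prop :=
  ∀ m, ∀ z ∈ ch S (m + 1), F.bd m (f (m + 1) z) = f m (E.bd m z)

/-- `f` is carried by `Φ` on `S`. -/
def CarriedBy (f : ∀ m, E.Ch m →ₗ[ℤ] F.Ch m) : Prop :=
  ∀ m, ∀ σ ∈ S m, f m (Finsupp.single σ 1) ∈ ch (Φ m σ) m

variable {S Φ}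

/-- By induction on the number of vertices, the image of ∂σ is a cycle in the acyclic carrier of σ,
so it has a filling there. The value on the empty simplex is prescribed; its carrier need not be
acyclic. -/
theorem exists_chainMap (hΦ : IsCarrier S Φ) (f₀ : E.Ch 0 →ₗ[ℤ] F.Ch 0)
    (h₀ : ∀ σ ∈ S 0, f₀ (Finsupp.single σ 1) ∈ ch (Φ 0 σ) 0) :
    ∃ f : ∀ m, E.Ch m →ₗ[ℤ] F.Ch m, f 0 = f₀ ∧ IsChainMap S f ∧ CarriedBy S Φ f := by
  classical
  -- The default value 0 is taken only where no filling exists, which does not happen on `S`.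
  let step : ∀ m, (E.Ch m →ₗ[ℤ] F.Ch m) → (E.Ch (m + 1) →ₗ[ℤ] F.Ch (m + 1)) := fun m f =>
    Finsupp.lift _ ℤ _ fun σ =>
      if h : ∃ w ∈ ch (Φ (m + 1) σ) (m + 1), F.bd m w = f (E.bd m (Finsupp.single σ 1))
      then h.choose else 0
  let f : ∀ m, E.Ch m →ₗ[ℤ] F.Ch m := fun m => Nat.rec f₀ step m
  have hstep : ∀ m σ, (∃ w ∈ ch (Φ (m + 1) σ) (m + 1), F.bd m w = f m (E.bd m (Finsupp.single σ 1)))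
      → f (m + 1) (Finsupp.single σ 1) ∈ ch (Φ (m + 1) σ) (m + 1) ∧
        F.bd m (f (m + 1) (Finsupp.single σ 1)) = f m (E.bd m (Finsupp.single σ 1)) := by
    intro m σ h
    have : f (m + 1) (Finsupp.single σ 1) = h.choose := by
      change step m (f m) _ = _
      simp only [step, Finsupp.lift_apply, Finsupp.sum_single_index, zero_smul, one_smul, dif_pos h]
    rw [this]
    exact h.choose_spec
  have key : ∀ m, (∀ σ ∈ S m, f m (Finsupp.single σ 1) ∈ ch (Φ m σ) m) ∧
      (∀ σ ∈ S (m + 1), f m (E.bd m (Finsupp.single σ 1)) ∈ F.cyc m) := by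
    intro m
    induction m with
    | zero => exact ⟨h₀, fun _ _ => trivial⟩
    | succ m ih =>
      have hex : ∀ σ ∈ S (m + 1), ∃ w ∈ ch (Φ (m + 1) σ) (m + 1),
          F.bd m w = f m (E.bd m (Finsupp.single σ 1)) := by
        intro σ hσ
        refine hΦ.acyclic σ hσ m _ ?_ (ih.2 σ hσ)
        rw [bd_single, map_sum]
        refine Submodule.sum_mem _ fun i _ => ?_
        rw [map_smul]
        exact Submodule.smul_mem _ _ (ch_mono (hΦ.mono σ hσ i m)
          (ih.1 _ (hΦ.closed i σ hσ)))
      refine ⟨fun σ hσ => (hstep m σ (hex σ hσ)).1, fun σ hσ => ?_⟩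
      change F.bd m _ = 0
      have := ch_eqOn (S := S) (F.bd m ∘ₗ f (m + 1)) (f m ∘ₗ E.bd m)
        (fun σ hσ => (hstep m σ (hex σ hσ)).2)
        (bd_single_mem (fun i => hΦ.closed i σ hσ) : E.bd (m + 1) (Finsupp.single σ 1) ∈ _)
      simp only [LinearMap.comp_apply] at this
      rw [this, bd_bd, map_zero]
  refine ⟨f, rfl, fun m z hz => ?_, fun m σ hσ => (key m).1 σ hσ⟩
  refine ch_eqOn (S := S) (F.bd m ∘ₗ f (m + 1)) (f m ∘ₗ E.bd m) (fun σ hσ => (hstep m σ ?_).2) hz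
  refine hΦ.acyclic σ hσ m _ ?_ ((key m).2 σ hσ)
  rw [bd_single, map_sum]
  refine Submodule.sum_mem _ fun i _ => ?_
  rw [map_smul]
  exact Submodule.smul_mem _ _ (ch_mono (hΦ.mono σ hσ i m) ((key m).1 _ (hΦ.closed i σ hσ)))

/-- The same induction applies, since f σ - g σ - h ∂σ is a cycle in the acyclic carrier of σ. The
homotopy can start with 0 because `f` and `g` agree on the empty simplex. -/
theorem exists_chainHomotopy (hΦ : IsCarrier S Φ) {f g : ∀ m, E.Ch m →ₗ[ℤ] F.Ch m}
    (hf : IsChainMap S f) (hg : IsChainMap S g) (cf : CarriedBy S Φ f) (cg : CarriedBy S Φ g)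
    (h₀ : ∀ σ ∈ S 0, f 0 (Finsupp.single σ 1) = g 0 (Finsupp.single σ 1)) :
    ∃ h : ∀ m, E.Ch m →ₗ[ℤ] F.Ch (m + 1),
      (∀ m, ∀ σ ∈ S m, h m (Finsupp.single σ 1) ∈ ch (Φ m σ) (m + 1)) ∧
      ∀ m, ∀ z ∈ ch S (m + 1),
        F.bd (m + 1) (h (m + 1) z) = f (m + 1) z - g (m + 1) z - h m (E.bd m z) := by
  classical
  let step : ∀ m, (E.Ch m →ₗ[ℤ] F.Ch (m + 1)) → (E.Ch (m + 1) →ₗ[ℤ] F.Ch (m + 2)) := fun m k =>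
    Finsupp.lift _ ℤ _ fun σ =>
      if h : ∃ w ∈ ch (Φ (m + 1) σ) (m + 2), F.bd (m + 1) w = f (m + 1) (Finsupp.single σ 1) -
        g (m + 1) (Finsupp.single σ 1) - k (E.bd m (Finsupp.single σ 1))
      then h.choose else 0
  let h : ∀ m, E.Ch m →ₗ[ℤ] F.Ch (m + 1) := fun m => Nat.rec 0 step m
  have hstep : ∀ m σ, (∃ w ∈ ch (Φ (m + 1) σ) (m + 2), F.bd (m + 1) w =
      f (m + 1) (Finsupp.single σ 1) - g (m + 1) (Finsupp.single σ 1) -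
        h m (E.bd m (Finsupp.single σ 1)))
      → h (m + 1) (Finsupp.single σ 1) ∈ ch (Φ (m + 1) σ) (m + 2) ∧
        F.bd (m + 1) (h (m + 1) (Finsupp.single σ 1)) = f (m + 1) (Finsupp.single σ 1) -
          g (m + 1) (Finsupp.single σ 1) - h m (E.bd m (Finsupp.single σ 1)) := by
    intro m σ hh
    have : h (m + 1) (Finsupp.single σ 1) = hh.choose := by
      change step m (h m) _ = _
      simp only [step, Finsupp.lift_apply, Finsupp.sum_single_index, zero_smul, one_smul,
        dif_pos hh]
    rw [this]
    exact hh.choose_spec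
  have hex : ∀ m, (∀ σ ∈ S m, h m (Finsupp.single σ 1) ∈ ch (Φ m σ) (m + 1)) →
      (∀ z ∈ ch S m, z ∈ E.cyc m → F.bd m (h m z) = f m z - g m z) →
      ∀ σ ∈ S (m + 1), ∃ w ∈ ch (Φ (m + 1) σ) (m + 2), F.bd (m + 1) w =
      f (m + 1) (Finsupp.single σ 1) - g (m + 1) (Finsupp.single σ 1) -
        h m (E.bd m (Finsupp.single σ 1)) := by
    intro m h1 h2 σ hσ
    refine hΦ.acyclic σ hσ (m + 1) _ (Submodule.sub_mem _ (Submodule.sub_mem _ (cf _ σ hσ)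
      (cg _ σ hσ)) ?_) ?_
    · rw [bd_single, map_sum]
      refine Submodule.sum_mem _ fun i _ => ?_
      rw [map_smul]
      exact Submodule.smul_mem _ _ (ch_mono (hΦ.mono σ hσ i _) (h1 _ (hΦ.closed i σ hσ)))
    · change F.bd m _ = 0
      rw [map_sub, map_sub, hf m _ (single_mem_ch hσ), hg m _ (single_mem_ch hσ),
        h2 _ (bd_single_mem fun i => hΦ.closed i σ hσ) (bd_mem_cyc _ _), sub_self]
  have key : ∀ m, (∀ σ ∈ S m, h m (Finsupp.single σ 1) ∈ ch (Φ m σ) (m + 1)) ∧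
      (∀ z ∈ ch S m, z ∈ E.cyc m → F.bd m (h m z) = f m z - g m z) := by
    intro m
    induction m with
    | zero =>
      refine ⟨fun σ _ => ?_, fun z hz _ => ?_⟩
      · change (0 : E.Ch 0 →ₗ[ℤ] F.Ch 1) _ ∈ _
        simp
      · have := ch_eqOn (f 0) (g 0) h₀ hz
        change F.bd 0 ((0 : E.Ch 0 →ₗ[ℤ] F.Ch 1) z) = _
        simp [this]
    | succ m ih =>
      refine ⟨fun σ hσ => (hstep m σ (hex m ih.1 ih.2 σ hσ)).1, fun z hz hc => ?_⟩
      have := ch_eqOn (S := S) (F.bd (m + 1) ∘ₗ h (m + 1))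
        (f (m + 1) - g (m + 1) - h m ∘ₗ E.bd m)
        (fun σ hσ => (hstep m σ (hex m ih.1 ih.2 σ hσ)).2) hz
      have hc' : E.bd m z = 0 := hc
      simpa [hc'] using this
  refine ⟨h, fun m => (key m).1, fun m z hz => ?_⟩
  exact ch_eqOn (S := S) (F.bd (m + 1) ∘ₗ h (m + 1)) (f (m + 1) - g (m + 1) - h m ∘ₗ E.bd m)
    (fun σ hσ => (hstep m σ (hex m (key m).1 (key m).2 σ hσ)).2) hz

end Carriers

/-! ### Relative homology -/

section Relative

/-- Relative cycles. -/
noncomputable def relZ (S S' : E.Fam) (m : ℕ) : Submodule ℤ (E.Ch (m + 1)) :=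
  ch S (m + 1) ⊓ (ch S' m).comap (E.bd m)

/-- Relative boundaries. -/
noncomputable def relB (S S' : E.Fam) (m : ℕ) : Submodule ℤ (E.Ch (m + 1)) :=
  (ch S (m + 2)).map (E.bd (m + 1)) ⊔ ch S' (m + 1)

/-- Relative homology of a pair of families. -/
abbrev RelH (S S' : E.Fam) (m : ℕ) : Type v :=
  relZ S S' m ⧸ (relB S S' m).comap (relZ S S' m).subtype

/-- The class of a relative cycle. -/
noncomputable def relClass (S S' : E.Fam) (m : ℕ) : relZ S S' m →ₗ[ℤ] RelH S S' m :=
  Submodule.mkQ _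

/-- `f` is a chain map of pairs of families. -/
structure IsPairMap (S S' : E.Fam) (T T' : F.Fam) (f : ∀ m, E.Ch m →ₗ[ℤ] F.Ch m) : Prop where
  chain : IsChainMap S f
  map : ∀ m, ∀ z ∈ ch S m, f m z ∈ ch T m
  map' : ∀ m, ∀ z ∈ ch S' m, f m z ∈ ch T' m

variable {S S' : E.Fam} {T T' : F.Fam} {f : ∀ m, E.Ch m →ₗ[ℤ] F.Ch m}

theorem IsPairMap.relZ_le (hf : IsPairMap S S' T T' f) (m : ℕ) :
    relZ S S' m ≤ (relZ T T' m).comap (f (m + 1)) := fun z hz =>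
  ⟨hf.map _ z hz.1, by
    change F.bd m (f (m + 1) z) ∈ ch T' m
    rw [hf.chain m z hz.1]
    exact hf.map' m _ hz.2⟩

theorem IsPairMap.relB_le (hf : IsPairMap S S' T T' f) (m : ℕ) :
    relB S S' m ≤ (relB T T' m).comap (f (m + 1)) := by
  refine sup_le ?_ fun z hz => Submodule.mem_sup_right (hf.map' _ z hz)
  rintro _ ⟨w, hw, rfl⟩
  refine Submodule.mem_sup_left ⟨f (m + 2) w, hf.map _ w hw, ?_⟩
  exact hf.chain _ w hw

/-- The map induced in relative homology by a chain map of pairs. -/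
noncomputable def IsPairMap.relMap (hf : IsPairMap S S' T T' f) (m : ℕ) :
    RelH S S' m →ₗ[ℤ] RelH T T' m :=
  Submodule.mapQ _ _ ((f (m + 1)).restrict (hf.relZ_le m)) fun _ hz => hf.relB_le m hz

theorem IsPairMap.relMap_class (hf : IsPairMap S S' T T' f) (m : ℕ) (z : relZ S S' m) :
    hf.relMap m (relClass S S' m z) = relClass T T' m ⟨f (m + 1) z, hf.relZ_le m z.2⟩ := rfl

theorem relClass_surjective (S S' : E.Fam) (m : ℕ) : Function.Surjective (relClass S S' m) :=
  Submodule.mkQ_surjective _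

theorem relClass_eq_zero {m : ℕ} {z : relZ S S' m} :
    relClass S S' m z = 0 ↔ (z : E.Ch (m + 1)) ∈ relB S S' m :=
  Submodule.Quotient.mk_eq_zero _

theorem relClass_eq {m : ℕ} {z w : relZ S S' m} :
    relClass S S' m z = relClass S S' m w ↔ (z - w : E.Ch (m + 1)) ∈ relB S S' m := by
  rw [← sub_eq_zero, ← map_sub, relClass_eq_zero]
  rfl

theorem isPairMap_id {S S' T T' : E.Fam} (h : ∀ m, S m ⊆ T m) (h' : ∀ m, S' m ⊆ T' m) :
    IsPairMap S S' T T' fun _ => LinearMap.id :=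
  ⟨fun _ _ _ => rfl, fun _ _ hz => ch_mono (h _) hz, fun _ _ hz => ch_mono (h' _) hz⟩

/-- A chain homotopy gives relatively homologous cycles. -/
theorem sub_mem_relB {f g : ∀ m, E.Ch m →ₗ[ℤ] F.Ch m} {h : ∀ m, E.Ch m →ₗ[ℤ] F.Ch (m + 1)}
    (hb : ∀ m, ∀ z ∈ ch S (m + 1),
        F.bd (m + 1) (h (m + 1) z) = f (m + 1) z - g (m + 1) z - h m (E.bd m z))
    (hT : ∀ m, ∀ z ∈ ch S m, h m z ∈ ch T (m + 1)) (hT' : ∀ m, ∀ z ∈ ch S' m, h m z ∈ ch T' (m + 1))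
    {m : ℕ} {z : E.Ch (m + 1)} (hz : z ∈ relZ S S' m) :
    f (m + 1) z - g (m + 1) z ∈ relB T T' m := by
  have := hb m z hz.1
  rw [eq_sub_iff_add_eq] at this
  rw [← this]
  exact Submodule.add_mem_sup ⟨_, hT _ z hz.1, rfl⟩ (hT' _ _ hz.2)

end Relative

end FaceSystem

/-! ### Elements of the homology of a cokernel -/

section CokernelHomology

variable {A : Type} [Ring A] {C D C' D' : ChainComplex (ModuleCat.{u} A) ℕ} (φ : C ⟶ D) (φ' : C' ⟶ D') (n : ℕ)

/-- The cycles relative to a chain map. -/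
noncomputable def relCyc : Submodule A (D.X n) :=
  (LinearMap.range (φ.f ((ComplexShape.down ℕ).next n)).hom).comap
    (D.d n ((ComplexShape.down ℕ).next n)).hom

theorem cokernel_π_f_comp_eq_zero (i : ℕ) : φ.f i ≫ (cokernel.π φ).f i = 0 := by
  rw [← HomologicalComplex.comp_f, cokernel.condition, HomologicalComplex.zero_f]

theorem cokernel_π_f_surjective (i : ℕ) : Function.Surjective ((cokernel.π φ).f i).hom := by
  rw [← ModuleCat.epi_iff_surjective]
  infer_instance

theorem cokernel_π_f_eq_zero {i : ℕ} {b : D.X i} :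
    ((cokernel.π φ).f i).hom b = 0 ↔ b ∈ LinearMap.range (φ.f i).hom := by
  constructor
  · have hex : (ShortComplex.mk φ (cokernel.π φ) (cokernel.condition φ)).Exact :=
      ShortComplex.exact_cokernel φ
    have := hex.map (HomologicalComplex.eval (ModuleCat.{u} A) (ComplexShape.down ℕ) i)
    rw [ShortComplex.moduleCat_exact_iff] at this
    exact this b
  · rintro ⟨a, rfl⟩
    exact LinearMap.congr_fun (congrArg ModuleCat.Hom.hom (cokernel_π_f_comp_eq_zero φ i)) a

theorem relCyc_comp_d :
    (ModuleCat.ofHom (relCyc φ n).subtype ≫ (cokernel.π φ).f n) ≫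
      (cokernel φ).d n ((ComplexShape.down ℕ).next n) = 0 := by
  rw [Category.assoc, HomologicalComplex.Hom.comm]
  ext b
  exact (cokernel_π_f_eq_zero φ).2 b.2

/-- The class of a relative cycle in the homology of the cokernel. -/
noncomputable def cokernelClass : relCyc φ n →ₗ[A] (cokernel φ).homology n :=
  ((cokernel φ).liftCycles (ModuleCat.ofHom (relCyc φ n).subtype ≫ (cokernel.π φ).f n)
    ((ComplexShape.down ℕ).next n) rfl (relCyc_comp_d φ n) ≫ (cokernel φ).homologyπ n).hom

/-- A cycle of the quotient lifts to a chain of `D`, because the projection is onto in each degree;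
its boundary dies in the quotient, so the lift is a relative cycle. -/
theorem cokernelClass_surjective : Function.Surjective (cokernelClass φ n) := by
  intro y
  have hπ : Function.Surjective ((cokernel φ).homologyπ n).hom := by
    rw [← ModuleCat.epi_iff_surjective]; infer_instance
  obtain ⟨y, rfl⟩ := hπ y
  obtain ⟨b, hb⟩ := cokernel_π_f_surjective φ n (((cokernel φ).iCycles n).hom y)
  have hb' : b ∈ relCyc φ n := by
    change (D.d n ((ComplexShape.down ℕ).next n)).hom b ∈ LinearMap.range (φ.f _).hom
    rw [← cokernel_π_f_eq_zero]
    have h1 := LinearMap.congr_fun (congrArg ModuleCat.Hom.hom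
      ((cokernel.π φ).comm n ((ComplexShape.down ℕ).next n))) b
    have h2 := LinearMap.congr_fun (congrArg ModuleCat.Hom.hom
      ((cokernel φ).iCycles_d n ((ComplexShape.down ℕ).next n))) y
    simp only [ModuleCat.hom_comp, LinearMap.comp_apply] at h1 h2
    rw [← h1, hb, h2]
    rfl
  refine ⟨⟨b, hb'⟩, ?_⟩
  change ((cokernel φ).homologyπ n).hom _ = _
  congr 1
  have hi : Function.Injective ((cokernel φ).iCycles n).hom := by
    rw [← ModuleCat.mono_iff_injective]; infer_instance
  apply hi
  rw [← hb]
  exact LinearMap.congr_fun (congrArg ModuleCat.Hom.hom ((cokernel φ).liftCycles_i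
    (ModuleCat.ofHom (relCyc φ n).subtype ≫ (cokernel.π φ).f n)
    ((ComplexShape.down ℕ).next n) rfl (relCyc_comp_d φ n))) ⟨b, hb'⟩

/-- If the class bounds in the quotient, a lift of the bounding chain has the right boundary up to
an element killed by the projection, which comes from `C`. -/
theorem cokernelClass_eq_zero {b : relCyc φ n} : cokernelClass φ n b = 0 ↔
    (b : D.X n) ∈ LinearMap.range (D.d (n + 1) n).hom ⊔ LinearMap.range (φ.f n).hom := by
  have hi : Function.Injective ((cokernel φ).iCycles n).hom := by
    rw [← ModuleCat.mono_iff_injective]; infer_instance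
  have hex : (ShortComplex.mk ((cokernel φ).toCycles (n + 1) n) ((cokernel φ).homologyπ n)
      (by simp)).Exact :=
    ShortComplex.exact_of_g_is_cokernel _ ((cokernel φ).homologyIsCokernel (n + 1) n (by simp))
  rw [ShortComplex.moduleCat_exact_iff] at hex
  have hl := LinearMap.congr_fun (congrArg ModuleCat.Hom.hom ((cokernel φ).liftCycles_i
    (ModuleCat.ofHom (relCyc φ n).subtype ≫ (cokernel.π φ).f n)
    ((ComplexShape.down ℕ).next n) rfl (relCyc_comp_d φ n))) b
  simp only [ModuleCat.hom_comp, LinearMap.comp_apply] at hl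
  have hd : ∀ w : D.X (n + 1), ((cokernel φ).iCycles n).hom
      (((cokernel φ).toCycles (n + 1) n).hom (((cokernel.π φ).f (n + 1)).hom w)) =
      ((cokernel.π φ).f n).hom ((D.d (n + 1) n).hom w) := by
    intro w
    have h1 := LinearMap.congr_fun (congrArg ModuleCat.Hom.hom
      ((cokernel.π φ).comm (n + 1) n)) w
    have h2 := LinearMap.congr_fun (congrArg ModuleCat.Hom.hom
      ((cokernel φ).toCycles_i (n + 1) n)) (((cokernel.π φ).f (n + 1)).hom w)
    simp only [ModuleCat.hom_comp, LinearMap.comp_apply] at h1 h2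
    rw [h2, h1]
  constructor
  · intro h
    obtain ⟨q, hq⟩ := hex _ h
    obtain ⟨w, rfl⟩ := cokernel_π_f_surjective φ (n + 1) q
    have := congrArg ((cokernel φ).iCycles n).hom hq
    dsimp only at this
    replace this := ((hd w).symm.trans this).trans hl
    have h0 : ((cokernel.π φ).f n).hom ((b : D.X n) - (D.d (n + 1) n).hom w) = 0 := by
      rw [map_sub, this]; exact sub_self _
    rw [cokernel_π_f_eq_zero] at h0
    have := Submodule.add_mem_sup (LinearMap.mem_range_self (D.d (n + 1) n).hom w) h0
    rwa [add_sub_cancel] at this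
  · intro h
    obtain ⟨_, ⟨w, rfl⟩, a, ha, hb⟩ := Submodule.mem_sup.1 h
    have h0 := (cokernel_π_f_eq_zero φ).2 ha
    have : ((cokernel φ).toCycles (n + 1) n).hom (((cokernel.π φ).f (n + 1)).hom w) =
        ((cokernel φ).liftCycles (ModuleCat.ofHom (relCyc φ n).subtype ≫ (cokernel.π φ).f n)
          ((ComplexShape.down ℕ).next n) rfl (relCyc_comp_d φ n)).hom b := by
      apply hi
      rw [hd, hl]
      change _ = ((cokernel.π φ).f n).hom (b : D.X n)
      rw [← hb, map_add, h0, add_zero]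
    change ((cokernel φ).homologyπ n).hom _ = 0
    refine (congrArg ((cokernel φ).homologyπ n).hom this).symm.trans ?_
    exact LinearMap.congr_fun (congrArg ModuleCat.Hom.hom
      ((cokernel φ).toCycles_comp_homologyπ (n + 1) n)) _

variable {φ φ'}

theorem cokernelClass_naturality (g : Arrow.mk φ ⟶ Arrow.mk φ') (b : relCyc φ n)
    (b' : relCyc φ' n) (hb : (b' : D'.X n) = (g.right.f n).hom (b : D.X n)) :
    (HomologicalComplex.homologyMap ((coker _).map g) n).hom (cokernelClass φ n b) =
      cokernelClass φ' n b' := by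
  have hi : Function.Injective ((cokernel φ').iCycles n).hom := by
    rw [← ModuleCat.mono_iff_injective]; infer_instance
  have h1 := LinearMap.congr_fun (congrArg ModuleCat.Hom.hom (HomologicalComplex.homologyπ_naturality
    ((coker (ChainComplex (ModuleCat.{u} A) ℕ)).map g) n))
    (((cokernel φ).liftCycles (ModuleCat.ofHom (relCyc φ n).subtype ≫ (cokernel.π φ).f n)
          ((ComplexShape.down ℕ).next n) rfl (relCyc_comp_d φ n)).hom b)
  refine h1.trans ?_
  change ((cokernel φ').homologyπ n).hom _ = ((cokernel φ').homologyπ n).hom _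
  congr 1
  apply hi
  have h2 := LinearMap.congr_fun (congrArg ModuleCat.Hom.hom (HomologicalComplex.cyclesMap_i
    ((coker (ChainComplex (ModuleCat.{u} A) ℕ)).map g) n))
    (((cokernel φ).liftCycles (ModuleCat.ofHom (relCyc φ n).subtype ≫ (cokernel.π φ).f n)
          ((ComplexShape.down ℕ).next n) rfl (relCyc_comp_d φ n)).hom b)
  refine h2.trans ?_
  have h3 := LinearMap.congr_fun (congrArg ModuleCat.Hom.hom ((cokernel φ').liftCycles_i
    (ModuleCat.ofHom (relCyc φ' n).subtype ≫ (cokernel.π φ').f n)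
    ((ComplexShape.down ℕ).next n) rfl (relCyc_comp_d φ' n))) b'
  refine Eq.trans ?_ h3.symm
  have h4 := LinearMap.congr_fun (congrArg ModuleCat.Hom.hom ((cokernel φ).liftCycles_i
    (ModuleCat.ofHom (relCyc φ n).subtype ≫ (cokernel.π φ).f n)
    ((ComplexShape.down ℕ).next n) rfl (relCyc_comp_d φ n))) b
  have h5 : cokernel.π φ ≫ (coker (ChainComplex (ModuleCat.{u} A) ℕ)).map g =
      g.right ≫ cokernel.π φ' := cokernel.π_desc _ _ _
  have h6 := LinearMap.congr_fun (congrArg ModuleCat.Hom.hom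
    (congrArg (fun k => HomologicalComplex.Hom.f k n) h5)) (b : D.X n)
  change (((coker _).map g).f n).hom (((cokernel φ).iCycles n).hom _) = _
  have h4' : ((cokernel φ).iCycles n).hom (((cokernel φ).liftCycles
      (ModuleCat.ofHom (relCyc φ n).subtype ≫ (cokernel.π φ).f n)
          ((ComplexShape.down ℕ).next n) rfl (relCyc_comp_d φ n)).hom b) =
          ((cokernel.π φ).f n).hom (b : D.X n) := h4
  rw [h4']
  refine h6.trans ?_
  change ((cokernel.π φ').f n).hom ((g.right.f n).hom (b : D.X n)) =
    ((cokernel.π φ').f n).hom (b' : D'.X n)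
  rw [hb]

end CokernelHomology

/-! ### Homology of simplicial sets through face systems -/

section Transfer

open Simplicial FaceSystem

/-- An embedding of a simplicial set into a face system. -/
structure SSetEmbedding (B : SSet.{u}) (E : FaceSystem.{u}) where
  j : ∀ n : ℕ, B _⦋n⦌ → E.G (n + 1)
  inj : ∀ n, Function.Injective (j n)
  d_j : ∀ n (i : Fin (n + 2)) (σ : B _⦋n + 1⦌), E.d i (j (n + 1) σ) = j n (B.δ i σ)

namespace SSetEmbedding

variable {A B B' : SSet.{u}} {E : FaceSystem.{u}} (J : SSetEmbedding B E)
  (J' : SSetEmbedding B' E)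

/-- The generator of the chains given by a simplex. -/
noncomputable def gen {n : ℕ} (σ : B _⦋n⦌) : (intChains.obj B).X n :=
  (B.ιChainComplex (R := ModuleCat.of ℤ (ULift.{u} ℤ)) σ).hom (ULift.up 1)

theorem d_gen {n : ℕ} (σ : B _⦋n + 1⦌) : ((intChains.obj B).d (n + 1) n).hom (gen σ) =
    ∑ i : Fin (n + 2), (-1 : ℤ) ^ (i : ℕ) • gen (B.δ i σ) := by
  have := LinearMap.congr_fun (congrArg ModuleCat.Hom.hom
    (B.ιChainComplex_d (ModuleCat.of ℤ (ULift.{u} ℤ)) σ)) (ULift.up 1)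
  refine this.trans ?_
  simp only [ModuleCat.hom_sum, LinearMap.sum_apply]
  rfl

theorem map_gen (f : A ⟶ B) {n : ℕ} (σ : A _⦋n⦌) : ((intChains.map f).f n).hom (gen σ) =
    gen (f.app _ σ) :=
  LinearMap.congr_fun (congrArg ModuleCat.Hom.hom
    (SSet.ι_chainComplexMap_f _ _ f (ModuleCat.of ℤ (ULift.{u} ℤ)) σ)) (ULift.up 1)

/-- Linearity over `ℤ` is automatic, for any module structures. -/
def _root_.AddMonoidHom.toIntLinear {M N : Type*} [AddCommGroup M] [AddCommGroup N] [Module ℤ M]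
    [Module ℤ N] (f : M →+ N) : M →ₗ[ℤ] N where
  toFun := f
  map_add' := f.map_add
  map_smul' c x := by simpa using map_intCast_smul f ℤ ℤ c x

/-- Linearity over `ℤ` is automatic, for any module structures. -/
def _root_.AddEquiv.toIntLinear {M N : Type*} [AddCommGroup M] [AddCommGroup N] [Module ℤ M]
    [Module ℤ N] (f : M ≃+ N) : M ≃ₗ[ℤ] N where
  __ := f
  map_smul' c x := by simpa using map_intCast_smul f ℤ ℤ c x

/-- Additive maps are used throughout the transfer, so that different `ℤ`-module structures on the
same group never have to be compared. -/
theorem intChains_hom_ext {n : ℕ} {M : Type u} [AddCommGroup M]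
    {f g : (intChains.obj B).X n →+ M} (h : ∀ σ : B _⦋n⦌, f (gen σ) = g (gen σ)) : f = g := by
  have : ModuleCat.ofHom f.toIntLinear = ModuleCat.ofHom g.toIntLinear := by
    apply SSet.chainComplex_hom_ext (T := ModuleCat.of ℤ M)
    intro σ
    ext x
    have hx : x = (x.down : ℤ) • (ULift.up 1 : ULift.{u} ℤ) := by
      ext; simp
    have key : (ModuleCat.ofHom f.toIntLinear).hom
        ((B.ιChainComplex (R := ModuleCat.of ℤ (ULift.{u} ℤ)) σ).hom (ULift.up 1)) =
        (ModuleCat.ofHom g.toIntLinear).hom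
        ((B.ιChainComplex (R := ModuleCat.of ℤ (ULift.{u} ℤ)) σ).hom (ULift.up 1)) := h σ
    rw [hx]
    simp only [map_smul]
    congr 1
  ext x
  exact LinearMap.congr_fun (congrArg ModuleCat.Hom.hom this) x

/-- In each degree the chains are a coproduct of copies of the coefficients, one for each simplex.
-/
theorem exists_desc {n : ℕ} {M : Type u} [AddCommGroup M] (k : B _⦋n⦌ → M) :
    ∃ f : (intChains.obj B).X n →+ M, ∀ σ, f (gen σ) = k σ := by
  let g : (intChains.obj B).X n ⟶ ModuleCat.of ℤ M := Sigma.desc fun σ : B _⦋n⦌ =>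
    ModuleCat.ofHom ((LinearMap.toSpanSingleton ℤ M (k σ)).comp
      (ULift.moduleEquiv (R := ℤ) (M := ℤ)).toLinearMap)
  refine ⟨g.hom.toAddMonoidHom, fun σ => ?_⟩
  have : B.ιChainComplex (R := ModuleCat.of ℤ (ULift.{u} ℤ)) σ ≫ g = ModuleCat.ofHom
    ((LinearMap.toSpanSingleton ℤ M (k σ)).comp
      (ULift.moduleEquiv (R := ℤ) (M := ℤ)).toLinearMap) := Sigma.ι_desc _ _
  refine (LinearMap.congr_fun (congrArg ModuleCat.Hom.hom this) (ULift.up 1)).trans ?_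
  exact one_smul ℤ (k σ)

/-- The chains of a simplicial set as chains of a face system. -/
noncomputable def toCh (n : ℕ) : (intChains.obj B).X n →+ E.Ch (n + 1) :=
  (exists_desc fun σ => (Finsupp.single (J.j n σ) 1 : E.Ch (n + 1))).choose

theorem toCh_gen {n : ℕ} (σ : B _⦋n⦌) : J.toCh n (gen σ) = Finsupp.single (J.j n σ) 1 :=
  (exists_desc fun σ => (Finsupp.single (J.j n σ) 1 : E.Ch (n + 1))).choose_spec σ

open Classical in
/-- A retraction of `toCh`. -/
noncomputable def ofCh (n : ℕ) : E.Ch (n + 1) →+ (intChains.obj B).X n :=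
  Finsupp.liftAddHom fun τ => (zmultiplesHom _)
    (if h : ∃ σ, J.j n σ = τ then gen h.choose else 0)

theorem ofCh_single {n : ℕ} (σ : B _⦋n⦌) :
    J.ofCh n (Finsupp.single (J.j n σ) (1 : ℤ)) = gen σ := by
  have h : ∃ σ', J.j n σ' = J.j n σ := ⟨σ, rfl⟩
  have h' : h.choose = σ := J.inj n h.choose_spec
  rw [ofCh, Finsupp.liftAddHom_apply_single, dif_pos h, h']
  exact one_zsmul _

theorem ofCh_toCh (n : ℕ) (x : (intChains.obj B).X n) : J.ofCh n (J.toCh n x) = x := by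
  have : (J.ofCh n).comp (J.toCh n) = AddMonoidHom.id _ := by
    apply intChains_hom_ext
    intro σ
    rw [AddMonoidHom.comp_apply, toCh_gen, ofCh_single]
    rfl
  exact DFunLike.congr_fun this x

theorem toCh_injective (n : ℕ) : Function.Injective (J.toCh n) :=
  Function.LeftInverse.injective (g := J.ofCh n) (J.ofCh_toCh n)

theorem bd_toCh (n : ℕ) (x : (intChains.obj B).X (n + 1)) :
    E.bd (n + 1) (J.toCh (n + 1) x) = J.toCh n (((intChains.obj B).d (n + 1) n).hom x) := by
  have : (E.bd (n + 1)).toAddMonoidHom.comp (J.toCh (n + 1)) =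
      (J.toCh n).comp ((intChains.obj B).d (n + 1) n).hom.toAddMonoidHom := by
    apply intChains_hom_ext
    intro σ
    have h1 : (J.toCh n).comp ((intChains.obj B).d (n + 1) n).hom.toAddMonoidHom (gen σ) =
      J.toCh n (((intChains.obj B).d (n + 1) n).hom (gen σ)) := rfl
    have h2 : (E.bd (n + 1)).toAddMonoidHom.comp (J.toCh (n + 1)) (gen σ) =
      E.bd (n + 1) (J.toCh (n + 1) (gen σ)) := rfl
    rw [h1, h2, toCh_gen, d_gen, map_sum, bd_single]
    refine Finset.sum_congr rfl fun i _ => ?_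
    rw [map_zsmul, toCh_gen, J.d_j]
  exact DFunLike.congr_fun this x

theorem toCh_map (f : A ⟶ B) (I : SSetEmbedding A E)
    (hf : ∀ n σ, J.j n (f.app _ σ) = I.j n σ) (n : ℕ) (x : (intChains.obj A).X n) :
    J.toCh n (((intChains.map f).f n).hom x) = I.toCh n x := by
  have : (J.toCh n).comp ((intChains.map f).f n).hom.toAddMonoidHom = I.toCh n := by
    apply intChains_hom_ext
    intro σ
    have h1 : (J.toCh n).comp ((intChains.map f).f n).hom.toAddMonoidHom (gen σ) =
      J.toCh n (((intChains.map f).f n).hom (gen σ)) := rfl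
    rw [h1, map_gen, toCh_gen, toCh_gen, hf]
  exact DFunLike.congr_fun this x

/-- On generators coming from `B` the retraction `ofCh` is also a section of `toCh`, so the chains
of a face system supported on the image of `B` are exactly the chains of `B`. -/
theorem mem_ch_iff {S : E.Fam} {n : ℕ} (hS : S (n + 1) = range (J.j n)) (z : E.Ch (n + 1)) :
    z ∈ ch S (n + 1) ↔ ∃ x, J.toCh n x = z := by
  constructor
  · intro hz
    refine ⟨J.ofCh n z, ?_⟩
    refine ch_eqOn ((J.toCh n).comp (J.ofCh n)).toIntLinearMap LinearMap.id (fun τ hτ => ?_) hz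
    rw [hS] at hτ
    obtain ⟨σ, rfl⟩ := hτ
    exact (congrArg (J.toCh n) (J.ofCh_single σ)).trans (J.toCh_gen σ)
  · rintro ⟨x, rfl⟩
    have : (Submodule.mkQ (ch S (n + 1))).toAddMonoidHom.comp (J.toCh n) = 0 := by
      apply intChains_hom_ext
      intro σ
      have h1 : (Submodule.mkQ (ch S (n + 1))).toAddMonoidHom.comp (J.toCh n) (gen σ) =
        Submodule.Quotient.mk (J.toCh n (gen σ)) := rfl
      rw [h1, toCh_gen]
      refine (Submodule.Quotient.mk_eq_zero _).2 (single_mem_ch ?_)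
      rw [hS]
      exact mem_range_self σ
    exact (Submodule.Quotient.mk_eq_zero _).1 (DFunLike.congr_fun this x)

end SSetEmbedding

end Transfer

/-! ### Relative homology of simplicial pairs as relative cycles modulo relative boundaries. -/

section PairTransfer

open Simplicial FaceSystem

/-- Both targets are the quotient of `Z` by the same kernel. The two descriptions of relative
homology are compared in this way, as quotients of one group of relative cycles. -/
theorem exists_addEquiv_of_ker_eq {Z A B : Type*} [AddCommGroup Z] [AddCommGroup A] [AddCommGroup B]
    (p : Z →+ A) (q : Z →+ B) (hp : Function.Surjective p) (hq : Function.Surjective q)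
    (h : ∀ z, p z = 0 ↔ q z = 0) : ∃ e : A ≃+ B, ∀ z, e (p z) = q z := by
  have hk : p.ker = q.ker := by
    ext z
    rw [AddMonoidHom.mem_ker, AddMonoidHom.mem_ker, h]
  let e := (QuotientAddGroup.quotientKerEquivOfSurjective p hp).symm.trans
    ((QuotientAddGroup.quotientAddEquivOfEq hk).trans
      (QuotientAddGroup.quotientKerEquivOfSurjective q hq))
  refine ⟨e, fun z => ?_⟩
  have : (QuotientAddGroup.quotientKerEquivOfSurjective p hp).symm (p z) =
      QuotientAddGroup.mk z := by
    rw [AddEquiv.symm_apply_eq]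
    rfl
  simp only [e, AddEquiv.trans_apply, this]
  rfl

/-- An embedding of a pair of simplicial sets into a face system, with images `S` and `S'`. -/
structure PairEmbedding (f : Arrow SSet.{u}) {E : FaceSystem.{u}} (S S' : E.Fam) where
  J : SSetEmbedding f.right E
  I : SSetEmbedding f.left E
  comm : ∀ n σ, J.j n (f.hom.app _ σ) = I.j n σ
  range_J : ∀ n, S (n + 1) = range (J.j n)
  range_I : ∀ n, S' (n + 1) = range (I.j n)
  zero_I : S' 0 = univ

namespace PairEmbedding

variable {f g : Arrow SSet.{u}} {E : FaceSystem.{u}} {S S' T T' : E.Fam}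
  (Θ : PairEmbedding f S S') (Ξ : PairEmbedding g T T')

theorem toCh_mem (n : ℕ) (b : relCyc (intChains.map f.hom) n) :
    Θ.J.toCh n (b : (intChains.obj f.right).X n) ∈ relZ S S' n := by
  refine ⟨(Θ.J.mem_ch_iff (Θ.range_J n) _).2 ⟨_, rfl⟩, ?_⟩
  change E.bd n _ ∈ ch S' n
  cases n with
  | zero =>
    -- The empty simplex belongs to `S'`, so the augmentation imposes no condition and the homology
    -- in degree 0 is unreduced.
    rw [ch, Θ.zero_I, Finsupp.supported_univ]
    trivial
  | succ n =>
    rw [SSetEmbedding.bd_toCh, Θ.I.mem_ch_iff (Θ.range_I n)]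
    have hb : ((intChains.obj f.right).d (n + 1) ((ComplexShape.down ℕ).next (n + 1))).hom b ∈
      LinearMap.range ((intChains.map f.hom).f ((ComplexShape.down ℕ).next (n + 1))).hom := b.2
    have hn : (ComplexShape.down ℕ).next (n + 1) = n := by simp
    rw [hn] at hb
    obtain ⟨a, ha⟩ := hb
    refine ⟨a, ?_⟩
    rw [← Θ.J.toCh_map f.hom Θ.I Θ.comm n a]
    exact congrArg _ ha

theorem toCh_mem_relB (n : ℕ) (b : (intChains.obj f.right).X n) :
    Θ.J.toCh n b ∈ relB S S' n ↔
      b ∈ LinearMap.range ((intChains.obj f.right).d (n + 1) n).hom ⊔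
        LinearMap.range ((intChains.map f.hom).f n).hom := by
  constructor
  · intro h
    obtain ⟨_, ⟨w, hw, rfl⟩, y, hy, hb⟩ := Submodule.mem_sup.1 h
    obtain ⟨w, rfl⟩ := (Θ.J.mem_ch_iff (Θ.range_J _) _).1 hw
    obtain ⟨y, rfl⟩ := (Θ.I.mem_ch_iff (Θ.range_I _) _).1 hy
    rw [SSetEmbedding.bd_toCh, ← Θ.J.toCh_map f.hom Θ.I Θ.comm n y, ← map_add] at hb
    rw [← Θ.J.toCh_injective n hb]
    exact Submodule.add_mem_sup ⟨w, rfl⟩ ⟨y, rfl⟩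
  · intro h
    obtain ⟨_, ⟨w, rfl⟩, _, ⟨y, rfl⟩, rfl⟩ := Submodule.mem_sup.1 h
    rw [map_add, ← SSetEmbedding.bd_toCh, Θ.J.toCh_map f.hom Θ.I Θ.comm n y]
    exact Submodule.add_mem_sup ⟨_, (Θ.J.mem_ch_iff (Θ.range_J _) _).2 ⟨w, rfl⟩, rfl⟩
      ((Θ.I.mem_ch_iff (Θ.range_I _) _).2 ⟨y, rfl⟩)

/-- The class in relative homology of a relative cycle of the chains. -/
noncomputable def toRel (n : ℕ) : relCyc (intChains.map f.hom) n →+ RelH S S' n where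
  toFun b := relClass S S' n ⟨_, Θ.toCh_mem n b⟩
  map_zero' := by
    rw [relClass_eq_zero]
    change Θ.J.toCh n 0 ∈ _
    rw [map_zero]
    exact Submodule.zero_mem _
  map_add' a b := by
    rw [← map_add]
    congr 1
    ext1
    exact map_add (Θ.J.toCh n) _ _

theorem toRel_surjective (n : ℕ) : Function.Surjective (Θ.toRel n) := by
  intro y
  obtain ⟨⟨z, hz, hz'⟩, rfl⟩ := relClass_surjective _ _ _ y
  obtain ⟨b, rfl⟩ := (Θ.J.mem_ch_iff (Θ.range_J _) _).1 hz
  refine ⟨⟨b, ?_⟩, rfl⟩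
  change ((intChains.obj f.right).d n _).hom b ∈ LinearMap.range ((intChains.map f.hom).f _).hom
  cases n with
  | zero =>
    have : (intChains.obj f.right).d 0 ((ComplexShape.down ℕ).next 0) = 0 :=
      (intChains.obj f.right).shape _ _ (by simp)
    rw [this]
    exact Submodule.zero_mem _
  | succ n =>
    have hz'' : E.bd (n + 1) (Θ.J.toCh (n + 1) b) ∈ ch S' (n + 1) := hz'
    rw [SSetEmbedding.bd_toCh, Θ.I.mem_ch_iff (Θ.range_I n)] at hz''
    obtain ⟨a, ha⟩ := hz''
    rw [← Θ.J.toCh_map f.hom Θ.I Θ.comm n a] at ha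
    have : (ComplexShape.down ℕ).next (n + 1) = n := by simp
    rw [this]
    exact ⟨a, Θ.J.toCh_injective n ha⟩

theorem exists_equiv (n : ℕ) : ∃ e : RelH S S' n ≃+ (relHomology n).obj f,
    ∀ b, e (Θ.toRel n b) = cokernelClass (intChains.map f.hom) n b :=
  exists_addEquiv_of_ker_eq (Θ.toRel n) (cokernelClass (intChains.map f.hom) n).toAddMonoidHom
    (Θ.toRel_surjective n) (cokernelClass_surjective _ n) fun b => by
      have h1 : Θ.toRel n b = 0 ↔ _ := relClass_eq_zero
      have h2 : (cokernelClass (intChains.map f.hom) n).toAddMonoidHom b = 0 ↔ _ :=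
        cokernelClass_eq_zero _ n
      rw [h1, h2]
      exact Θ.toCh_mem_relB n b

/-- Relative homology of simplicial sets as relative homology of families. -/
noncomputable def equiv (n : ℕ) : RelH S S' n ≃+ (relHomology n).obj f := (Θ.exists_equiv n).choose

theorem equiv_toRel (n : ℕ) (b : relCyc (intChains.map f.hom) n) :
    Θ.equiv n (Θ.toRel n b) = cokernelClass (intChains.map f.hom) n b :=
  (Θ.exists_equiv n).choose_spec b

theorem equiv_naturality (k : f ⟶ g) (hk : ∀ n σ, Ξ.J.j n (k.right.app _ σ) = Θ.J.j n σ)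
    (h : ∀ m, S m ⊆ T m) (h' : ∀ m, S' m ⊆ T' m) (n : ℕ) (y : RelH S S' n) :
    ((relHomology n).map k).hom (Θ.equiv n y) =
      Ξ.equiv n ((isPairMap_id h h').relMap n y) := by
  obtain ⟨b, rfl⟩ := Θ.toRel_surjective n y
  have hb' : ((intChains.map k.right).f n).hom (b : (intChains.obj f.right).X n) ∈
      relCyc (intChains.map g.hom) n := by
    obtain ⟨b, a, ha⟩ := b
    refine ⟨((intChains.map k.left).f _).hom a, ?_⟩
    have h1 := LinearMap.congr_fun (congrArg ModuleCat.Hom.hom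
      ((intChains.map k.right).comm n ((ComplexShape.down ℕ).next n))) b
    have h2 : intChains.map k.left ≫ intChains.map g.hom =
        intChains.map f.hom ≫ intChains.map k.right := by
      rw [← Functor.map_comp, ← Functor.map_comp, Arrow.w]
    have h3 := LinearMap.congr_fun (congrArg ModuleCat.Hom.hom
      (congrArg (fun q => HomologicalComplex.Hom.f q ((ComplexShape.down ℕ).next n)) h2)) a
    refine h3.trans (Eq.trans ?_ h1.symm)
    exact congrArg ((intChains.map k.right).f _).hom ha
  rw [equiv_toRel]
  have h4 := cokernelClass_naturality (φ := intChains.map f.hom) (φ' := intChains.map g.hom) n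
    (intChains.mapArrow.map k) b ⟨_, hb'⟩ rfl
  refine h4.trans ?_
  rw [← equiv_toRel Ξ]
  congr 1
  refine (congrArg (relClass T T' n) (Subtype.ext ?_) :)
  exact Ξ.J.toCh_map k.right Θ.J hk n b

end PairEmbedding

end PairTransfer

/-! ### The face systems of singular simplices and of tuples of vertices. -/

section Systems

open FaceSystem

theorem Fin.succAbove_comp_succAbove_of_le {m : ℕ} {i j : Fin (m + 1)} (h : i ≤ j) :
    j.succ.succAbove ∘ i.succAbove = i.castSucc.succAbove ∘ j.succAbove := by
  funext k
  simp only [Function.comp_apply, Fin.succAbove, Fin.lt_def, Fin.le_def, Fin.ext_iff] at *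
  split_ifs <;> simp_all <;> omega

/-- The topological simplex with `m` vertices. -/
abbrev Simp (m : ℕ) : Type := stdSimplex ℝ (Fin m)

/-- The `i`-th face inclusion of topological simplices. -/
noncomputable def coface {m : ℕ} (i : Fin (m + 1)) : C(Simp m, Simp (m + 1)) :=
  ⟨stdSimplex.map i.succAbove, stdSimplex.continuous_map _⟩

theorem coface_comp_coface {m : ℕ} {i j : Fin (m + 1)} (h : i ≤ j) :
    (coface j.succ).comp (coface i) = (coface i.castSucc).comp (coface j) := by
  ext1 x
  change stdSimplex.map _ (stdSimplex.map _ x) = stdSimplex.map _ (stdSimplex.map _ x)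
  rw [stdSimplex.map_comp_apply, stdSimplex.map_comp_apply, Fin.succAbove_comp_succAbove_of_le h]

/-- Singular simplices. -/
noncomputable abbrev Sing (X : Type u) [TopologicalSpace X] : FaceSystem.{u} where
  G m := C(Simp m, X)
  d i τ := τ.comp (coface i)
  d_d i j h τ := by
    rw [ContinuousMap.comp_assoc, ContinuousMap.comp_assoc, coface_comp_coface h]

/-- Tuples. -/
abbrev Tup (V : Type u) : FaceSystem.{u} where
  G m := Fin m → V
  d i t := t ∘ i.succAbove
  d_d i j h t := by
    rw [Function.comp_assoc, Function.comp_assoc, Fin.succAbove_comp_succAbove_of_le h]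

variable {X : Type u} [TopologicalSpace X]

/-- The singular simplices whose image satisfies a condition. -/
def singFam (c : Set X → Prop) : (Sing X).Fam := fun m => {τ : C(Simp m, X) | c (range τ)}

theorem closed_singFam {c : Set X → Prop} (hc : ∀ s t, s ⊆ t → c t → c s) :
    Closed (singFam c) := by
  intro m i τ hτ
  refine hc _ _ ?_ hτ
  exact range_comp_subset_range (coface i) τ

/-- The singular simplices in a subset. -/
abbrev singIn (A : Set X) : (Sing X).Fam := singFam (· ⊆ A)

/-- Singular simplices of a subspace as singular simplices of the space. -/
noncomputable def singEmbedding (A : Set X) :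
    SSetEmbedding (TopCat.toSSet.obj (TopCat.of A)) (Sing X) where
  j n σ := (⟨Subtype.val, continuous_subtype_val⟩ : C(A, X)).comp (TopCat.toSSetObjEquiv _ _ σ)
  inj n σ τ h := by
    apply (TopCat.toSSetObjEquiv _ _).injective
    ext1 x
    exact Subtype.ext (DFunLike.congr_fun h x)
  d_j _ _ _ := rfl

theorem range_singEmbedding (A : Set X) (n : ℕ) :
    singIn A (n + 1) = range ((singEmbedding A).j n) := by
  ext τ
  constructor
  · intro h
    let τ' : C(Simp (n + 1), TopCat.of A) := ⟨fun x => ⟨(τ : C(Simp (n + 1), X)) x, h (mem_range_self x)⟩,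
      Continuous.subtype_mk (map_continuous (τ : C(Simp (n + 1), X))) _⟩
    refine ⟨(TopCat.toSSetObjEquiv _ (Opposite.op (SimplexCategory.mk n))).symm τ', ?_⟩
    change ContinuousMap.comp _ _ = _
    rw [Equiv.apply_symm_apply]
    rfl
  · rintro ⟨σ, rfl⟩
    rintro _ ⟨x, rfl⟩
    exact Subtype.coe_prop _

/-- Coordinates summing to 1 need at least one index. Hence there is exactly one singular simplex
without vertices, and it spans the augmentation. -/
instance : IsEmpty (Simp 0) := ⟨fun x => by simpa using x.2.2⟩

theorem singFam_zero {c : Set X → Prop} (hc : c ∅) : singFam c 0 = univ := by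
  refine eq_univ_of_forall fun τ => ?_
  change c (range (τ : C(Simp 0, X)))
  rwa [range_eq_empty]

/-- The pair `(A, A - U)` as a pair of families of singular simplices. -/
noncomputable def spacePairEmbedding (A U : Set X) :
    PairEmbedding (spacePair A U) (singIn A) (singIn (A \ U)) where
  J := singEmbedding A
  I := singEmbedding (A \ U)
  comm _ _ := rfl
  range_J := range_singEmbedding A
  range_I := range_singEmbedding _
  zero_I := singFam_zero (empty_subset _)

theorem singIn_mono {A B : Set X} (h : A ⊆ B) (m : ℕ) : singIn A m ⊆ singIn B m :=
  fun _ hτ => Subset.trans hτ h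

theorem spaceHMap_equiv (n : ℕ) {A U A' U' : Set X} (hA : A ⊆ A') (hU : U' ⊆ U)
    (y : RelH (singIn A) (singIn (A \ U)) n) :
    spaceHMap n hA hU ((spacePairEmbedding A U).equiv n y) =
      (spacePairEmbedding A' U').equiv n
        ((isPairMap_id (singIn_mono hA) (singIn_mono (sdiff_subset_sdiff hA hU))).relMap n y) :=
  (spacePairEmbedding A U).equiv_naturality (spacePairEmbedding A' U') (spacePairHom hA hU)
    (fun _ _ => rfl) (singIn_mono hA) (singIn_mono (sdiff_subset_sdiff hA hU)) n y

/-- The ordered simplices of an abstract simplicial complex. -/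
def complexFam {V : Type u} (L : PreAbstractSimplicialComplex V) : (Tup V).Fam :=
  fun m => {t : Fin m → V | m = 0 ∨ ∃ σ ∈ L.faces, ∀ i, t i ∈ σ}

theorem complexFam_mono {V : Type u} {L M : PreAbstractSimplicialComplex V} (h : L ≤ M) (m : ℕ) :
    complexFam L m ⊆ complexFam M m := by
  rintro t (h0 | ⟨σ, hσ, ht⟩)
  · exact Or.inl h0
  · exact Or.inr ⟨σ, h hσ, ht⟩

/-- Ordered simplices as tuples. -/
def tupEmbedding {V : Type u} (L : PreAbstractSimplicialComplex V) :
    SSetEmbedding (orderedSSet L) (Tup V) where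
  j _ σ := σ.1
  inj _ _ _ h := Subtype.ext h
  d_j _ _ _ := rfl

theorem range_tupEmbedding {V : Type u} (L : PreAbstractSimplicialComplex V) (n : ℕ) :
    complexFam L (n + 1) = range ((tupEmbedding L).j n) := by
  ext t
  constructor
  · rintro (h0 | h)
    · exact absurd h0 (Nat.succ_ne_zero n)
    · exact ⟨⟨t, h⟩, rfl⟩
  · rintro ⟨σ, rfl⟩
    exact Or.inr σ.2

/-- A pair of complexes as a pair of families of tuples. -/
def complexPairEmbedding {V : Type u} {L M : PreAbstractSimplicialComplex V} (h : L ≤ M) :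
    PairEmbedding (Arrow.mk (orderedSSetMap h)) (complexFam M) (complexFam L) where
  J := tupEmbedding M
  I := tupEmbedding L
  comm _ _ := rfl
  range_J := range_tupEmbedding M
  range_I := range_tupEmbedding L
  zero_I := eq_univ_of_forall fun _ => Or.inl rfl

theorem complexHMap_equiv (n : ℕ) {V : Type u} {L M L' M' : PreAbstractSimplicialComplex V}
    (h : L ≤ M) (h' : L' ≤ M') (hL : L ≤ L') (hM : M ≤ M')
    (y : RelH (complexFam M) (complexFam L) n) :
    complexHMap n h h' hL hM ((complexPairEmbedding h).equiv n y) =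
      (complexPairEmbedding h').equiv n
        ((isPairMap_id (complexFam_mono hM) (complexFam_mono hL)).relMap n y) :=
  (complexPairEmbedding h).equiv_naturality (complexPairEmbedding h') (complexPairHom h h' hL hM)
    (fun _ _ => rfl) (complexFam_mono hM) (complexFam_mono hL) n y

end Systems

/-! ### Cones over singular simplices and acyclicity of contractible sets. -/

section Cones

open FaceSystem

theorem coface_succAbove {m : ℕ} (i : Fin (m + 1)) (x : Simp m) (j : Fin m) :
    coface i x (i.succAbove j) = x j := by
  classical
  change (stdSimplex.map i.succAbove x) _ = _
  have := congrFun (stdSimplex.map_coe (S := ℝ) i.succAbove x) (i.succAbove j)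
  refine this.trans ?_
  rw [FunOnFinite.linearMap_apply_apply, Finset.sum_eq_single j]
  · intro k hk hkj
    simp only [Finset.mem_filter, Finset.mem_univ, true_and] at hk
    exact absurd (Fin.succAbove_right_injective hk) hkj
  · intro h
    simp at h

theorem coface_self {m : ℕ} (i : Fin (m + 1)) (x : Simp m) : coface i x i = 0 := by
  classical
  have := congrFun (stdSimplex.map_coe (S := ℝ) i.succAbove x) i
  refine this.trans ?_
  rw [FunOnFinite.linearMap_apply_apply]
  refine Finset.sum_eq_zero fun k hk => ?_
  simp only [Finset.mem_filter, Finset.mem_univ, true_and] at hk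
  exact absurd hk (Fin.succAbove_ne i k)

/-- The join parametrization of a simplex as a cone over its zeroth face. -/
noncomputable def coneMap (m : ℕ) : (Simp m × unitInterval) ⊕ Unit → Simp (m + 1)
  | Sum.inl (x, s) => ⟨Fin.cons (1 - (s : ℝ)) fun i => (s : ℝ) * x i, by
      constructor
      · intro i
        refine Fin.cases ?_ (fun j => ?_) i
        · simpa using s.2.2
        · rw [Fin.cons_succ]
          exact mul_nonneg s.2.1 (stdSimplex.zero_le x j)
      · rw [Fin.sum_univ_succ]
        have := x.2.2
        simp only [Fin.cons_zero, Fin.cons_succ, ← Finset.mul_sum]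
        rw [show ∑ i, x i = 1 from this]
        ring⟩
  | Sum.inr _ => ⟨Pi.single 0 1, single_mem_stdSimplex ℝ 0⟩

theorem coneMap_inl_zero {m : ℕ} (x : Simp m) (s : unitInterval) :
    coneMap m (Sum.inl (x, s)) 0 = 1 - (s : ℝ) := rfl

theorem coneMap_inl_succ {m : ℕ} (x : Simp m) (s : unitInterval) (i : Fin m) :
    coneMap m (Sum.inl (x, s)) i.succ = (s : ℝ) * x i := rfl

theorem coneMap_inr_zero {m : ℕ} (s : Unit) : coneMap m (Sum.inr s) 0 = 1 := by
  change (Pi.single 0 1 : Fin (m + 1) → ℝ) 0 = 1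
  simp

theorem coneMap_inr_succ {m : ℕ} (s : Unit) (i : Fin m) : coneMap m (Sum.inr s) i.succ = 0 := by
  change (Pi.single 0 1 : Fin (m + 1) → ℝ) i.succ = 0
  simp

theorem simp_ext_succAbove {m : ℕ} (i : Fin (m + 1)) {x y : Simp (m + 1)} (h : x i = y i)
    (h' : ∀ j, x (i.succAbove j) = y (i.succAbove j)) : x = y := by
  refine stdSimplex.ext (funext fun k => ?_)
  obtain rfl | ⟨j, rfl⟩ := Fin.eq_self_or_eq_succAbove i k
  · exact h
  · exact h' j

/-- A continuous surjection from a compact space to a Hausdorff space is a quotient map. The extra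
point in the source is needed for `m = 0`, where the product with the interval is empty but the cone
is a point. -/
theorem isQuotientMap_coneMap (m : ℕ) : IsQuotientMap (coneMap m) := by
  have hc : Continuous (coneMap m) := by
    refine continuous_sum_dom.2 ⟨?_, continuous_const⟩
    refine Continuous.subtype_mk (continuous_pi fun i => ?_) _
    refine Fin.cases ?_ (fun j => ?_) i
    · simp only [Fin.cons_zero]
      fun_prop
    · simp only [Fin.cons_succ]
      refine (continuous_subtype_val.comp continuous_snd).mul ?_
      exact (continuous_apply j).comp (continuous_subtype_val.comp continuous_fst)
  have : CompactSpace (Simp m) := isCompact_iff_compactSpace.1 (isCompact_stdSimplex ℝ (Fin m))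
  refine hc.isClosedMap.isQuotientMap hc fun y => ?_
  have hsum : y 0 + ∑ i : Fin m, y i.succ = 1 := by
    have := y.2.2
    rwa [Fin.sum_univ_succ] at this
  by_cases h0 : y 0 = 1
  · refine ⟨Sum.inr (), simp_ext_succAbove 0 (by rw [coneMap_inr_zero, h0]) fun j => ?_⟩
    simp only [Fin.succAbove_zero]
    rw [coneMap_inr_succ]
    have h1 : ∑ i : Fin m, y i.succ = 0 := by linarith
    rw [Finset.sum_eq_zero_iff_of_nonneg fun i _ => stdSimplex.zero_le y i.succ] at h1
    exact (h1 j (Finset.mem_univ j)).symm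
  · have hlt : 0 < 1 - y 0 := by
      have : y 0 ≤ 1 := stdSimplex.le_one y 0
      have := lt_of_le_of_ne this h0
      linarith
    have h0' : 0 ≤ y 0 := y.2.1 0
    refine ⟨Sum.inl (⟨fun i => y i.succ / (1 - y 0), fun i => div_nonneg (y.2.1 _) hlt.le, ?_⟩,
      ⟨1 - y 0, hlt.le, by linarith⟩), simp_ext_succAbove 0 ?_ fun j => ?_⟩
    · rw [← Finset.sum_div, div_eq_one_iff_eq hlt.ne']
      linarith
    · rw [coneMap_inl_zero]
      ring
    · simp only [Fin.succAbove_zero]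
      rw [coneMap_inl_succ]
      change (1 - y 0) * (y j.succ / (1 - y 0)) = _
      field_simp

/-- The parameter `s` is read off from the zeroth coordinate, and the point of the base from the
others unless `s = 0`; only the apex is hit more than once. -/
theorem coneMap_eq_cases {m : ℕ} {a b : (Simp m × unitInterval) ⊕ Unit}
    (h : coneMap m a = coneMap m b) :
    a = b ∨ ((∀ x s, a = Sum.inl (x, s) → s = 0) ∧ ∀ x s, b = Sum.inl (x, s) → s = 0) := by
  have h0 : coneMap m a 0 = coneMap m b 0 := by rw [h]
  have hs : ∀ i : Fin m, coneMap m a i.succ = coneMap m b i.succ := fun i => by rw [h]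
  rcases a with ⟨x, s⟩ | a <;> rcases b with ⟨y, t⟩ | b
  · rw [coneMap_inl_zero, coneMap_inl_zero] at h0
    have hst : s = t := Subtype.ext (by linarith)
    subst hst
    by_cases hs0 : s = 0
    · right
      subst hs0
      exact ⟨fun _ _ h => by injection h with h; injection h with h1 h2; exact h2.symm,
        fun _ _ h => by injection h with h; injection h with h1 h2; exact h2.symm⟩
    · left
      congr 2
      refine stdSimplex.ext (funext fun i => ?_)
      have := hs i
      rw [coneMap_inl_succ, coneMap_inl_succ] at this
      exact mul_left_cancel₀ (fun h => hs0 (Subtype.ext h)) this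
  · rw [coneMap_inl_zero, coneMap_inr_zero] at h0
    right
    refine ⟨fun _ _ h => ?_, fun _ _ h => by simp at h⟩
    injection h with h; injection h with h1 h2
    rw [← h2]
    exact Subtype.ext (by simpa using h0)
  · rw [coneMap_inl_zero, coneMap_inr_zero] at h0
    right
    refine ⟨fun _ _ h => by simp at h, fun _ _ h => ?_⟩
    injection h with h; injection h with h1 h2
    rw [← h2]
    exact Subtype.ext (by simpa using h0.symm)
  · exact Or.inl rfl

theorem coface_zero_eq {m : ℕ} (x : Simp m) : coface 0 x = coneMap m (Sum.inl (x, 1)) := by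
  refine simp_ext_succAbove 0 ?_ fun j => ?_
  · rw [coface_self, coneMap_inl_zero]; simp
  · rw [coface_succAbove, Fin.succAbove_zero, coneMap_inl_succ]; simp

theorem coface_succ_coneMap_inl {m : ℕ} (i : Fin (m + 1)) (x : Simp m) (s : unitInterval) :
    coface i.succ (coneMap m (Sum.inl (x, s))) = coneMap (m + 1) (Sum.inl (coface i x, s)) := by
  refine simp_ext_succAbove i.succ ?_ fun j => ?_
  · rw [coface_self, coneMap_inl_succ, coface_self, mul_zero]
  · rw [coface_succAbove]
    refine Fin.cases ?_ (fun j => ?_) j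
    · rw [Fin.succ_succAbove_zero, coneMap_inl_zero, coneMap_inl_zero]
    · rw [Fin.succ_succAbove_succ, coneMap_inl_succ, coneMap_inl_succ, coface_succAbove]

theorem coface_succ_coneMap_inr {m : ℕ} (i : Fin (m + 1)) (s : Unit) :
    coface i.succ (coneMap m (Sum.inr s)) = coneMap (m + 1) (Sum.inr s) := by
  refine simp_ext_succAbove i.succ ?_ fun j => ?_
  · rw [coface_self, coneMap_inr_succ]
  · rw [coface_succAbove]
    refine Fin.cases ?_ (fun j => ?_) j
    · rw [Fin.succ_succAbove_zero, coneMap_inr_zero, coneMap_inr_zero]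
    · rw [Fin.succ_succAbove_succ, coneMap_inr_succ, coneMap_inr_succ]

variable {X : Type u} [TopologicalSpace X]

/-- A contraction of `Y` to `z`. -/
structure IsContraction (Y : Set X) (z : X) (H : X → unitInterval → X) : Prop where
  cont : ContinuousOn (fun q : X × unitInterval => H q.1 q.2) (Y ×ˢ univ)
  mem : z ∈ Y
  map : ∀ y ∈ Y, ∀ s, H y s ∈ Y
  zero : ∀ y ∈ Y, H y 0 = z
  one : ∀ y ∈ Y, H y 1 = y

variable {Y : Set X} {z : X} {H : X → unitInterval → X}

/-- The homotopy along `τ` is constant at `s = 0`, which is the apex, so it factors through the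
quotient map `coneMap`. -/
theorem IsContraction.exists_cone (hH : IsContraction Y z H) {m : ℕ} (τ : C(Simp m, X))
    (hτ : range τ ⊆ Y) : ∃ κ : C(Simp (m + 1), X), range κ ⊆ Y ∧
      (∀ x s, κ (coneMap m (Sum.inl (x, s))) = H (τ x) s) ∧
      ∀ s, κ (coneMap m (Sum.inr s)) = z := by
  have hτ' : ∀ x, τ x ∈ Y := fun x => hτ (mem_range_self x)
  let g : C((Simp m × unitInterval) ⊕ Unit, X) := ⟨Sum.elim (fun q => H (τ q.1) q.2) fun _ => z, by
    refine Continuous.sumElim ?_ continuous_const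
    exact hH.cont.comp_continuous (f := fun q : Simp m × unitInterval => (τ q.1, q.2))
      (by fun_prop) fun q => ⟨hτ' _, trivial⟩⟩
  have hg : ∀ a, g a ∈ Y := by
    rintro (⟨x, s⟩ | s)
    · exact hH.map _ (hτ' x) s
    · exact hH.mem
  have hg0 : ∀ a : (Simp m × unitInterval) ⊕ Unit, (∀ x s, a = Sum.inl (x, s) → s = 0) →
      g a = z := by
    rintro (⟨x, s⟩ | s) h
    · have := h x s rfl
      subst this
      exact hH.zero _ (hτ' x)
    · rfl
  have hfac : Function.FactorsThrough g (coneMap m) := by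
    intro a b hab
    rcases coneMap_eq_cases hab with rfl | ⟨h1, h2⟩
    · rfl
    · rw [hg0 a h1, hg0 b h2]
  let q : C((Simp m × unitInterval) ⊕ Unit, Simp (m + 1)) :=
    ⟨coneMap m, (isQuotientMap_coneMap m).continuous⟩
  have hq : IsQuotientMap q := isQuotientMap_coneMap m
  have hlift : ∀ a, hq.lift g hfac (coneMap m a) = g a := fun a =>
    DFunLike.congr_fun (hq.lift_comp g hfac) a
  refine ⟨hq.lift g hfac, ?_, fun x s => hlift _, fun s => hlift _⟩
  rintro _ ⟨y, rfl⟩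
  obtain ⟨a, rfl⟩ := (isQuotientMap_coneMap m).surjective y
  rw [hlift]
  exact hg a

/-- The cones define a cone operator: on the face opposite to the apex the homotopy is the identity,
and coning commutes with the remaining faces. -/
theorem IsContraction.acyclic (hH : IsContraction Y z H) : Acyclic (singIn Y) := by
  classical
  let k : ∀ m, (Sing X).G m → (Sing X).G (m + 1) := fun m τ =>
    if h : range τ ⊆ Y then (hH.exists_cone τ h).choose else ContinuousMap.const _ z
  have hk : ∀ m (τ : C(Simp m, X)), range τ ⊆ Y → range (k m τ) ⊆ Y ∧
      (∀ x s, (k m τ) (coneMap m (Sum.inl (x, s))) = H (τ x) s) ∧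
      ∀ s, (k m τ) (coneMap m (Sum.inr s)) = z := by
    intro m τ h
    have : k m τ = (hH.exists_cone τ h).choose := dif_pos h
    rw [this]
    exact (hH.exists_cone τ h).choose_spec
  have hmem : ∀ m (τ : C(Simp m, X)), range τ ⊆ Y → ∀ x, τ x ∈ Y :=
    fun m τ h x => h (mem_range_self x)
  refine acyclic_of_cone k (fun m τ hτ => (hk m τ hτ).1) (fun m τ hτ => ?_) fun m τ hτ i => ?_
  · refine ContinuousMap.ext fun x => ?_
    change k m τ (coface 0 x) = _
    rw [coface_zero_eq, (hk m τ hτ).2.1, hH.one _ (hmem m τ hτ x)]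
  · have hτ' : range ((Sing X).d i τ) ⊆ Y := (range_comp_subset_range (coface i) τ).trans hτ
    refine ContinuousMap.ext fun y => ?_
    obtain ⟨a, rfl⟩ := (isQuotientMap_coneMap m).surjective y
    change k (m + 1) τ (coface i.succ _) = _
    rcases a with ⟨x, s⟩ | s
    · rw [coface_succ_coneMap_inl, (hk _ τ hτ).2.1, (hk _ _ hτ').2.1]
      rfl
    · rw [coface_succ_coneMap_inr, (hk _ τ hτ).2.2, (hk _ _ hτ').2.2]

end Cones

/-! ### Acyclicity of the fine singular simplices of a simplex. -/

section Subdivision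

open FaceSystem

/-! ### Fine simplices in a simplex -/

/-- The points of a simplex in a subset of the ambient space. -/
def simpSet {m : ℕ} (C : Set (Fin m → ℝ)) : Set (Simp m) := {x | (x : Fin m → ℝ) ∈ C}

/-- Straight segments to a fixed point of the convex set give a contraction. -/
theorem acyclic_simpSet {m : ℕ} {C : Set (Fin m → ℝ)} (hC : Convex ℝ C)
    (hne : (simpSet C).Nonempty) : Acyclic (singIn (simpSet C)) := by
  obtain ⟨z, hz⟩ := hne
  have hcomb : ∀ s : unitInterval, (s : ℝ) + (1 - s) = 1 := fun s => by ring
  let H : Simp m → unitInterval → Simp m := fun y s =>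
    ⟨(s : ℝ) • (y : Fin m → ℝ) + (1 - (s : ℝ)) • (z : Fin m → ℝ),
      convex_stdSimplex ℝ (Fin m) y.2 z.2 s.2.1 (sub_nonneg.2 s.2.2) (hcomb s)⟩
  refine IsContraction.acyclic (z := z) (H := H) ⟨?_, hz, fun y hy s => ?_, fun y _ => ?_, fun y _ => ?_⟩
  · refine Continuous.continuousOn (Continuous.subtype_mk ?_ _)
    have h1 : Continuous fun q : Simp m × unitInterval => (q.1 : Fin m → ℝ) :=
      continuous_subtype_val.comp continuous_fst
    have h2 : Continuous fun q : Simp m × unitInterval => (q.2 : ℝ) :=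
      continuous_subtype_val.comp continuous_snd
    exact (h2.smul h1).add ((continuous_const.sub h2).smul continuous_const)
  · exact hC hy hz s.2.1 (sub_nonneg.2 s.2.2) (hcomb s)
  · refine stdSimplex.ext ?_
    change ((0 : unitInterval) : ℝ) • (y : Fin m → ℝ) +
      (1 - ((0 : unitInterval) : ℝ)) • (z : Fin m → ℝ) = z
    simp
  · refine stdSimplex.ext ?_
    change ((1 : unitInterval) : ℝ) • (y : Fin m → ℝ) +
      (1 - ((1 : unitInterval) : ℝ)) • (z : Fin m → ℝ) = y
    simp

/-- The sets in `C` which are fine in the coordinates in `L`. -/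
def FineIn {m : ℕ} (η : ℝ) (L : Finset (Fin m)) (C : Set (Fin m → ℝ)) (T : Set (Simp m)) : Prop :=
  T ⊆ simpSet C ∧ ∀ j ∈ L, ∃ c : ℕ, ∀ y ∈ T, c * η ≤ y j ∧ y j ≤ (c + 2) * η

theorem FineIn.mono {m : ℕ} {η : ℝ} {L : Finset (Fin m)} {C : Set (Fin m → ℝ)}
    (S T : Set (Simp m)) (h : S ⊆ T) (hT : FineIn η L C T) : FineIn η L C S :=
  ⟨h.trans hT.1, fun j hj => (hT.2 j hj).imp fun _ hc y hy => hc y (h hy)⟩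

theorem singFam_or {X : Type u} [TopologicalSpace X] {c d e : Set X → Prop}
    (h : ∀ T, e T ↔ c T ∨ d T) : (singFam e) = fun m => singFam c m ∪ singFam d m := by
  funext m
  ext τ
  exact h _

theorem singFam_and {X : Type u} [TopologicalSpace X] {c d e : Set X → Prop}
    (h : ∀ T, e T ↔ c T ∧ d T) : (singFam e) = fun m => singFam c m ∩ singFam d m := by
  funext m
  ext τ
  exact h _

theorem convex_coord_le {m : ℕ} (j : Fin m) (b : ℝ) : Convex ℝ {y : Fin m → ℝ | y j ≤ b} :=
  convex_halfSpace_le (LinearMap.proj (R := ℝ) (φ := fun _ : Fin m => ℝ) j).isLinear b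

theorem convex_coord_ge {m : ℕ} (j : Fin m) (b : ℝ) : Convex ℝ {y : Fin m → ℝ | b ≤ y j} :=
  convex_halfSpace_ge (LinearMap.proj (R := ℝ) (φ := fun _ : Fin m => ℝ) j).isLinear b

/-- This takes the place of an explicit subdivision. Coordinates are treated one at a time, and for
each of them slabs are split off by Mayer-Vietoris. The intervals [cη, (c + 2)η] overlap by η, so a
set fine in a coordinate lies below (k + 2)η or above (k + 1)η: no fine simplex is lost. In the
upper slab and in the overlap, fineness in this coordinate is automatic, which leaves fewer
coordinates. -/
theorem acyclic_fineIn {m : ℕ} {η : ℝ} (hη : 0 < η) (L : Finset (Fin m)) :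
    ∀ C : Set (Fin m → ℝ), Convex ℝ C → (simpSet C).Nonempty →
      Acyclic (singFam (FineIn η L C)) := by
  induction L using Finset.induction_on with
  | empty =>
    intro C hC hne
    have : FineIn η ∅ C = (· ⊆ simpSet C) := by
      funext T
      simp [FineIn]
    rw [this]
    exact acyclic_simpSet hC hne
  | insert j L hj ih =>
    -- The inner induction is on the number of intervals needed to cover the values of the
    -- coordinate `j`; a single interval imposes no condition.
    have key : ∀ k : ℕ, ∀ C : Set (Fin m → ℝ), Convex ℝ C → (simpSet C).Nonempty →
        (∀ y ∈ simpSet C, y j ≤ (k + 2) * η) → Acyclic (singFam (FineIn η (insert j L) C)) := by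
      intro k
      induction k with
      | zero =>
        intro C hC hne hle
        have : FineIn η (insert j L) C = FineIn η L C := by
          funext T
          apply propext
          constructor
          · exact fun h => ⟨h.1, fun i hi => h.2 i (Finset.mem_insert_of_mem hi)⟩
          · refine fun h => ⟨h.1, fun i hi => ?_⟩
            obtain rfl | hi := Finset.mem_insert.1 hi
            · exact ⟨0, fun y hy => ⟨by simp, hle y (h.1 hy)⟩⟩
            · exact h.2 i hi
        rw [this]
        exact ih C hC hne
      | succ k ihk =>
        intro C hC hne hle
        let A := C ∩ {y | y j ≤ (k + 2) * η}
        let B := C ∩ {y | (k + 1) * η ≤ y j}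
        have hA : Convex ℝ A := hC.inter (convex_coord_le j _)
        have hB : Convex ℝ B := hC.inter (convex_coord_ge j _)
        have hsB : ∀ T : Set (Simp m), T ⊆ simpSet B → ∀ y ∈ T,
            ((k + 1 : ℕ) : ℝ) * η ≤ y j ∧ y j ≤ ((k + 1 : ℕ) + 2) * η := fun T hT y hy =>
          ⟨by push_cast; exact (hT hy).2, hle y (hT hy).1⟩
        have hBL : ∀ T, FineIn η (insert j L) B T ↔ FineIn η L B T := by
          intro T
          constructor
          · exact fun h => ⟨h.1, fun i hi => h.2 i (Finset.mem_insert_of_mem hi)⟩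
          · refine fun h => ⟨h.1, fun i hi => ?_⟩
            obtain rfl | hi := Finset.mem_insert.1 hi
            · exact ⟨k + 1, hsB T h.1⟩
            · exact h.2 i hi
        have hABL : ∀ T, FineIn η L (A ∩ B) T ↔
            FineIn η (insert j L) A T ∧ FineIn η (insert j L) B T := by
          intro T
          rw [hBL]
          constructor
          · refine fun h => ⟨⟨fun y hy => (h.1 hy).1, fun i hi => ?_⟩, fun y hy => (h.1 hy).2, h.2⟩
            obtain rfl | hi := Finset.mem_insert.1 hi
            · exact ⟨k + 1, hsB T fun y hy => (h.1 hy).2⟩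
            · exact h.2 i hi
          · exact fun h => ⟨fun y hy => ⟨h.1.1 hy, h.2.1 hy⟩, h.2.2⟩
        have hCAB : ∀ T, FineIn η (insert j L) C T ↔
            FineIn η (insert j L) A T ∨ FineIn η (insert j L) B T := by
          intro T
          constructor
          · intro h
            obtain ⟨c, hc⟩ := h.2 j (Finset.mem_insert_self j L)
            rcases Nat.lt_or_ge k c with hkc | hkc
            · right
              refine ⟨fun y hy => ⟨h.1 hy, le_trans ?_ (hc y hy).1⟩, h.2⟩
              have : ((k + 1 : ℕ) : ℝ) ≤ c := by exact_mod_cast hkc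
              push_cast at this
              gcongr
            · left
              refine ⟨fun y hy => ⟨h.1 hy, le_trans (hc y hy).2 ?_⟩, h.2⟩
              have : (c : ℝ) ≤ k := by exact_mod_cast hkc
              gcongr
          · rintro (h | h)
            · exact ⟨fun y hy => (h.1 hy).1, h.2⟩
            · exact ⟨fun y hy => (h.1 hy).1, h.2⟩
        by_cases hneA : (simpSet A).Nonempty
        · have hAac := ihk A hA hneA fun y hy => hy.2
          by_cases hneB : (simpSet B).Nonempty
          · have hneAB : (simpSet (A ∩ B)).Nonempty := by
              obtain ⟨a, ha⟩ := hneA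
              obtain ⟨b, hb⟩ := hneB
              by_cases ha' : (k + 1) * η ≤ a j
              · exact ⟨a, ha, ha.1, ha'⟩
              by_cases hb' : b j ≤ (k + 2) * η
              · exact ⟨b, ⟨hb.1, hb'⟩, hb⟩
              push Not at ha' hb'
              have hd : 0 < b j - a j := by nlinarith
              -- On the segment from `a` to `b` the coordinate `j` takes the value (k + 1)η at this
              -- parameter, and the point found there lies in both slabs.
              set s : ℝ := ((k + 1) * η - a j) / (b j - a j) with hs
              have hs0 : 0 ≤ s := div_nonneg (by linarith) hd.le
              have hs1 : s ≤ 1 := by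
                rw [hs, div_le_one hd]
                nlinarith
              have hmem := convex_stdSimplex ℝ (Fin m) a.2 b.2 (sub_nonneg.2 hs1) hs0 (by ring)
              have hmemC := hC ha.1 hb.1 (sub_nonneg.2 hs1) hs0 (by ring)
              have hval : (1 - s) * a j + s * b j = (k + 1) * η := by
                have : s * (b j - a j) = (k + 1) * η - a j := div_mul_cancel₀ _ hd.ne'
                linarith
              refine ⟨⟨_, hmem⟩, ⟨hmemC, ?_⟩, ⟨hmemC, ?_⟩⟩
              · change (1 - s) * a j + s * b j ≤ _
                rw [hval]
                nlinarith
              · change _ ≤ (1 - s) * a j + s * b j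
                rw [hval]
            rw [singFam_or hCAB]
            have hBac : Acyclic (singFam (FineIn η (insert j L) B)) := by
              rw [show FineIn η (insert j L) B = FineIn η L B from funext fun T => propext (hBL T)]
              exact ih B hB hneB
            refine hAac.union hBac (closed_singFam FineIn.mono) (closed_singFam FineIn.mono) ?_
            rw [← singFam_and hABL]
            exact ih _ (hA.inter hB) hneAB
          · have : ∀ y ∈ simpSet C, y j ≤ (k + 2) * η := by
              intro y hy
              by_contra h
              push Not at h
              exact hneB ⟨y, hy, by change _ ≤ y j; nlinarith⟩
            exact ihk C hC hne this
        · have hCB : FineIn η (insert j L) C = FineIn η L B := by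
            funext T
            apply propext
            rw [hCAB, ← hBL]
            refine ⟨fun h => h.elim (fun hA' => ⟨fun y hy => ?_, hA'.2⟩) id, Or.inr⟩
            exact absurd ⟨y, hA'.1 hy⟩ hneA
          rw [hCB]
          refine ih B hB ?_
          obtain ⟨y, hy⟩ := hne
          refine ⟨y, hy, ?_⟩
          by_contra h
          refine hneA ⟨y, hy, ?_⟩
          change ¬ (_ ≤ y j) at h
          change y j ≤ _
          nlinarith
    intro C hC hne
    -- Coordinates of points of a simplex are at most 1, so about 1/η intervals suffice.
    obtain ⟨k, hk⟩ := exists_nat_gt (1 / η)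
    refine key k C hC hne fun y _ => (stdSimplex.le_one y j).trans ?_
    rw [div_lt_iff₀ hη] at hk
    nlinarith

end Subdivision

/-! ### Natural operators on singular chains and a subdivision from acyclic models. -/

section NaturalOperators

open FaceSystem

theorem exists_dependent_seq {α : ℕ → Type*} (I : ∀ m, α m → Prop)
    (R : ∀ m, α m → α (m + 1) → Prop) (a₀ : α 0) (h₀ : I 0 a₀)
    (step : ∀ m a, I m a → ∃ b, I (m + 1) b ∧ R m a b) :
    ∃ s : ∀ m, α m, s 0 = a₀ ∧ ∀ m, I m (s m) ∧ R m (s m) (s (m + 1)) := by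
  choose f hf using step
  let s : ∀ m, {a : α m // I m a} := fun m =>
    Nat.rec ⟨a₀, h₀⟩ (fun m a => ⟨f m a.1 a.2, (hf m a.1 a.2).1⟩) m
  exact ⟨fun m => (s m).1, rfl, fun m => ⟨(s m).2, (hf m (s m).1 (s m).2).2⟩⟩

theorem ch_hom_ext {E : FaceSystem.{v}} {m : ℕ} {M : Type*} [AddCommGroup M]
    {f g : E.Ch m →ₗ[ℤ] M} (h : ∀ σ, f (Finsupp.single σ 1) = g (Finsupp.single σ 1)) : f = g :=
  Finsupp.lhom_ext' fun σ => LinearMap.ext_ring (h σ)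

variable {A B : Type*} [TopologicalSpace A] [TopologicalSpace B]

/-- The composition of a singular simplex with a continuous map. -/
def postcomp (κ : C(A, B)) {m : ℕ} (τ : (Sing A).G m) : (Sing B).G m :=
  ContinuousMap.comp κ (τ : C(Simp m, A))

/-- The map of singular chains induced by a continuous map. -/
noncomputable def push (κ : C(A, B)) (m : ℕ) : (Sing A).Ch m →ₗ[ℤ] (Sing B).Ch m :=
  Finsupp.lmapDomain ℤ ℤ (postcomp κ)

theorem push_single (κ : C(A, B)) (m : ℕ) (τ : (Sing A).G m) :
    push κ m (Finsupp.single τ 1) = Finsupp.single (postcomp κ τ) 1 := by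
  simp [push]

theorem bd_push (κ : C(A, B)) (m : ℕ) (z : (Sing A).Ch (m + 1)) :
    (Sing B).bd m (push κ (m + 1) z) = push κ m ((Sing A).bd m z) := by
  suffices h : (Sing B).bd m ∘ₗ push κ (m + 1) = push κ m ∘ₗ (Sing A).bd m from
    LinearMap.congr_fun h z
  refine ch_hom_ext fun σ => ?_
  rw [LinearMap.comp_apply, LinearMap.comp_apply, push_single, bd_single, bd_single, map_sum]
  refine Finset.sum_congr rfl fun i _ => ?_
  rw [map_smul, push_single]
  rfl

theorem push_mem {κ : C(A, B)} {m : ℕ} {S : (Sing A).Fam} {T : (Sing B).Fam}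
    (h : ∀ τ ∈ S m, postcomp κ τ ∈ T m) {z : (Sing A).Ch m} (hz : z ∈ ch S m) :
    push κ m z ∈ ch T m :=
  ch_induction _ _ (fun τ hτ => by rw [push_single]; exact single_mem_ch (h τ hτ)) hz

/-- The natural operator on singular chains with a given value on the universal simplex. -/
noncomputable def natOp (X : Type*) [TopologicalSpace X] {m k : ℕ} (a : (Sing (Simp m)).Ch k) :
    (Sing X).Ch m →ₗ[ℤ] (Sing X).Ch k :=
  Finsupp.lift _ ℤ _ fun τ : (Sing X).G m => push (τ : C(Simp m, X)) k a

/-- The universal singular simplex. -/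
noncomputable def univSimp (m : ℕ) : (Sing (Simp m)).Ch m :=
  Finsupp.single (ContinuousMap.id (Simp m) : (Sing (Simp m)).G m) 1

theorem natOp_single {X : Type*} [TopologicalSpace X] {m k : ℕ} (a : (Sing (Simp m)).Ch k)
    (τ : (Sing X).G m) : natOp X a (Finsupp.single τ 1) = push (τ : C(Simp m, X)) k a := by
  simp [natOp]

theorem push_push {D : Type*} [TopologicalSpace D] (κ : C(A, B)) (μ : C(B, D)) (m : ℕ)
    (z : (Sing A).Ch m) : push μ m (push κ m z) = push (μ.comp κ) m z := by
  suffices h : push μ m ∘ₗ push κ m = push (μ.comp κ) m from LinearMap.congr_fun h z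
  refine ch_hom_ext fun σ => ?_
  rw [LinearMap.comp_apply, push_single, push_single, push_single]
  rfl

theorem natOp_push {m k : ℕ} (a : (Sing (Simp m)).Ch k) (κ : C(A, B)) (z : (Sing A).Ch m) :
    natOp B a (push κ m z) = push κ k (natOp A a z) := by
  suffices h : natOp B a ∘ₗ push κ m = push κ k ∘ₗ natOp A a from LinearMap.congr_fun h z
  refine ch_hom_ext fun σ => ?_
  rw [LinearMap.comp_apply, LinearMap.comp_apply, push_single, natOp_single, natOp_single,
    push_push]
  rfl

theorem push_univSimp {m : ℕ} (τ : (Sing A).G m) :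
    push (τ : C(Simp m, A)) m (univSimp m) = Finsupp.single τ 1 := by
  rw [univSimp, push_single]
  rfl

theorem natOp_univSimp {m k : ℕ} (a : (Sing (Simp m)).Ch k) :
    natOp (Simp m) a (univSimp m) = a := by
  rw [univSimp, natOp_single]
  suffices h : push (ContinuousMap.id (Simp m)) k = LinearMap.id from LinearMap.congr_fun h a
  refine ch_hom_ext fun σ => ?_
  rw [push_single]
  rfl

theorem natOp_univSimp_eq {X : Type*} [TopologicalSpace X] (m : ℕ) (z : (Sing X).Ch m) :
    natOp X (univSimp m) z = z := by
  suffices h : natOp X (univSimp m) = LinearMap.id from LinearMap.congr_fun h z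
  refine ch_hom_ext fun σ => ?_
  rw [natOp_single, push_univSimp, LinearMap.id_apply]

/-- Natural linear operators agree if they agree on the universal simplex. -/
theorem natural_ext {X : Type*} [TopologicalSpace X] {m k : ℕ}
    (P Q : (Sing X).Ch m →ₗ[ℤ] (Sing X).Ch k) (P' Q' : (Sing (Simp m)).Ch m →ₗ[ℤ] (Sing (Simp m)).Ch k)
    (hP : ∀ (κ : C(Simp m, X)) z, P (push κ m z) = push κ k (P' z))
    (hQ : ∀ (κ : C(Simp m, X)) z, Q (push κ m z) = push κ k (Q' z))
    (h : P' (univSimp m) = Q' (univSimp m)) (z : (Sing X).Ch m) : P z = Q z := by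
  suffices h : P = Q from LinearMap.congr_fun h z
  refine ch_hom_ext fun σ => ?_
  rw [← push_univSimp σ, hP, hQ, h]

/-- Both sides are natural, so it suffices to compare them on the universal simplex, where the
equality is the hypothesis. -/
theorem natOp_chain {m : ℕ} {a : (Sing (Simp m)).Ch m} {b : (Sing (Simp (m + 1))).Ch (m + 1)}
    (h : (Sing (Simp (m + 1))).bd m b = natOp _ a ((Sing _).bd m (univSimp (m + 1))))
    {X : Type*} [TopologicalSpace X] (z : (Sing X).Ch (m + 1)) :
    (Sing X).bd m (natOp X b z) = natOp X a ((Sing X).bd m z) := by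
  refine natural_ext ((Sing X).bd m ∘ₗ natOp X b) (natOp X a ∘ₗ (Sing X).bd m)
    ((Sing _).bd m ∘ₗ natOp _ b) (natOp _ a ∘ₗ (Sing _).bd m) (fun κ z => ?_) (fun κ z => ?_) ?_ z
  · simp only [LinearMap.comp_apply, natOp_push, bd_push]
  · simp only [LinearMap.comp_apply, natOp_push, bd_push]
  · simp only [LinearMap.comp_apply, natOp_univSimp, h]

theorem natOp_homotopy {m : ℕ} {a : (Sing (Simp (m + 1))).Ch (m + 1)} {t : (Sing (Simp m)).Ch (m + 1)}
    {b : (Sing (Simp (m + 1))).Ch (m + 2)}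
    (h : (Sing (Simp (m + 1))).bd (m + 1) b =
      a - univSimp (m + 1) - natOp _ t ((Sing _).bd m (univSimp (m + 1))))
    {X : Type*} [TopologicalSpace X] (z : (Sing X).Ch (m + 1)) :
    (Sing X).bd (m + 1) (natOp X b z) = natOp X a z - z - natOp X t ((Sing X).bd m z) := by
  refine natural_ext ((Sing X).bd (m + 1) ∘ₗ natOp X b)
    (natOp X a - LinearMap.id - natOp X t ∘ₗ (Sing X).bd m)
    ((Sing _).bd (m + 1) ∘ₗ natOp _ b) (natOp _ a - LinearMap.id - natOp _ t ∘ₗ (Sing _).bd m)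
    (fun κ z => ?_) (fun κ z => ?_) ?_ z
  · simp only [LinearMap.comp_apply, natOp_push, bd_push]
  · simp only [LinearMap.comp_apply, LinearMap.sub_apply, LinearMap.id_apply, natOp_push, bd_push,
      map_sub]
  · simp only [LinearMap.comp_apply, LinearMap.sub_apply, LinearMap.id_apply, natOp_univSimp, h]

/-- A set is fine if every coordinate of a simplex varies little on it. -/
abbrev Fine (η : ℝ) {m : ℕ} (T : Set (Simp m)) : Prop :=
  FineIn η Finset.univ univ T

/-- A coface inserts a zero coordinate, which is fine with `c = 0`, and leaves the other coordinates
unchanged. -/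
theorem Fine.image_coface {η : ℝ} (hη : 0 < η) {m : ℕ} {T : Set (Simp m)} (h : Fine η T)
    (i : Fin (m + 1)) : Fine η (coface i '' T) := by
  refine ⟨fun _ _ => trivial, fun j _ => ?_⟩
  obtain rfl | ⟨j, rfl⟩ := Fin.eq_self_or_eq_succAbove i j
  · refine ⟨0, ?_⟩
    rintro _ ⟨y, _, rfl⟩
    rw [coface_self]
    exact ⟨by simp, by positivity⟩
  · obtain ⟨c, hc⟩ := h.2 j (Finset.mem_univ j)
    refine ⟨c, ?_⟩
    rintro _ ⟨y, hy, rfl⟩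
    rw [coface_succAbove]
    exact hc y hy

instance {m : ℕ} : Nonempty (Simp (m + 1)) := ⟨⟨Pi.single 0 1, single_mem_stdSimplex ℝ 0⟩⟩

theorem acyclic_fine {η : ℝ} (hη : 0 < η) (m : ℕ) :
    Acyclic (singFam (Fine η) : (Sing (Simp (m + 1))).Fam) :=
  acyclic_fineIn hη _ _ convex_univ ⟨Classical.arbitrary _, trivial⟩

theorem acyclic_simp (m : ℕ) : Acyclic (fun _ => univ : (Sing (Simp (m + 1))).Fam) := by
  have := acyclic_simpSet (C := (univ : Set (Fin (m + 1) → ℝ))) convex_univ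
    ⟨Classical.arbitrary _, trivial⟩
  convert this using 2 with k
  exact (eq_univ_of_forall fun τ y _ => trivial).symm

theorem natOp_bd_mem {η : ℝ} (hη : 0 < η) {m : ℕ} {a : (Sing (Simp m)).Ch m}
    (ha : a ∈ ch (singFam (Fine η)) m) :
    natOp _ a ((Sing _).bd m (univSimp (m + 1))) ∈ ch (singFam (Fine η)) m := by
  rw [univSimp, bd_single, map_sum]
  refine Submodule.sum_mem _ fun i _ => ?_
  rw [map_smul, natOp_single]
  refine Submodule.smul_mem _ _ (push_mem (fun τ hτ => ?_) ha)
  have := Fine.image_coface hη hτ i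
  change Fine η (range _)
  rw [← range_comp] at this
  exact this

/-- Acyclic models: `s (m + 1)` is a fine filling of the subdivided boundary of the universal
simplex, and `t (m + 1)` fills the defect between `s (m + 1)`, the simplex and the homotopy on its
boundary. As η is arbitrary, no subdivision has to be iterated. -/
theorem exists_subdivision {η : ℝ} (hη : 0 < η) :
    ∃ (s : ∀ m, (Sing (Simp m)).Ch m) (t : ∀ m, (Sing (Simp m)).Ch (m + 1)),
      s 0 = univSimp 0 ∧ t 0 = 0 ∧ (∀ m, s m ∈ ch (singFam (Fine η)) m) ∧
      (∀ m, (Sing (Simp (m + 1))).bd m (s (m + 1)) =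
        natOp _ (s m) ((Sing _).bd m (univSimp (m + 1)))) ∧
      ∀ m, (Sing (Simp (m + 1))).bd (m + 1) (t (m + 1)) =
        s (m + 1) - univSimp (m + 1) - natOp _ (t m) ((Sing _).bd m (univSimp (m + 1))) := by
  obtain ⟨s, hs0, hs⟩ := exists_dependent_seq (α := fun m => (Sing (Simp m)).Ch m)
    (fun m a => a ∈ ch (singFam (Fine η)) m ∧
      natOp _ a ((Sing _).bd m (univSimp (m + 1))) ∈ (Sing _).cyc m)
    (fun m a b => (Sing (Simp (m + 1))).bd m b = natOp _ a ((Sing _).bd m (univSimp (m + 1))))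
    (univSimp 0) ⟨single_mem_ch ⟨fun _ _ => trivial, fun j => j.elim0⟩, trivial⟩
    (fun m a ⟨ha, hc⟩ => by
      obtain ⟨b, hb, hb'⟩ := acyclic_fine hη m m _ (natOp_bd_mem hη ha) hc
      refine ⟨b, ⟨hb, ?_⟩, hb'⟩
      change (Sing _).bd m _ = 0
      rw [natOp_chain hb', bd_bd, map_zero])
  obtain ⟨t, ht0, ht⟩ := exists_dependent_seq (α := fun m => (Sing (Simp m)).Ch (m + 1))
    (fun m a => (Sing _).bd m (s (m + 1) - univSimp (m + 1) -
      natOp _ a ((Sing _).bd m (univSimp (m + 1)))) = 0)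
    (fun m a b => (Sing (Simp (m + 1))).bd (m + 1) b =
        s (m + 1) - univSimp (m + 1) - natOp _ a ((Sing _).bd m (univSimp (m + 1))))
    0 (by
      have h0 : natOp (Simp 1) (0 : (Sing (Simp 0)).Ch 1) = 0 := by
        ext; simp [natOp]
      rw [h0, LinearMap.zero_apply, sub_zero, map_sub, (hs 0).2, hs0, natOp_univSimp_eq, sub_self])
    (fun m a ha => by
      obtain ⟨b, -, hb⟩ := acyclic_simp m (m + 1) _ (by simp [ch]) ha
      refine ⟨b, ?_, hb⟩
      rw [map_sub, map_sub, (hs (m + 1)).2, natOp_homotopy hb, bd_bd, map_zero]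
      abel)
  exact ⟨s, t, hs0, ht0, fun m => (hs m).1.1, fun m => (hs m).2, fun m => (ht m).2⟩

end NaturalOperators

/-! ### The theorem on small singular simplices. -/

section SmallSimplices

open FaceSystem

variable {X : Type u}

/-- A condition on sets that is inherited by subsets. -/
def Hereditary (c : Set X → Prop) : Prop := ∀ S T, S ⊆ T → c T → c S

theorem Hereditary.and {c : Set X → Prop} (hc : Hereditary c) (A : Set X) :
    Hereditary fun T => c T ∧ T ⊆ A :=
  fun _ _ h h' => ⟨hc _ _ h h'.1, h.trans h'.2⟩

theorem hereditary_subset (A : Set X) : Hereditary fun T => T ⊆ A := fun _ _ h h' => h.trans h'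

variable [TopologicalSpace X]

theorem natOp_mem {m k : ℕ} {a : (Sing (Simp m)).Ch k} {b : Set (Simp m) → Prop}
    (ha : a ∈ ch (singFam b) k) {c : Set X → Prop} {z : (Sing X).Ch m}
    (hz : ∀ τ ∈ z.support, ∀ T, b T → c ((τ : C(Simp m, X)) '' T)) :
    natOp X a z ∈ ch (singFam c) k := by
  rw [natOp, Finsupp.lift_apply]
  refine Submodule.sum_mem _ fun τ hτ => Submodule.smul_mem _ _ (push_mem (fun κ hκ => ?_) ha)
  have := hz τ hτ _ hκ
  rw [← range_comp] at this
  exact this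

/-- A natural operator replaces a simplex by pieces of its own image. Hence every hereditary family
is preserved, and fine pieces are as small as the continuity of the simplex permits. -/
theorem exists_subdivisionOp (X : Type u) [TopologicalSpace X] {η : ℝ} (hη : 0 < η) :
    ∃ (s : ∀ m, (Sing X).Ch m →ₗ[ℤ] (Sing X).Ch m)
      (t : ∀ m, (Sing X).Ch m →ₗ[ℤ] (Sing X).Ch (m + 1)),
      (∀ z, s 0 z = z) ∧ (∀ z, t 0 z = 0) ∧
      (∀ m z, (Sing X).bd m (s (m + 1) z) = s m ((Sing X).bd m z)) ∧
      (∀ m z, (Sing X).bd (m + 1) (t (m + 1) z) = s (m + 1) z - z - t m ((Sing X).bd m z)) ∧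
      (∀ c : Set X → Prop, Hereditary c → ∀ m, ∀ z ∈ ch (singFam c) m,
        s m z ∈ ch (singFam c) m ∧ t m z ∈ ch (singFam c) (m + 1)) ∧
      ∀ (c : Set X → Prop) (m : ℕ) (z : (Sing X).Ch m),
        (∀ τ ∈ z.support, ∀ T, Fine η T → c ((τ : C(Simp m, X)) '' T)) →
        s m z ∈ ch (singFam c) m := by
  obtain ⟨s, t, hs0, ht0, hs, hs', ht⟩ := exists_subdivision hη
  refine ⟨fun m => natOp X (s m), fun m => natOp X (t m), fun z => ?_, fun z => ?_,
    fun m z => natOp_chain (hs' m) z, fun m z => natOp_homotopy (ht m) z,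
    fun c hc m z hz => ⟨?_, ?_⟩, fun c m z hz => natOp_mem (hs m) hz⟩
  · change natOp X (s 0) z = z
    rw [hs0, natOp_univSimp_eq]
  · have : natOp X (t 0) = 0 := by rw [ht0]; ext; simp [natOp]
    change natOp X (t 0) z = 0
    rw [this, LinearMap.zero_apply]
  · exact natOp_mem (b := fun _ => True) (fun _ _ => trivial)
      fun τ hτ T _ => hc _ _ (image_subset_range _ _) (hz hτ)
  · exact natOp_mem (b := fun _ => True) (fun _ _ => trivial)
      fun τ hτ T _ => hc _ _ (image_subset_range _ _) (hz hτ)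

/-- The condition `c` holds locally on `D`. -/
structure LocallyOn (D : Set X) (c : Set X → Prop) : Prop where
  hereditary : Hereditary c
  empty : c ∅
  nhds : ∀ y ∈ D, ∃ U ∈ 𝓝 y, c (U ∩ D)

variable {D : Set X} {c : Set X → Prop}

theorem LocallyOn.exists_fine (hc : LocallyOn D c) {m : ℕ} (τ : C(Simp m, X)) (hτ : range τ ⊆ D) :
    ∃ η₀ > 0, ∀ η, 0 < η → η ≤ η₀ → ∀ T, Fine η T → c (τ '' T) := by
  choose! U hU hcU using hc.nhds
  obtain ⟨V, hV, h⟩ := lebesgue_number_lemma_nhds (K := (univ : Set (Simp m)))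
    (U := fun y => τ ⁻¹' U (τ y)) isCompact_univ
    (fun y _ => τ.continuous.continuousAt (hU _ (hτ (mem_range_self y))))
  obtain ⟨δ, hδ, hδV⟩ := Metric.mem_uniformity_dist.1 hV
  -- Points of a fine set differ by at most 2η < δ in each coordinate, and δ is a Lebesgue number of
  -- the cover pulled back along `τ`.
  refine ⟨δ / 3, by positivity, fun η hη hη' T hT => ?_⟩
  obtain rfl | ⟨y, hy⟩ := T.eq_empty_or_nonempty
  · rw [image_empty]; exact hc.empty
  obtain ⟨y', hy'⟩ := h y trivial
  refine hc.hereditary _ _ ?_ (hcU (τ y') (hτ (mem_range_self _)))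
  rintro _ ⟨w, hw, rfl⟩
  refine ⟨hy' (hδV ?_), hτ (mem_range_self _)⟩
  refine lt_of_le_of_lt ((dist_pi_le_iff (r := 2 * η) (by positivity)).2 fun j => ?_)
    (by linarith : 2 * η < δ)
  obtain ⟨k, hk⟩ := hT.2 j (Finset.mem_univ j)
  have h1 := hk y hy
  have h2 := hk w hw
  change |y j - w j| ≤ _
  rw [abs_le]
  constructor <;> linarith [h1.1, h1.2, h2.1, h2.2]

theorem LocallyOn.exists_fine_chain (hc : LocallyOn D c) {m : ℕ} {z : (Sing X).Ch m}
    (hz : z ∈ ch (singIn D) m) : ∃ η₀ > 0, ∀ η, 0 < η → η ≤ η₀ →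
      ∀ τ ∈ z.support, ∀ T, Fine η T → c ((τ : C(Simp m, X)) '' T) := by
  classical
  have : ∀ F : Finset (C(Simp m, X)), (∀ τ ∈ F, range τ ⊆ D) → ∃ η₀ > 0, ∀ η, 0 < η → η ≤ η₀ →
      ∀ τ ∈ F, ∀ T, Fine η T → c (τ '' T) := by
    intro F
    induction F using Finset.induction_on with
    | empty => exact fun _ => ⟨1, one_pos, fun _ _ _ _ h => absurd h (Finset.notMem_empty _)⟩
    | insert τ F _ ih =>
      intro hF
      obtain ⟨η₁, h1, h1'⟩ := ih fun τ hτ => hF τ (Finset.mem_insert_of_mem hτ)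
      obtain ⟨η₂, h2, h2'⟩ := hc.exists_fine τ (hF τ (Finset.mem_insert_self _ _))
      refine ⟨min η₁ η₂, lt_min h1 h2, fun η hη hle τ' hτ' => ?_⟩
      obtain rfl | hτ' := Finset.mem_insert.1 hτ'
      · exact h2' η hη (hle.trans (min_le_right _ _))
      · exact h1' η hη (hle.trans (min_le_left _ _)) τ' hτ'
  exact this z.support fun τ hτ => hz hτ

/-- The singular simplices in `A` satisfying a condition. -/
abbrev singSmall (c : Set X → Prop) (A : Set X) : (Sing X).Fam := singFam fun T => c T ∧ T ⊆ A

theorem singSmall_subset (c : Set X → Prop) (A : Set X) (m : ℕ) : singSmall c A m ⊆ singIn A m :=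
  fun _ h => h.2

theorem LocallyOn.exists_fine_chain' (hc : LocallyOn D c) {A : Set X} (hA : A ⊆ D) {m : ℕ}
    {z : (Sing X).Ch m} (hz : z ∈ ch (singIn A) m) : ∃ η₀ > 0, ∀ η, 0 < η → η ≤ η₀ →
      ∀ τ ∈ z.support, ∀ T, Fine η T → c ((τ : C(Simp m, X)) '' T) ∧ (τ : C(Simp m, X)) '' T ⊆ A := by
  obtain ⟨η₀, h0, h⟩ := hc.exists_fine_chain (ch_mono (singIn_mono hA m) hz)
  exact ⟨η₀, h0, fun η hη hle τ hτ T hT => ⟨h η hη hle τ hτ T hT,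
    (image_subset_range _ _).trans (hz hτ)⟩⟩

/-- If `w` has boundary `z`, then so has s w - t z. The first term is small for η small, the second
because `z` is. -/
theorem acyclic_singSmall (hc : LocallyOn D c) {Y : Set X} (hY : Y ⊆ D) (h : Acyclic (singIn Y)) :
    Acyclic (singSmall c Y) := by
  intro m z hz hcyc
  obtain ⟨w, hw, hwz⟩ := h m z (ch_mono (singSmall_subset c Y m) hz) hcyc
  obtain ⟨η, hη, hfine⟩ := hc.exists_fine_chain' hY hw
  obtain ⟨s, t, hs0, ht0, hs, ht, hst, hsf⟩ := exists_subdivisionOp X hη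
  have hsw := hsf (fun T => c T ∧ T ⊆ Y) _ w (hfine η hη le_rfl)
  cases m with
  | zero => exact ⟨s 1 w, hsw, by rw [hs, hwz, hs0]⟩
  | succ m =>
    refine ⟨s (m + 2) w - t (m + 1) z,
      Submodule.sub_mem _ hsw (hst _ (hc.hereditary.and Y) _ z hz).2, ?_⟩
    have hz0 : (Sing X).bd m z = 0 := hcyc
    rw [map_sub, hs, ht, hwz, hz0, map_zero]
    abel

/-- A relative cycle is homologous to its subdivision through `t`, and `t` preserves all hereditary
families, in particular those of the small simplices and of the subspace. -/
theorem bijective_singSmall (hc : LocallyOn D c) {A A' : Set X} (hA : A ⊆ D) (hA' : A' ⊆ A)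
    (m : ℕ) : Function.Bijective ((isPairMap_id (singSmall_subset c A)
      (singSmall_subset c A')).relMap m) := by
  have hS := hc.hereditary.and A
  have hS' := hc.hereditary.and A'
  constructor
  · rw [injective_iff_map_eq_zero]
    intro y hy
    obtain ⟨⟨z, hz⟩, rfl⟩ := relClass_surjective _ _ _ y
    rw [IsPairMap.relMap_class, relClass_eq_zero] at hy
    rw [relClass_eq_zero]
    obtain ⟨_, ⟨w, hw, rfl⟩, v, hv, hwv⟩ := Submodule.mem_sup.1 hy
    change _ = z at hwv
    obtain ⟨η₁, h1, hf1⟩ := hc.exists_fine_chain' hA hw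
    obtain ⟨η₂, h2, hf2⟩ := hc.exists_fine_chain' (hA'.trans hA) hv
    obtain ⟨s, t, hs0, ht0, hs, ht, hst, hsf⟩ := exists_subdivisionOp X (lt_min h1 h2)
    have hsw := hsf (fun T => c T ∧ T ⊆ A) _ w (hf1 _ (lt_min h1 h2) (min_le_left _ _))
    have hsv := hsf (fun T => c T ∧ T ⊆ A') _ v (hf2 _ (lt_min h1 h2) (min_le_right _ _))
    -- From z = ∂w + v one gets s z = ∂(s w) + s v; the homotopy converts s z back into z, with all
    -- chains small.
    have hz1 : z = (Sing X).bd (m + 1) (s (m + 2) w - t (m + 1) z) +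
        (s (m + 1) v - t m ((Sing X).bd m z)) := by
      rw [map_sub, hs, ht]
      conv_lhs => rw [← sub_sub_cancel (s (m + 1) z) z]
      rw [← sub_eq_zero]
      have : s (m + 1) z = s (m + 1) ((Sing X).bd (m + 1) w) + s (m + 1) v := by
        rw [← map_add, hwv]
      rw [this]
      abel
    change z ∈ _
    rw [hz1]
    refine Submodule.add_mem_sup ⟨_, Submodule.sub_mem _ hsw (hst _ hS _ z hz.1).2, rfl⟩
      (Submodule.sub_mem _ hsv (hst _ hS' _ _ hz.2).2)
  · intro y
    obtain ⟨⟨z, hz⟩, rfl⟩ := relClass_surjective _ _ _ y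
    obtain ⟨η₁, h1, hf1⟩ := hc.exists_fine_chain' hA hz.1
    obtain ⟨η₂, h2, hf2⟩ := hc.exists_fine_chain' (hA'.trans hA) hz.2
    obtain ⟨s, t, hs0, ht0, hs, ht, hst, hsf⟩ := exists_subdivisionOp X (lt_min h1 h2)
    have hsz := hsf (fun T => c T ∧ T ⊆ A) _ z (hf1 _ (lt_min h1 h2) (min_le_left _ _))
    have hsb := hsf (fun T => c T ∧ T ⊆ A') _ _ (hf2 _ (lt_min h1 h2) (min_le_right _ _))
    refine ⟨relClass _ _ m ⟨s (m + 1) z, hsz, ?_⟩, ?_⟩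
    · change (Sing X).bd m (s (m + 1) z) ∈ ch (singSmall c A') m
      rw [hs]
      exact hsb
    · rw [IsPairMap.relMap_class, relClass_eq]
      change s (m + 1) z - z ∈ _
      have : s (m + 1) z - z = (Sing X).bd (m + 1) (t (m + 1) z) + t m ((Sing X).bd m z) := by
        rw [ht]; abel
      rw [this]
      exact Submodule.add_mem_sup ⟨_, (hst _ (hereditary_subset A) _ z hz.1).2, rfl⟩
        (hst _ (hereditary_subset A') _ _ hz.2).2

end SmallSimplices

/-! ### Geodesic contractions below the convexity radius. -/

section Geodesics

open FaceSystem

variable {X : Type u} [MetricSpace X]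

open Classical in
/-- A shortest path from `z` to `y`, if there is one. -/
noncomputable def geod (z y : X) : unitInterval → X :=
  if h : ∃ γ, IsShortestPath γ z y then h.choose else fun _ => z

theorem exists_stronglyConvex_of_lt_convAt {v : X} {a : ℝ} (h : (a : EReal) < convAt v) :
    ∃ δ > a, ∀ δ', 0 < δ' → δ' ≤ δ → StronglyConvex (Metric.ball v δ') := by
  obtain ⟨_, ⟨δ, hδ, rfl⟩, hlt⟩ := lt_sSup_iff.1 h
  exact ⟨δ, EReal.coe_lt_coe_iff.1 hlt, hδ⟩

/-- Uniqueness of shortest paths forces the chosen path `geod` to agree with the one provided by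
`A`. Thus one global function serves all strongly convex sets at once. -/
theorem stronglyConvex_geod {A : Set X} (hA : StronglyConvex A) :
    (∀ z ∈ A, ∀ y ∈ A, IsShortestPath (geod z y) z y ∧ ∀ s, geod z y s ∈ A) ∧
    ContinuousOn (fun q : X × X × unitInterval => geod q.1 q.2.1 q.2.2) (A ×ˢ A ×ˢ univ) := by
  obtain ⟨Γ, hΓ, hcont⟩ := hA
  have key : ∀ z ∈ A, ∀ y ∈ A, IsShortestPath (geod z y) z y ∧ geod z y = Γ z y := by
    intro z hz y hy
    have hex : ∃ γ, IsShortestPath γ z y := ⟨_, (hΓ z hz y hy).1⟩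
    have hsp : IsShortestPath (geod z y) z y := by
      rw [geod, dif_pos hex]
      exact hex.choose_spec
    exact ⟨hsp, (hΓ z hz y hy).2.1 _ hsp⟩
  refine ⟨fun z hz y hy => ⟨(key z hz y hy).1, fun s => ?_⟩, hcont.congr fun q hq => ?_⟩
  · rw [(key z hz y hy).2]
    exact (hΓ z hz y hy).2.2 s
  · rw [(key q.1 hq.1 q.2.1 hq.2.1).2]

theorem isShortestPath_geod {v z y : X} {a : ℝ} (h : (a : EReal) < convAt v)
    (hz : z ∈ Metric.closedBall v a) (hy : y ∈ Metric.closedBall v a) :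
    IsShortestPath (geod z y) z y := by
  obtain ⟨δ, hδ, hsc⟩ := exists_stronglyConvex_of_lt_convAt h
  have ha : 0 ≤ a := dist_nonneg.trans hz
  exact ((stronglyConvex_geod (hsc δ (ha.trans_lt hδ) le_rfl)).1 z (lt_of_le_of_lt hz hδ) y
    (lt_of_le_of_lt hy hδ)).1

/-- A closed ball is the intersection of the slightly larger open balls, and these are strongly
convex as long as their radius does not exceed some δ > a. -/
theorem geod_mem_closedBall {v z y : X} {a : ℝ} (h : (a : EReal) < convAt v)
    (hz : z ∈ Metric.closedBall v a) (hy : y ∈ Metric.closedBall v a) (s : unitInterval) :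
    geod z y s ∈ Metric.closedBall v a := by
  obtain ⟨δ, hδ, hsc⟩ := exists_stronglyConvex_of_lt_convAt h
  have ha : 0 ≤ a := dist_nonneg.trans hz
  change dist _ v ≤ a
  refine le_of_forall_gt_imp_ge_of_dense fun δ' hδ' => ?_
  rcases le_or_gt δ' δ with hle | hlt
  · exact le_of_lt (((stronglyConvex_geod (hsc δ' (ha.trans_lt hδ') hle)).1 z (lt_of_le_of_lt hz hδ') y
      (lt_of_le_of_lt hy hδ')).2 s)
  · exact (le_of_lt (((stronglyConvex_geod (hsc δ (ha.trans_lt hδ) le_rfl)).1 z (lt_of_le_of_lt hz hδ) y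
      (lt_of_le_of_lt hy hδ)).2 s)).trans hlt.le

/-- Geodesically star-shaped sets, covered by strongly convex balls containing the center, are
contractible. -/
theorem isContraction_geod {Y : Set X} {z : X} (hz : z ∈ Y)
    (hY : ∀ y ∈ Y, ∃ (v : X) (a : ℝ), (a : EReal) < convAt v ∧ z ∈ Metric.closedBall v a ∧
      y ∈ Metric.closedBall v a ∧ ∀ s, geod z y s ∈ Y) :
    IsContraction Y z (geod z) := by
  refine ⟨fun q hq => ?_, hz, fun y hy s => ?_, fun y hy => ?_, fun y hy => ?_⟩
  · obtain ⟨v, a, h, hzv, hyv, -⟩ := hY q.1 hq.1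
    obtain ⟨δ, hδ, hsc⟩ := exists_stronglyConvex_of_lt_convAt h
    have ha : 0 ≤ a := dist_nonneg.trans hzv
    have hc := (stronglyConvex_geod (hsc δ (ha.trans_lt hδ) le_rfl)).2
    have hc' : ContinuousOn (fun q : X × unitInterval => geod z q.1 q.2)
        (Metric.ball v δ ×ˢ univ) :=
      hc.comp (f := fun q : X × unitInterval => (z, q.1, q.2)) (by fun_prop)
        fun q hq => ⟨lt_of_le_of_lt hzv hδ, hq.1, trivial⟩
    -- Continuity is local: near the given point it is inherited from the strongly convex open ball
    -- around `v`, which also contains the centre `z`.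
    exact (hc'.continuousAt ((Metric.isOpen_ball.prod isOpen_univ).mem_nhds
      ⟨lt_of_le_of_lt hyv hδ, trivial⟩)).continuousWithinAt
  · obtain ⟨v, a, h, hzv, hyv, h'⟩ := hY y hy
    exact h' s
  · obtain ⟨v, a, h, hzv, hyv, h'⟩ := hY y hy
    exact (isShortestPath_geod h hzv hyv).1
  · obtain ⟨v, a, h, hzv, hyv, h'⟩ := hY y hy
    exact (isShortestPath_geod h hzv hyv).2.1

/-- A union of balls, centered at a common point. -/
theorem acyclic_iUnion_closedBall {ι : Type*} {f : ι → X} {a : ℝ} {z : X} (i₀ : ι)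
    (hz : ∀ i, dist z (f i) ≤ a) (hf : ∀ i, (a : EReal) < convAt (f i)) :
    Acyclic (singIn {y | ∃ i, dist y (f i) ≤ a}) :=
  (isContraction_geod (Y := {y | ∃ i, dist y (f i) ≤ a}) ⟨i₀, hz i₀⟩ fun _ ⟨i, hi⟩ =>
    ⟨f i, a, hf i, hz i, hi,
    fun s => ⟨i, geod_mem_closedBall (hf i) (hz i) hi s⟩⟩).acyclic

/-- Each ball contains the shortest paths between its points, so the intersection contracts along
geodesics to any of its points. -/
theorem acyclic_biInter_closedBall {σ : Set X} {a : ℝ} (hσ : σ.Nonempty)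
    (hne : ∃ z, ∀ v ∈ σ, dist z v ≤ a) (hf : ∀ v ∈ σ, (a : EReal) < convAt v) :
    Acyclic (singIn {y | ∀ v ∈ σ, dist y v ≤ a}) := by
  obtain ⟨z, hz⟩ := hne
  obtain ⟨v₀, hv₀⟩ := hσ
  exact (isContraction_geod (Y := {y | ∀ v ∈ σ, dist y v ≤ a}) hz fun y hy => ⟨v₀, a, hf v₀ hv₀,
    hz v₀ hv₀, hy v₀ hv₀, fun s v hv => geod_mem_closedBall (hf v hv) (hz v hv) (hy v hv) s⟩).acyclic

end Geodesics

/-! ### Simplicial chain maps and barycentric subdivision of tuples. -/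

section ChainMaps

open FaceSystem

/-! ### Simplicial maps -/

namespace FaceSystem

section SimplicialMap

variable {E : FaceSystem.{v}} {F : FaceSystem.{w}}

/-- The chain map of a map of simplices. -/
noncomputable def simpMap (f : ∀ m, E.G m → F.G m) (m : ℕ) : E.Ch m →ₗ[ℤ] F.Ch m :=
  Finsupp.lmapDomain ℤ ℤ (f m)

theorem simpMap_single (f : ∀ m, E.G m → F.G m) (m : ℕ) (σ : E.G m) :
    simpMap f m (Finsupp.single σ 1) = Finsupp.single (f m σ) 1 := by
  simp [simpMap]

theorem simpMap_mem {f : ∀ m, E.G m → F.G m} {S : E.Fam} {T : F.Fam} {m : ℕ}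
    (h : ∀ σ ∈ S m, f m σ ∈ T m) {z : E.Ch m} (hz : z ∈ ch S m) : simpMap f m z ∈ ch T m :=
  ch_induction _ _ (fun σ hσ => by rw [simpMap_single]; exact single_mem_ch (h σ hσ)) hz

theorem bd_simpMap {f : ∀ m, E.G m → F.G m}
    (hf : ∀ m (i : Fin (m + 1)) σ, F.d i (f (m + 1) σ) = f m (E.d i σ)) (m : ℕ)
    (z : E.Ch (m + 1)) : F.bd m (simpMap f (m + 1) z) = simpMap f m (E.bd m z) := by
  suffices h : F.bd m ∘ₗ simpMap f (m + 1) = simpMap f m ∘ₗ E.bd m from LinearMap.congr_fun h z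
  refine ch_hom_ext fun σ => ?_
  rw [LinearMap.comp_apply, LinearMap.comp_apply, simpMap_single, bd_single, bd_single, map_sum]
  refine Finset.sum_congr rfl fun i _ => ?_
  rw [map_smul, simpMap_single, hf]

theorem CarriedBy.map_mem {S S' : E.Fam} {Φ : ∀ m, E.G m → F.Fam} {T : F.Fam}
    {f : ∀ m, E.Ch m →ₗ[ℤ] F.Ch m} (hf : CarriedBy S Φ f) (hS : ∀ m, S' m ⊆ S m)
    (hT : ∀ m, ∀ σ ∈ S' m, Φ m σ m ⊆ T m) {m : ℕ} {z : E.Ch m} (hz : z ∈ ch S' m) :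
    f m z ∈ ch T m :=
  ch_induction _ _ (fun σ hσ => ch_mono (hT m σ hσ) (hf m σ (hS m hσ))) hz

/-- Two chain maps with a common acyclic carrier agree in relative homology. -/
theorem sub_mem_relB_of_carrier {S R' : E.Fam} {Φ : ∀ m, E.G m → F.Fam} {T T' : F.Fam}
    (hΦ : IsCarrier S Φ) {f g : ∀ m, E.Ch m →ₗ[ℤ] F.Ch m} (hf : IsChainMap S f)
    (hg : IsChainMap S g) (cf : CarriedBy S Φ f) (cg : CarriedBy S Φ g)
    (h₀ : ∀ σ ∈ S 0, f 0 (Finsupp.single σ 1) = g 0 (Finsupp.single σ 1))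
    (hR : ∀ m, R' m ⊆ S m) (hT : ∀ m, ∀ σ ∈ S m, Φ m σ (m + 1) ⊆ T (m + 1))
    (hT' : ∀ m, ∀ σ ∈ R' m, Φ m σ (m + 1) ⊆ T' (m + 1))
    {m : ℕ} {z : E.Ch (m + 1)} (hz : z ∈ relZ S R' m) :
    f (m + 1) z - g (m + 1) z ∈ relB T T' m := by
  obtain ⟨h, hc, hb⟩ := exists_chainHomotopy hΦ hf hg cf cg h₀
  exact sub_mem_relB hb
    (fun m z hz => ch_induction _ _ (fun σ hσ => ch_mono (hT m σ hσ) (hc m σ hσ)) hz)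
    (fun m z hz => ch_induction _ _ (fun σ hσ => ch_mono (hT' m σ hσ) (hc m σ (hR m hσ))) hz) hz

theorem IsPairMap.of_carriedBy {S R' : E.Fam} {Φ : ∀ m, E.G m → F.Fam} {T T' : F.Fam}
    {f : ∀ m, E.Ch m →ₗ[ℤ] F.Ch m} (hf : IsChainMap S f) (cf : CarriedBy S Φ f)
    (hR : ∀ m, R' m ⊆ S m) (hT : ∀ m, ∀ σ ∈ S m, Φ m σ m ⊆ T m)
    (hT' : ∀ m, ∀ σ ∈ R' m, Φ m σ m ⊆ T' m) : IsPairMap S R' T T' f :=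
  ⟨hf, fun _ _ hz => CarriedBy.map_mem cf (fun _ => subset_rfl) hT hz,
    fun _ _ hz => CarriedBy.map_mem cf hR hT' hz⟩

theorem IsPairMap.comp {G : FaceSystem.{u}} {S S' : E.Fam} {T T' : F.Fam} {U U' : G.Fam}
    {f : ∀ m, E.Ch m →ₗ[ℤ] F.Ch m} {g : ∀ m, F.Ch m →ₗ[ℤ] G.Ch m} (hg : IsPairMap T T' U U' g)
    (hf : IsPairMap S S' T T' f) : IsPairMap S S' U U' fun m => g m ∘ₗ f m :=
  ⟨fun m z hz => (hg.chain m _ (hf.map _ z hz)).trans (congrArg _ (hf.chain m z hz)),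
    fun m z hz => hg.map m _ (hf.map m z hz), fun m z hz => hg.map' m _ (hf.map' m z hz)⟩

end SimplicialMap

end FaceSystem

/-! ### Tuples -/

/-- The tuples with values in a set. -/
def tupIn {V : Type u} (A : Set V) : (Tup V).Fam := fun m => {t : Fin m → V | ∀ i, t i ∈ A}

/-- Prepending `v` is a cone operator. -/
theorem acyclic_cons {V : Type u} {S : (Tup V).Fam} (v : V)
    (h : ∀ m, ∀ t ∈ S m, (Fin.cons v t : Fin (m + 1) → V) ∈ S (m + 1)) : Acyclic S := by
  refine acyclic_of_cone (fun m t => (Fin.cons v t : Fin (m + 1) → V)) h (fun m t _ => ?_)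
    fun m t _ i => ?_
  · change (Fin.cons v t : Fin (m + 1) → V) ∘ Fin.succAbove 0 = t
    funext j
    simp
  · change (Fin.cons v t : Fin (m + 2) → V) ∘ i.succ.succAbove =
      (Fin.cons v (t ∘ i.succAbove) : Fin (m + 1) → V)
    funext j
    refine Fin.cases ?_ (fun j => ?_) j <;> simp

theorem acyclic_tupIn {V : Type u} {A : Set V} (hA : A.Nonempty) : Acyclic (tupIn A) := by
  obtain ⟨v, hv⟩ := hA
  exact acyclic_cons v fun m t ht i => Fin.cases hv ht i

/-! ### Subdivision of tuples -/

section Subdivide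

variable {V : Type u}

/-- Pairwise comparable tuples of finite sets. -/
def IsChainTup {m : ℕ} (σ : Fin m → Finset V) : Prop := ∀ i j, σ i ⊆ σ j ∨ σ j ⊆ σ i

theorem IsChainTup.comp {m k : ℕ} {σ : Fin m → Finset V} (h : IsChainTup σ) (f : Fin k → Fin m) :
    IsChainTup (σ ∘ f) := fun _ _ => h _ _

theorem IsChainTup.exists_min {m : ℕ} {σ : Fin (m + 1) → Finset V} (h : IsChainTup σ) :
    ∃ i, ∀ j, σ i ⊆ σ j := by
  obtain ⟨i, -, hi⟩ := Finset.exists_min_image Finset.univ (fun i => (σ i).card) ⟨0, Finset.mem_univ _⟩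
  refine ⟨i, fun j => (h i j).elim id fun hji => ?_⟩
  rw [Finset.eq_of_subset_of_card_le hji (hi j (Finset.mem_univ j))]

theorem IsChainTup.exists_max {m : ℕ} {σ : Fin (m + 1) → Finset V} (h : IsChainTup σ) :
    ∃ i, ∀ j, σ j ⊆ σ i := by
  obtain ⟨i, -, hi⟩ := Finset.exists_max_image Finset.univ (fun i => (σ i).card) ⟨0, Finset.mem_univ _⟩
  refine ⟨i, fun j => (h i j).elim (fun hij => ?_) id⟩
  rw [Finset.eq_of_subset_of_card_le hij (hi j (Finset.mem_univ j))]

/-- The carrier of the barycentric subdivision. -/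
def sdCarrier (m : ℕ) (t : Fin m → V) : (Tup (Finset V)).Fam := fun k =>
  {σ : Fin k → Finset V | (∀ j, (σ j).Nonempty ∧ (σ j : Set V) ⊆ range t) ∧ IsChainTup σ}

/-- The apex of the cone is the full vertex set of the tuple: it contains every member of every
flag, so it can be added to all of them. -/
theorem isCarrier_sdCarrier :
    IsCarrier (E := Tup V) (F := Tup (Finset V)) (fun _ => univ) sdCarrier := by
  classical
  refine ⟨fun _ _ _ _ => trivial, fun m t _ i k σ hσ => ⟨fun j => ⟨(hσ.1 j).1, ?_⟩, hσ.2⟩,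
    fun m t _ => acyclic_cons (Finset.univ.image t) fun k σ hσ => ⟨fun j => ?_, ?_⟩⟩
  · exact (hσ.1 j).2.trans (range_comp_subset_range i.succAbove t)
  · refine Fin.cases ?_ (fun j => ?_) j
    · simp only [Fin.cons_zero]
      exact ⟨Finset.univ_nonempty.image t, by simp⟩
    · simp only [Fin.cons_succ]
      exact hσ.1 j
  · have hle : ∀ j, σ j ⊆ Finset.univ.image t := fun j v hv => by
      obtain ⟨i, rfl⟩ := (hσ.1 j).2 hv
      exact Finset.mem_image_of_mem _ (Finset.mem_univ _)
    intro i j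
    refine Fin.cases ?_ (fun i => ?_) i
    · refine Fin.cases (Or.inl subset_rfl) (fun j => ?_) j
      simp only [Fin.cons_zero, Fin.cons_succ]
      exact Or.inr (hle j)
    · refine Fin.cases ?_ (fun j => ?_) j
      · simp only [Fin.cons_zero, Fin.cons_succ]
        exact Or.inl (hle i)
      · simp only [Fin.cons_succ]
        exact hσ.2 i j

variable (V) in
-- Only a chain map carried by flags is needed, so no formula is chosen. The empty tuple is sent to
-- the empty flag.
theorem exists_sd : ∃ l : ∀ m, (Tup V).Ch m →ₗ[ℤ] (Tup (Finset V)).Ch m,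
    l 0 = simpMap (E := Tup V) (F := Tup (Finset V)) (fun _ _ _ => ∅) 0 ∧
      IsChainMap (fun _ => univ) l ∧ CarriedBy (fun _ => univ) sdCarrier l := by
  refine exists_chainMap isCarrier_sdCarrier _ fun t _ => ?_
  rw [simpMap_single]
  exact single_mem_ch ⟨fun j => j.elim0, fun j => j.elim0⟩

/-- The barycentric subdivision of chains of tuples. -/
noncomputable def sdMap (V : Type u) : ∀ m, (Tup V).Ch m →ₗ[ℤ] (Tup (Finset V)).Ch m :=
  (exists_sd V).choose

theorem sdMap_zero (t : Fin 0 → V) (σ : Fin 0 → Finset V) :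
    sdMap V 0 (Finsupp.single t 1) = Finsupp.single σ 1 := by
  rw [sdMap, (exists_sd V).choose_spec.1, simpMap_single]
  exact congrArg (fun σ : Fin 0 → Finset V => Finsupp.single σ (1 : ℤ)) (Subsingleton.elim _ _)

theorem isChainMap_sdMap : IsChainMap (fun _ => univ) (sdMap V) := (exists_sd V).choose_spec.2.1

theorem carriedBy_sdMap : CarriedBy (fun _ => univ) sdCarrier (sdMap V) :=
  (exists_sd V).choose_spec.2.2

/-- The carrier of the identity. -/
def fullCarrier (m : ℕ) (t : Fin m → V) : (Tup V).Fam := tupIn (range t)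

theorem isCarrier_fullCarrier {S : (Tup V).Fam} (hS : Closed S) :
    IsCarrier (E := Tup V) (F := Tup V) S fullCarrier :=
  ⟨hS, fun _ _ _ _ _ _ hs j => range_comp_subset_range _ _ (hs j),
    fun _ _ _ => acyclic_tupIn (range_nonempty _)⟩

open Classical in
/-- A vertex of a finite set. -/
noncomputable def pick (v₀ : V) (σ : Finset V) : V := if h : σ.Nonempty then h.choose else v₀

theorem pick_mem {v₀ : V} {σ : Finset V} (h : σ.Nonempty) : pick v₀ σ ∈ σ := by
  rw [pick, dif_pos h]
  exact h.choose_spec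

/-- The simplicial map that picks a vertex. -/
noncomputable def pickMap (v₀ : V) : ∀ m, (Tup (Finset V)).Ch m →ₗ[ℤ] (Tup V).Ch m :=
  simpMap (E := Tup (Finset V)) (F := Tup V) fun _ σ => pick v₀ ∘ σ

theorem bd_pickMap (v₀ : V) (m : ℕ) (z : (Tup (Finset V)).Ch (m + 1)) :
    (Tup V).bd m (pickMap v₀ (m + 1) z) = pickMap v₀ m ((Tup (Finset V)).bd m z) :=
  bd_simpMap (E := Tup (Finset V)) (F := Tup V) (fun _ _ _ => rfl) m z

/-- Picking vertices of the members of a flag leads back to vertices of the original tuple. So the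
composite and the identity share the acyclic carrier of all tuples with values in the vertex set. -/
theorem pickMap_sdMap {v₀ : V} {S R' : (Tup V).Fam} (hS : Closed S) (hR : ∀ m, R' m ⊆ S m)
    {T T' : (Tup V).Fam} (hT : ∀ m, ∀ t ∈ S m, tupIn (range t) (m + 1) ⊆ T (m + 1))
    (hT' : ∀ m, ∀ t ∈ R' m, tupIn (range t) (m + 1) ⊆ T' (m + 1))
    {m : ℕ} {z : (Tup V).Ch (m + 1)} (hz : z ∈ relZ S R' m) :
    pickMap v₀ (m + 1) (sdMap V (m + 1) z) - z ∈ relB T T' m := by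
  refine sub_mem_relB_of_carrier (isCarrier_fullCarrier hS)
    (f := fun m => pickMap v₀ m ∘ₗ sdMap V m) (g := fun m => LinearMap.id)
    (fun m z _ => ?_) (fun m z _ => rfl) (fun m t _ => ?_) (fun m t _ => single_mem_ch fun i => mem_range_self i)
    (fun t _ => ?_) hR hT hT' hz
  · rw [LinearMap.comp_apply, bd_pickMap, isChainMap_sdMap m z (by simp [ch])]
    rfl
  · exact simpMap_mem (E := Tup (Finset V)) (F := Tup V) (S := sdCarrier m t) (T := tupIn (range t))
      (f := fun _ σ => pick v₀ ∘ σ)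
      (fun σ hσ i => (hσ.1 i).2 (pick_mem (hσ.1 i).1)) (carriedBy_sdMap m t trivial)
  · rw [LinearMap.comp_apply, sdMap_zero t (fun j => j.elim0), pickMap, simpMap_single]
    exact congrArg (fun σ : Fin 0 → V => Finsupp.single σ (1 : ℤ)) (Subsingleton.elim _ _)

end Subdivide

end ChainMaps

/-! ### The maps between Čech complexes and spaces. -/

section Nerves

open FaceSystem

variable {X : Type u} [MetricSpace X]

/-! ### The families attached to Čech complexes -/

/-- The tuples of points of `Q` contained in a ball of radius `a`. -/
def cechFam (a : ℝ) (Q : Set X) : (Tup X).Fam := fun m =>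
  {t : Fin m → X | (∀ i, t i ∈ Q) ∧ ∃ y, ∀ i, dist y (t i) ≤ a}

theorem mem_cech_iff {a : ℝ} {Q : Set X} {σ : Finset X} :
    σ ∈ (cech a Q).faces ↔ σ.Nonempty ∧ (σ : Set X) ⊆ Q ∧ ∃ y, ∀ v ∈ σ, dist y v ≤ a := by
  change _ ∧ _ ∧ _ ↔ _
  simp only [Set.Nonempty, mem_iInter, Metric.mem_closedBall]

theorem complexFam_cech [Nonempty X] (a : ℝ) (Q : Set X) : complexFam (cech a Q) = cechFam a Q := by
  classical
  funext m
  ext t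
  constructor
  · rintro (rfl | ⟨σ, hσ, ht⟩)
    · exact ⟨fun i => i.elim0, Classical.arbitrary X, fun i => i.elim0⟩
    · rw [mem_cech_iff] at hσ
      exact ⟨fun i => hσ.2.1 (ht i), hσ.2.2.imp fun y hy i => hy _ (ht i)⟩
  · rintro ⟨h1, y, h2⟩
    cases m with
    | zero => exact Or.inl rfl
    | succ m =>
      refine Or.inr ⟨Finset.univ.image t, mem_cech_iff.2 ⟨Finset.univ_nonempty.image t, ?_, y, ?_⟩,
        fun i => Finset.mem_image_of_mem _ (Finset.mem_univ _)⟩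
      · simpa [range_subset_iff] using h1
      · simpa using h2

theorem closed_cechFam (a : ℝ) (Q : Set X) : FaceSystem.Closed (cechFam a Q) :=
  fun _ i _ ht => ⟨fun j => ht.1 (i.succAbove j), ht.2.imp fun _ h j => h (i.succAbove j)⟩

theorem cechFam_mono {a b : ℝ} {Q Q' : Set X} (hab : a ≤ b) (hQ : Q ⊆ Q') (m : ℕ) :
    cechFam a Q m ⊆ cechFam b Q' m :=
  fun _ ht => ⟨fun i => hQ (ht.1 i), ht.2.imp fun _ h i => (h i).trans hab⟩

/-- Flags of simplices of a Čech complex. -/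
def sdFam (a : ℝ) (Q : Set X) : (Tup (Finset X)).Fam := fun m =>
  {σ : Fin m → Finset X | (∀ j, σ j ∈ (cech a Q).faces) ∧ IsChainTup σ}

theorem closed_sdFam (a : ℝ) (Q : Set X) : FaceSystem.Closed (sdFam a Q) :=
  fun _ i _ hσ => ⟨fun j => hσ.1 (i.succAbove j), hσ.2.comp _⟩

theorem sdFam_mono {a : ℝ} {Q Q' : Set X} (hQ : Q ⊆ Q') (m : ℕ) :
    sdFam a Q m ⊆ sdFam a Q' m :=
  fun _ ht => ⟨fun i => cech_mono a hQ (ht.1 i), ht.2⟩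

theorem sdCarrier_subset {a : ℝ} {Q : Set X} {m : ℕ} {t : Fin m → X} (ht : t ∈ cechFam a Q m)
    (k : ℕ) : sdCarrier m t k ⊆ sdFam a Q k := by
  refine fun σ hσ => ⟨fun j => mem_cech_iff.2 ⟨(hσ.1 j).1, fun v hv => ?_, ?_⟩, hσ.2⟩
  · obtain ⟨i, rfl⟩ := (hσ.1 j).2 hv
    exact ht.1 i
  · obtain ⟨y, hy⟩ := ht.2
    refine ⟨y, fun v hv => ?_⟩
    obtain ⟨i, rfl⟩ := (hσ.1 j).2 hv
    exact hy i

theorem isPairMap_sdMap {a : ℝ} {P Q : Set X} :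
    IsPairMap (cechFam a P) (cechFam a Q) (sdFam a P) (sdFam a Q) (sdMap X) :=
  ⟨fun m z _ => isChainMap_sdMap m z (by simp [ch]),
    fun m z hz => CarriedBy.map_mem carriedBy_sdMap (fun _ => subset_univ _)
      (fun m t ht => sdCarrier_subset ht m) hz,
    fun m z hz => CarriedBy.map_mem carriedBy_sdMap (fun _ => subset_univ _)
      (fun m t ht => sdCarrier_subset ht m) hz⟩

/-! ### Close simplices -/

/-- A map to a nearest point. -/
structure IsNearest (P : Set X) (q : X → X) : Prop where
  mem : ∀ y, q y ∈ P
  le : ∀ y, ∀ v ∈ P, dist y (q y) ≤ dist y v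

/-- The sets all of whose points are close to all nearest points. -/
def Close (q : X → X) (a : ℝ) (T : Set X) : Prop := ∀ y ∈ T, ∀ y' ∈ T, dist y (q y') ≤ a

variable {P : Set X} {q : X → X}

theorem IsNearest.locallyOn_close (hq : IsNearest P q) {a : ℝ} {D : Set X}
    (hD : ∀ y ∈ D, dist y (q y) < a) : LocallyOn D (Close q a) := by
  refine ⟨fun S T h hT y hy y' hy' => hT y (h hy) y' (h hy'), fun y hy => hy.elim, fun y₀ hy₀ => ?_⟩
  -- The triangle inequality passes between `y₀` and nearby points three times, once for `y` and
  -- twice for `y'`; each passage costs less than a third of the available margin.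
  have hr : 0 < (a - dist y₀ (q y₀)) / 3 := by linarith [hD y₀ hy₀]
  refine ⟨Metric.ball y₀ _, Metric.ball_mem_nhds y₀ hr, fun y hy y' hy' => ?_⟩
  have h1 : dist y y₀ < _ := hy.1
  have h2 : dist y' y₀ < _ := hy'.1
  have h3 := dist_triangle y y₀ (q y')
  have h4 := dist_triangle y₀ y' (q y')
  have h5 := hq.le y' (q y₀) (hq.mem _)
  have h6 := dist_triangle y' y₀ (q y₀)
  rw [dist_comm y₀ y'] at h4
  linarith

/-! ### Realization of flags -/

/-- The union of the intersections of the balls around the vertices of the members of a flag. -/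
def flagSet (a : ℝ) {m : ℕ} (σ : Fin m → Finset X) : Set X := {y | ∃ i, ∀ v ∈ σ i, dist y v ≤ a}

theorem dist_le_of_mem_flagSet {a : ℝ} {m : ℕ} {σ : Fin m → Finset X} {i : Fin m}
    (hi : ∀ j, σ i ⊆ σ j) {y : X} (hy : y ∈ flagSet a σ) : ∀ v ∈ σ i, dist y v ≤ a :=
  fun v hv => hy.elim fun j hj => hj v (hi j hv)

/-- Along a flag the intersections of balls are nested, so their union is the intersection that
belongs to the smallest member. -/
theorem acyclic_flagSet {a : ℝ} (hP : ∀ v ∈ P, (a : EReal) < convAt v) {m : ℕ}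
    {σ : Fin (m + 1) → Finset X} (hσ : σ ∈ sdFam a P (m + 1)) :
    Acyclic (singIn (flagSet a σ)) := by
  obtain ⟨i, hi⟩ := hσ.2.exists_min
  have : flagSet a σ = {y | ∀ v ∈ (σ i : Set X), dist y v ≤ a} :=
    Subset.antisymm (fun y hy => dist_le_of_mem_flagSet hi hy) fun y hy => ⟨i, hy⟩
  rw [this]
  obtain ⟨h1, h2, h3⟩ := mem_cech_iff.1 (hσ.1 i)
  exact acyclic_biInter_closedBall h1 h3 fun v hv => hP v (h2 hv)

theorem IsNearest.dist_le_of_mem_flagSet (hq : IsNearest P q) {a : ℝ} {m : ℕ}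
    {σ : Fin m → Finset X} (hσ : σ ∈ sdFam a P m) {y : X} (hy : y ∈ flagSet a σ) :
    ∃ v, (∃ i, v ∈ σ i) ∧ v ∈ P ∧ dist y v ≤ a ∧ dist y (q y) ≤ a := by
  obtain ⟨i, hi⟩ := hy
  obtain ⟨⟨v, hv⟩, h2, -⟩ := mem_cech_iff.1 (hσ.1 i)
  exact ⟨v, ⟨i, hv⟩, h2 hv, hi v hv, (hq.le y v (h2 hv)).trans (hi v hv)⟩

/-- The carrier of the realization of flags. -/
def realCarrier (q : X → X) (a b : ℝ) (m : ℕ) (σ : Fin m → Finset X) : (Sing X).Fam :=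
  singSmall (Close q b) (flagSet a σ)

/-- Points of `flagSet a σ` have a sample point within a < b, so closeness at scale `b` holds
locally there and the restriction to close simplices keeps acyclicity. Closeness is built into the
carrier so that `vertMap` can be applied to a realization. -/
theorem IsNearest.isCarrier_realCarrier (hq : IsNearest P q) {a b : ℝ} (hab : a < b)
    (hP : ∀ v ∈ P, (a : EReal) < convAt v) :
    IsCarrier (E := Tup (Finset X)) (F := Sing X) (sdFam a P) (realCarrier q a b) := by
  refine ⟨closed_sdFam a P, fun m σ _ i k τ hτ => ⟨hτ.1, hτ.2.trans ?_⟩, fun m σ hσ => ?_⟩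
  · rintro y ⟨j, hj⟩
    exact ⟨i.succAbove j, hj⟩
  · refine acyclic_singSmall (hq.locallyOn_close (D := flagSet a σ) fun y hy => ?_) subset_rfl
      (acyclic_flagSet hP hσ)
    obtain ⟨v, -, -, -, h⟩ := hq.dist_le_of_mem_flagSet hσ hy
    exact h.trans_lt hab

instance (X : Type u) [TopologicalSpace X] : Subsingleton ((Sing X).G 0) :=
  ⟨fun _ _ => ContinuousMap.ext fun y => isEmptyElim (α := Simp 0) y⟩

theorem mem_singFam_zero {X : Type u} [TopologicalSpace X] {c : Set X → Prop} (hc : c ∅)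
    (τ : (Sing X).G 0) : τ ∈ singFam c 0 := by
  rw [singFam_zero hc]
  trivial

/-- A realization of flags by small singular chains. -/
structure IsRealization (P : Set X) (q : X → X) (a b : ℝ)
    (f : ∀ m, (Tup (Finset X)).Ch m →ₗ[ℤ] (Sing X).Ch m) : Prop where
  zero : ∀ σ τ, f 0 (Finsupp.single σ 1) = Finsupp.single τ 1
  chain : IsChainMap (sdFam a P) f
  carried : CarriedBy (sdFam a P) (realCarrier q a b) f

theorem IsNearest.exists_realization [Nonempty X] (hq : IsNearest P q) {a b : ℝ} (hab : a < b)
    (hP : ∀ v ∈ P, (a : EReal) < convAt v) : ∃ f, IsRealization P q a b f := by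
  obtain ⟨f, h0, h1, h2⟩ := exists_chainMap (hq.isCarrier_realCarrier hab hP)
    (simpMap (E := Tup (Finset X)) (F := Sing X)
      (fun _ _ => ContinuousMap.const _ (Classical.arbitrary X)) 0) fun σ _ => by
    rw [simpMap_single]
    exact single_mem_ch (mem_singFam_zero (c := fun T => Close q b T ∧ T ⊆ flagSet a σ)
      ⟨fun y hy => hy.elim, empty_subset _⟩ _)
  refine ⟨f, fun σ τ => ?_, h1, h2⟩
  rw [h0, simpMap_single]
  exact congrArg (fun τ : (Sing X).G 0 => Finsupp.single τ (1 : ℤ)) (Subsingleton.elim _ _)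

section Realization

variable {a b : ℝ} {f : ∀ m, (Tup (Finset X)).Ch m →ₗ[ℤ] (Sing X).Ch m}

theorem IsRealization.isPairMap (hf : IsRealization P q a b f) {Q D D' : Set X} (hQ : Q ⊆ P)
    (hD : ∀ v ∈ P, ∀ y, dist y v ≤ a → y ∈ D) (hD' : ∀ v ∈ Q, ∀ y, dist y v ≤ a → y ∈ D') :
    IsPairMap (sdFam a P) (sdFam a Q) (singSmall (Close q b) D) (singSmall (Close q b) D') f := by
  have key : ∀ (Q D : Set X), (∀ v ∈ Q, ∀ y, dist y v ≤ a → y ∈ D) → ∀ m, ∀ σ ∈ sdFam a Q m,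
      realCarrier q a b m σ m ⊆ singSmall (Close q b) D m := by
    refine fun Q D hD m σ hσ τ hτ => ⟨hτ.1, hτ.2.trans fun y ⟨i, hi⟩ => ?_⟩
    obtain ⟨⟨v, hv⟩, h2, -⟩ := mem_cech_iff.1 (hσ.1 i)
    exact hD v (h2 hv) y (hi v hv)
  exact IsPairMap.of_carriedBy hf.chain hf.carried (sdFam_mono hQ) (key P D hD) (key Q D' hD')

end Realization

/-! ### Vertices of singular simplices -/

/-- The vertices of a simplex. -/
noncomputable def vert {m : ℕ} (i : Fin m) : Simp m := ⟨Pi.single i 1, single_mem_stdSimplex ℝ i⟩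

theorem coface_vert {m : ℕ} (i : Fin (m + 1)) (j : Fin m) :
    coface i (vert j) = vert (i.succAbove j) := by
  refine simp_ext_succAbove i ?_ fun k => ?_
  · rw [coface_self]
    change _ = (Pi.single (i.succAbove j) 1 : Fin (m + 1) → ℝ) i
    simp
  · rw [coface_succAbove]
    change (Pi.single j 1 : Fin m → ℝ) k = (Pi.single (i.succAbove j) 1 : Fin (m + 1) → ℝ) _
    simp [Pi.single_apply]

/-- The images of the vertices of a singular simplex. -/
noncomputable def vertTup (q : X → X) (m : ℕ) (τ : C(Simp m, X)) : Fin m → X := fun i => q (τ (vert i))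

/-- The chain map taking a singular simplex to the images of its vertices. -/
noncomputable def vertMap (q : X → X) : ∀ m, (Sing X).Ch m →ₗ[ℤ] (Tup X).Ch m :=
  simpMap (E := Sing X) (F := Tup X) (vertTup q)

theorem vertTup_d (q : X → X) (m : ℕ) (i : Fin (m + 1)) (τ : C(Simp (m + 1), X)) :
    vertTup q m (τ.comp (coface i)) = vertTup q (m + 1) τ ∘ i.succAbove := by
  funext j
  change q (τ (coface i (vert j))) = q (τ (vert (i.succAbove j)))
  rw [coface_vert]

theorem bd_vertMap (q : X → X) (m : ℕ) (z : (Sing X).Ch (m + 1)) :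
    (Tup X).bd m (vertMap q (m + 1) z) = vertMap q m ((Sing X).bd m z) :=
  bd_simpMap (E := Sing X) (F := Tup X) (fun m i τ => (vertTup_d q m i τ).symm) m z

/-- Closeness supplies the centre of the ball: any point of the simplex is within `a` of all the
chosen sample points, and a vertex is taken. -/
theorem vertTup_mem [Nonempty X] {a : ℝ} {A Q : Set X} (hA : ∀ y ∈ A, q y ∈ Q) {m : ℕ}
    {τ : C(Simp m, X)} (hτ : τ ∈ singSmall (Close q a) A m) : vertTup q m τ ∈ cechFam a Q m := by
  refine ⟨fun i => hA _ (hτ.2 (mem_range_self _)), ?_⟩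
  cases m with
  | zero => exact ⟨Classical.arbitrary X, fun i => i.elim0⟩
  | succ m => exact ⟨τ (vert 0), fun i => hτ.1 _ (mem_range_self _) _ (mem_range_self _)⟩

theorem isPairMap_vertMap [Nonempty X] {a : ℝ} {A A' Q Q' : Set X} (hA : ∀ y ∈ A, q y ∈ Q)
    (hA' : ∀ y ∈ A', q y ∈ Q') : IsPairMap (singSmall (Close q a) A) (singSmall (Close q a) A')
      (cechFam a Q) (cechFam a Q') (vertMap q) :=
  ⟨fun m z _ => bd_vertMap q m z,
    fun _ _ hz => simpMap_mem (E := Sing X) (F := Tup X) (f := vertTup q)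
      (fun _ hτ => vertTup_mem hA hτ) hz,
    fun _ _ hz => simpMap_mem (E := Sing X) (F := Tup X) (f := vertTup q)
      (fun _ hτ => vertTup_mem hA' hτ) hz⟩

end Nerves

/-! ### Composites of realization and vertex maps are homotopic to inclusions. -/

section NerveHomotopies

open FaceSystem

variable {X : Type u} [MetricSpace X] {P : Set X} {q : X → X} {a b : ℝ}
  {f : ∀ m, (Tup (Finset X)).Ch m →ₗ[ℤ] (Sing X).Ch m}

theorem vertMap_zero (τ : (Sing X).G 0) (t : Fin 0 → X) :
    vertMap q 0 (Finsupp.single τ 1) = Finsupp.single t 1 := by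
  rw [vertMap, simpMap_single]
  exact congrArg (fun σ : Fin 0 → X => Finsupp.single σ (1 : ℤ)) (Subsingleton.elim _ _)

/-- The realization of the vertices of a small singular simplex is homotopic to the simplex. -/
theorem IsRealization.sub_mem_relB [Nonempty X] (hf : IsRealization P q a b f) (hq : IsNearest P q)
    (hP : ∀ v ∈ P, (a : EReal) < convAt v) {a₁ : ℝ} (ha : a₁ ≤ a) {A A' D D' : Set X}
    (hA : A' ⊆ A) (hD : ∀ y ∈ A, ∀ y', dist y' (q y) ≤ a → y' ∈ D)
    (hD' : ∀ y ∈ A', ∀ y', dist y' (q y) ≤ a → y' ∈ D') {m : ℕ} {z : (Sing X).Ch (m + 1)}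
    (hz : z ∈ relZ (singSmall (Close q a₁) A) (singSmall (Close q a₁) A') m) :
    f (m + 1) (sdMap X (m + 1) (vertMap q (m + 1) z)) - z ∈ relB (singIn D) (singIn D') m := by
  -- The carrier is the union of the `a`-balls around the sample points chosen for the vertices.
  -- Each of these balls contains the whole image of the close simplex, so the union is geodesically
  -- star-shaped about a vertex.
  let Φ : ∀ m, (Sing X).G m → (Sing X).Fam := fun m τ => singIn (flagSet a fun j => {vertTup q m τ j})
  have hmem : ∀ {m : ℕ} {τ : C(Simp m, X)} {y : X},
      y ∈ flagSet a (fun j => {vertTup q m τ j}) ↔ ∃ j, dist y (vertTup q m τ j) ≤ a := by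
    intro m τ y
    simp [flagSet]
  have hher : ∀ A, Hereditary fun T => Close q a₁ T ∧ T ⊆ A := fun A S T h hT =>
    ⟨fun y hy y' hy' => hT.1 y (h hy) y' (h hy'), h.trans hT.2⟩
  have hv : ∀ {m : ℕ} {τ : C(Simp m, X)}, τ ∈ singSmall (Close q a₁) A m →
      vertTup q m τ ∈ cechFam a P m := fun hτ =>
    cechFam_mono ha subset_rfl _ (vertTup_mem (fun y _ => hq.mem y) hτ)
  have hΦ : IsCarrier (singSmall (Close q a₁) A) Φ := by
    refine ⟨closed_singFam (hher A), fun m τ hτ i k => singIn_mono ?_ k, fun m τ hτ => ?_⟩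
    · rintro y hy
      rw [hmem] at hy ⊢
      obtain ⟨j, hj⟩ := hy
      rw [vertTup_d] at hj
      exact ⟨_, hj⟩
    · have : flagSet a (fun j => {vertTup q (m + 1) τ j}) =
          {y | ∃ j, dist y (vertTup q (m + 1) τ j) ≤ a} := Set.ext fun y => hmem
      change Acyclic (singIn _)
      rw [this]
      exact acyclic_iUnion_closedBall (z := τ (vert 0)) 0
        (fun i => (hτ.1 _ (mem_range_self _) _ (mem_range_self _)).trans ha)
        fun i => hP _ (hq.mem _)
  have hpair := (hf.isPairMap (Q := P) subset_rfl (fun _ _ _ _ => mem_univ _)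
    (fun _ _ _ _ => mem_univ _)).comp ((isPairMap_sdMap (a := a) (P := P) (Q := P)).comp
    ((isPairMap_id (cechFam_mono ha subset_rfl) (cechFam_mono ha subset_rfl)).comp
    (isPairMap_vertMap (a := a₁) (A := A) (A' := A) (fun y _ => hq.mem y) (fun y _ => hq.mem y))))
  refine sub_mem_relB_of_carrier hΦ (g := fun _ => LinearMap.id) hpair.chain
    (fun m z _ => rfl) (fun m τ hτ => ?_) (fun m τ hτ => ?_) (fun τ _ => ?_)
    (fun m τ hτ => ⟨hτ.1, hτ.2.trans hA⟩) (fun m τ hτ => ?_) (fun m τ hτ => ?_) hz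
  · change f m (sdMap X m (vertMap q m (Finsupp.single τ 1))) ∈ _
    rw [vertMap, simpMap_single]
    refine ch_induction (S := sdCarrier m (vertTup q m τ)) _ _ (fun σ hσ => ?_)
      (carriedBy_sdMap m _ trivial)
    refine ch_mono ?_ (hf.carried m σ (sdCarrier_subset (hv hτ) m hσ))
    refine fun κ hκ => hκ.2.trans fun y ⟨i, hi⟩ => hmem.2 ?_
    obtain ⟨v, hv'⟩ := (hσ.1 i).1
    obtain ⟨j, rfl⟩ := (hσ.1 i).2 hv'
    exact ⟨j, hi _ hv'⟩
  · refine single_mem_ch ?_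
    cases m with
    | zero =>
      exact mem_singFam_zero (c := (· ⊆ flagSet a fun j => {vertTup q 0 τ j})) (empty_subset _) _
    | succ m =>
      rintro _ ⟨y, rfl⟩
      exact hmem.2 ⟨0, (hτ.1 _ (mem_range_self _) _ (mem_range_self _)).trans ha⟩
  · change f 0 (sdMap X 0 (vertMap q 0 (Finsupp.single τ 1))) = Finsupp.single τ 1
    rw [vertMap_zero τ (fun j => j.elim0), sdMap_zero _ (fun j => j.elim0), hf.zero]
  · refine singIn_mono (fun y hy => ?_) _
    obtain ⟨j, hj⟩ := hmem.1 hy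
    exact hD _ (hτ.2 (mem_range_self _)) y hj
  · refine singIn_mono (fun y hy => ?_) _
    obtain ⟨j, hj⟩ := hmem.1 hy
    exact hD' _ (hτ.2 (mem_range_self _)) y hj

/-- The carrier for the vertices of the realization of flags. -/
def flagCarrier (P : Set X) (a b : ℝ) (m : ℕ) (σ : Fin m → Finset X) : (Tup X).Fam := fun k =>
  {s : Fin k → X | (∀ j, s j ∈ P) ∧ (k = 0 ∨ ∃ y ∈ flagSet a σ, ∀ j, dist y (s j) ≤ b)}

/-- A vertex `v` of the smallest member of the flag is within a ≤ b of every point of `flagSet a σ`,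
so it may be prepended to any tuple. For the empty tuple the centre is a point common to the balls
of that member. -/
theorem isCarrier_flagCarrier (hab : a ≤ b) :
    IsCarrier (E := Tup (Finset X)) (F := Tup X) (sdFam a P) (flagCarrier P a b) := by
  refine ⟨closed_sdFam a P, fun m σ _ i k s hs => ⟨hs.1, hs.2.imp id ?_⟩, fun m σ hσ => ?_⟩
  · rintro ⟨y, ⟨j, hj⟩, h⟩
    exact ⟨y, ⟨i.succAbove j, hj⟩, h⟩
  · obtain ⟨i, hi⟩ := hσ.2.exists_min
    obtain ⟨⟨v, hv⟩, h2, z, hz⟩ := mem_cech_iff.1 (hσ.1 i)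
    refine acyclic_cons v fun k s hs => ⟨Fin.cases (h2 hv) hs.1, Or.inr ?_⟩
    obtain ⟨y, hy, hys⟩ : ∃ y ∈ flagSet a σ, ∀ j, dist y (s j) ≤ b := by
      rcases hs.2 with rfl | h
      · exact ⟨z, ⟨i, hz⟩, fun j => j.elim0⟩
      · exact h
    exact ⟨y, hy, Fin.cases ((dist_le_of_mem_flagSet hi hy v hv).trans hab) hys⟩

theorem flagCarrier_subset [Nonempty X] {m : ℕ} {σ : Fin m → Finset X}
    {Q Q' : Set X} (hσ : σ ∈ sdFam a Q m) (hQ : ∀ v ∈ Q, ∀ v' ∈ P, dist v v' ≤ a + b → v' ∈ Q')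
    (k : ℕ) : flagCarrier P a b m σ k ⊆ cechFam b Q' k := by
  rintro s ⟨hs, rfl | ⟨y, ⟨i, hi⟩, hys⟩⟩
  · exact ⟨fun j => j.elim0, Classical.arbitrary X, fun j => j.elim0⟩
  · refine ⟨fun j => ?_, y, hys⟩
    obtain ⟨⟨v, hv⟩, h2, -⟩ := mem_cech_iff.1 (hσ.1 i)
    refine hQ v (h2 hv) _ (hs j) ((dist_triangle v y _).trans (add_le_add ?_ (hys j)))
    rw [dist_comm]
    exact hi v hv

/-- The vertices of the realization of the subdivision of a tuple are homotopic to the tuple. -/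
theorem IsRealization.vertMap_sub_mem_relB [Nonempty X] (hf : IsRealization P q a b f) (hq : IsNearest P q)
    (ha : 0 ≤ a) (hab : a ≤ b) {Q Q' : Set X} (hQ : Q ⊆ P)
    (hQ' : ∀ v ∈ Q, ∀ v' ∈ P, dist v v' ≤ a + b → v' ∈ Q') {m : ℕ} {z : (Tup X).Ch (m + 1)}
    (hz : z ∈ relZ (cechFam a P) (cechFam a Q) m) :
    vertMap q (m + 1) (f (m + 1) (sdMap X (m + 1) z)) - z ∈
      relB (cechFam b P) (cechFam b Q') m := by
  have hQQ : Q ⊆ Q' := fun v hv => hQ' v hv v (hQ hv) (by rw [dist_self]; linarith)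
  have hfull : ∀ (R : Set X) {m : ℕ} {t : Fin m → X}, t ∈ cechFam a R m → ∀ k,
      tupIn (range t) k ⊆ cechFam b R k := by
    intro R m t ht k s hs
    refine ⟨fun j => ?_, ht.2.imp fun y hy j => ?_⟩
    · obtain ⟨i, hi⟩ := hs j
      exact hi ▸ ht.1 i
    · obtain ⟨i, hi⟩ := hs j
      exact hi ▸ (hy i).trans hab
  have hsd := (isPairMap_sdMap (a := a) (P := P) (Q := Q)).relZ_le m hz
  -- The comparison passes through picked vertices: first the tuple itself against the picked
  -- vertices of its subdivision, then, in `h1`, those against the vertices of the realization.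
  have h2 : pickMap (Classical.arbitrary X) (m + 1) (sdMap X (m + 1) z) - z ∈
      relB (cechFam b P) (cechFam b Q') m :=
    pickMap_sdMap (closed_cechFam a P) (cechFam_mono le_rfl hQ) (fun m t ht => hfull P ht _)
      (fun m t ht => (hfull Q ht _).trans (cechFam_mono le_rfl hQQ _)) hz
  have hreal := hf.isPairMap (Q := P) (D := univ) (D' := univ) subset_rfl
    (fun _ _ _ _ => mem_univ _) (fun _ _ _ _ => mem_univ _)
  have h1 : vertMap q (m + 1) (f (m + 1) (sdMap X (m + 1) z)) -
      pickMap (Classical.arbitrary X) (m + 1) (sdMap X (m + 1) z) ∈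
      relB (cechFam b P) (cechFam b Q') m := by
    refine sub_mem_relB_of_carrier (isCarrier_flagCarrier hab)
      (f := fun m => vertMap q m ∘ₗ f m) (g := pickMap _)
      ((isPairMap_vertMap (Q := P) (Q' := P) (fun y _ => hq.mem y) (fun y _ => hq.mem y)).comp
        hreal).chain (fun m z _ => bd_pickMap _ m z) (fun m σ hσ => ?_) (fun m σ hσ => ?_)
      (fun σ _ => ?_) (sdFam_mono hQ) (fun m σ hσ => flagCarrier_subset hσ (fun _ _ v' hv' _ => hv') _)
      (fun m σ hσ => flagCarrier_subset hσ hQ' _) hsd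
    · refine simpMap_mem (E := Sing X) (F := Tup X) (f := vertTup q) (S := realCarrier q a b m σ)
        (T := flagCarrier P a b m σ) (fun τ hτ => ⟨fun j => hq.mem _, ?_⟩) (hf.carried m σ hσ)
      cases m with
      | zero => exact Or.inl rfl
      | succ m =>
        exact Or.inr ⟨τ (vert 0), hτ.2 (mem_range_self _),
          fun j => hτ.1 _ (mem_range_self _) _ (mem_range_self _)⟩
    · rw [pickMap, simpMap_single]
      refine single_mem_ch ⟨fun j => ?_, ?_⟩
      · obtain ⟨h1, h2, -⟩ := mem_cech_iff.1 (hσ.1 j)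
        exact h2 (pick_mem h1)
      · cases m with
        | zero => exact Or.inl rfl
        | succ m =>
          -- All picked vertices lie in the largest member of the flag, so a point common to its
          -- balls is a centre.
          obtain ⟨i, hi⟩ := hσ.2.exists_max
          obtain ⟨-, -, y, hy⟩ := mem_cech_iff.1 (hσ.1 i)
          exact Or.inr ⟨y, ⟨i, hy⟩, fun j =>
            (hy _ (hi j (pick_mem (mem_cech_iff.1 (hσ.1 j)).1))).trans hab⟩
    · rw [LinearMap.comp_apply, hf.zero σ (ContinuousMap.const _ (Classical.arbitrary X)),
        vertMap_zero _ (fun j => j.elim0), pickMap, simpMap_single]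
      exact congrArg (fun σ : Fin 0 → X => Finsupp.single σ (1 : ℤ)) (Subsingleton.elim _ _)
  have := Submodule.add_mem _ h1 h2
  rwa [sub_add_sub_cancel] at this

end NerveHomotopies

/-! ### The diagram chase. -/

section NerveRange

open FaceSystem

variable {X : Type u} [MetricSpace X] [Nonempty X] {P : Set X} {q : X → X}

/-- The image of a homomorphism between the relative homology groups of two nested pairs of
complexes, which are interleaved with Čech complexes, is the relative homology of a pair of spaces. -/
theorem nonempty_range_equiv (hq : IsNearest P q) {a₀ a a₁ a₂ : ℝ} (h0 : 0 ≤ a₀) (h1 : a₀ ≤ a)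
    (h2 : a < a₁) (h3 : a₁ ≤ a₂) (hP : ∀ v ∈ P, (a₂ : EReal) < convAt v)
    {MB LB MD LD : (Tup X).Fam} {Q Q' A₀ A₀' A₁ A₁' A₂ A₂' : Set X}
    (hMB : ∀ m, cechFam a₀ P m ⊆ MB m ∧ MB m ⊆ cechFam a P m)
    (hLB : ∀ m, cechFam a₀ Q m ⊆ LB m ∧ LB m ⊆ cechFam a Q m)
    (hMD : ∀ m, cechFam a₁ P m ⊆ MD m ∧ MD m ⊆ cechFam a₂ P m)
    (hLD : ∀ m, cechFam a₁ Q' m ⊆ LD m ∧ LD m ⊆ cechFam a₂ Q' m)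
    (hM : ∀ m, MB m ⊆ MD m) (hL : ∀ m, LB m ⊆ LD m)
    (hQ : Q ⊆ P) (hQ' : Q' ⊆ P) (hQQ : ∀ v ∈ Q, ∀ v' ∈ P, dist v v' ≤ a + a₁ → v' ∈ Q')
    (hA₀ : A₀' ⊆ A₀) (hA₁ : A₁' ⊆ A₁)
    (hqA₀ : ∀ y ∈ A₀, dist y (q y) < a₀) (hqA₀' : ∀ y ∈ A₀', q y ∈ Q)
    (hqA₁ : ∀ y ∈ A₁, dist y (q y) < a₁) (hqA₁' : ∀ y ∈ A₁', q y ∈ Q')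
    (hPA₁ : ∀ v ∈ P, ∀ y, dist y v ≤ a → y ∈ A₁) (hQA₁ : ∀ v ∈ Q, ∀ y, dist y v ≤ a → y ∈ A₁')
    (hPA₂ : ∀ v ∈ P, ∀ y, dist y v ≤ a₂ → y ∈ A₂) (hQA₂ : ∀ v ∈ Q', ∀ y, dist y v ≤ a₂ → y ∈ A₂')
    (h01 : A₀ ⊆ A₁) (h01' : A₀' ⊆ A₁') (h12 : A₁ ⊆ A₂) (h12' : A₁' ⊆ A₂') {m : ℕ}
    (hb : Function.Bijective ((isPairMap_id (singIn_mono h01) (singIn_mono h01')).relMap m))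
    (hi : Function.Injective ((isPairMap_id (singIn_mono h12) (singIn_mono h12')).relMap m)) :
    Nonempty (LinearMap.range ((isPairMap_id hM hL).relMap m) ≃ₗ[ℤ]
      RelH (singIn A₀) (singIn A₀') m) := by
  have hP1 : ∀ v ∈ P, (a : EReal) < convAt v := fun v hv =>
    lt_trans (EReal.coe_lt_coe_iff.2 (h2.trans_le h3)) (hP v hv)
  obtain ⟨f, hf⟩ := hq.exists_realization h2 hP1
  -- Any closeness scale above `a₂` would do, since no vertices are taken after the last
  -- realization.
  obtain ⟨k, hk⟩ := hq.exists_realization (lt_add_one a₂) hP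
  have bij₀ := bijective_singSmall (hq.locallyOn_close hqA₀) subset_rfl hA₀ m
  have bij₁ := bijective_singSmall (hq.locallyOn_close hqA₁) subset_rfl hA₁ m
  -- The maps `hι`, `hu`, `hv`, `hw` form the zigzag A₀ → MB → A₁ → MD → A₂, with the spaces
  -- represented by close simplices.
  have hι := (isPairMap_id (fun m => (hMB m).1) (fun m => (hLB m).1)).comp
    (isPairMap_vertMap (a := a₀) (A := A₀) (A' := A₀') (fun y _ => hq.mem y) hqA₀')
  have hu := ((hf.isPairMap hQ hPA₁ hQA₁).comp isPairMap_sdMap).comp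
    (isPairMap_id (fun m => (hMB m).2) (fun m => (hLB m).2))
  have hv := (isPairMap_id (fun m => (hMD m).1) (fun m => (hLD m).1)).comp
    (isPairMap_vertMap (a := a₁) (A := A₁) (A' := A₁') (fun y _ => hq.mem y) hqA₁')
  have hw := ((hk.isPairMap hQ' hPA₂ hQA₂).comp isPairMap_sdMap).comp
    (isPairMap_id (fun m => (hMD m).2) (fun m => (hLD m).2))
  have hsmall₂ := isPairMap_id (singSmall_subset (Close q (a₂ + 1)) A₂)
    (singSmall_subset (Close q (a₂ + 1)) A₂')
  have hui : ∀ y, (isPairMap_id (singSmall_subset (Close q a₁) A₁)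
      (singSmall_subset (Close q a₁) A₁')).relMap m (hu.relMap m (hι.relMap m y)) =
      (isPairMap_id (singIn_mono h01) (singIn_mono h01')).relMap m
        ((isPairMap_id (singSmall_subset (Close q a₀) A₀)
          (singSmall_subset (Close q a₀) A₀')).relMap m y) := by
    intro y
    obtain ⟨z, rfl⟩ := relClass_surjective _ _ _ y
    refine relClass_eq.2 ?_
    exact hf.sub_mem_relB hq hP1 h1 hA₀ (fun y _ y' h => hPA₁ _ (hq.mem y) y' h)
      (fun y hy y' h => hQA₁ _ (hqA₀' y hy) y' h) z.2
  have hvu : ∀ y, hv.relMap m (hu.relMap m y) = (isPairMap_id hM hL).relMap m y := by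
    intro y
    obtain ⟨z, rfl⟩ := relClass_surjective _ _ _ y
    refine relClass_eq.2 ?_
    have := hf.vertMap_sub_mem_relB hq (h0.trans h1) h2.le hQ hQQ
      ((isPairMap_id (fun m => (hMB m).2) (fun m => (hLB m).2)).relZ_le m z.2)
    exact (isPairMap_id (fun m => (hMD m).1) (fun m => (hLD m).1)).relB_le m this
  have hwv : ∀ y, hsmall₂.relMap m (hw.relMap m (hv.relMap m y)) =
      (isPairMap_id (singIn_mono h12) (singIn_mono h12')).relMap m
        ((isPairMap_id (singSmall_subset (Close q a₁) A₁)
          (singSmall_subset (Close q a₁) A₁')).relMap m y) := by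
    intro y
    obtain ⟨z, rfl⟩ := relClass_surjective _ _ _ y
    refine relClass_eq.2 ?_
    exact hk.sub_mem_relB hq hP h3 hA₁ (fun y _ y' h => hPA₂ _ (hq.mem y) y' h)
      (fun y hy y' h => hQA₂ _ (hqA₁' y hy) y' h) z.2
  -- After the comparison with all singular simplices, w ∘ v is an injective inclusion map, and u ∘
  -- ι a bijective one.
  have hvinj : Function.Injective (hv.relMap m) := by
    intro y y' hyy
    refine (hi.comp bij₁.1) ?_
    change (isPairMap_id (singIn_mono h12) (singIn_mono h12')).relMap m _ =
      (isPairMap_id (singIn_mono h12) (singIn_mono h12')).relMap m _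
    rw [← hwv, ← hwv, hyy]
  have husurj : Function.Surjective (hu.relMap m) := by
    intro y
    obtain ⟨y', hy'⟩ := (hb.comp bij₀).2 ((isPairMap_id (singSmall_subset (Close q a₁) A₁)
      (singSmall_subset (Close q a₁) A₁')).relMap m y)
    exact ⟨hι.relMap m y', bij₁.1 ((hui y').trans hy')⟩
  have hrange : LinearMap.range ((isPairMap_id hM hL).relMap m) = LinearMap.range (hv.relMap m) := by
    refine le_antisymm ?_ ?_
    · rintro _ ⟨y, rfl⟩
      exact ⟨_, hvu y⟩
    · rintro _ ⟨y, rfl⟩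
      obtain ⟨y', rfl⟩ := husurj y
      exact ⟨y', (hvu y').symm⟩
  rw [hrange]
  exact ⟨(LinearEquiv.ofInjective _ hvinj).symm.trans
    ((LinearEquiv.ofBijective _ bij₁).trans (LinearEquiv.ofBijective _ hb).symm)⟩

end NerveRange

/-! ### A dimension-free form of Jung's theorem. -/

section Jung

variable {E : Type*} [NormedAddCommGroup E] [InnerProductSpace ℝ E]

/-- Expanding the squares, the cross terms combine to the inner product of the barycentre with `w`.
The identity is applied below with `w` one of the points and with `w` the barycentre. -/
theorem sum_mul_norm_sub_sq {ι : Type*} [Fintype ι] (v : ι → E) {l : ι → ℝ} (hl : ∑ i, l i = 1)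
    (w : E) : ∑ i, l i * ‖v i - w‖ ^ 2 =
      ∑ i, l i * ‖v i‖ ^ 2 - ‖∑ i, l i • v i‖ ^ 2 + ‖∑ i, l i • v i - w‖ ^ 2 := by
  have h : ∀ i, l i * ‖v i - w‖ ^ 2 =
      l i * ‖v i‖ ^ 2 - 2 * inner ℝ (l i • v i) w + l i * ‖w‖ ^ 2 := fun i => by
    rw [norm_sub_sq_real, real_inner_smul_left]
    ring
  simp only [h]
  rw [Finset.sum_add_distrib, Finset.sum_sub_distrib, ← Finset.mul_sum, ← Finset.sum_mul, hl,
    ← sum_inner, norm_sub_sq_real]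
  ring

/-- Points at mutual distance at most `2a` are contained in a ball of radius `√2 a`. -/
theorem exists_dist_le_sqrt_two {ι : Type*} [Fintype ι] [Nonempty ι] (v : ι → E) {a : ℝ}
    (h : ∀ i j, dist (v i) (v j) ≤ 2 * a) : ∃ c, ∀ i, dist c (v i) ≤ √2 * a := by
  classical
  have ha : 0 ≤ a := by
    have := h (Classical.arbitrary ι) (Classical.arbitrary ι)
    rw [dist_self] at this
    linarith
  -- This is the variance of the points for given weights; the barycentre for weights of maximal
  -- variance is the desired centre.
  let g : (ι → ℝ) → ℝ := fun l => ∑ i, l i * ‖v i‖ ^ 2 - ‖∑ i, l i • v i‖ ^ 2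
  have hg : Continuous g := by fun_prop
  obtain ⟨l, hl, hmax⟩ := (isCompact_stdSimplex ℝ ι).exists_isMaxOn
    ⟨_, single_mem_stdSimplex ℝ (Classical.arbitrary ι)⟩ hg.continuousOn
  set c := ∑ i, l i • v i with hc
  -- The mean square distance from `v j` is g l + ‖v j - c‖², at most 4a². Averaging over `j` with
  -- the same weights gives 2 g l ≤ 4a².
  have hbound : g l ≤ 2 * a ^ 2 := by
    have h1 : ∀ j, g l + ‖v j - c‖ ^ 2 ≤ 4 * a ^ 2 := fun j => by
      have := sum_mul_norm_sub_sq v hl.2 (v j)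
      rw [norm_sub_rev (v j)]
      change _ = g l + _ at this
      rw [← this]
      calc ∑ i, l i * ‖v i - v j‖ ^ 2 ≤ ∑ i, l i * (4 * a ^ 2) := by
            refine Finset.sum_le_sum fun i _ => mul_le_mul_of_nonneg_left ?_ (hl.1 i)
            have := h i j
            rw [dist_eq_norm] at this
            nlinarith [norm_nonneg (v i - v j)]
        _ = 4 * a ^ 2 := by rw [← Finset.sum_mul, hl.2, one_mul]
    have h2 : ∑ j, l j * ‖v j - c‖ ^ 2 = g l := by
      rw [sum_mul_norm_sub_sq v hl.2 c, sub_self, norm_zero]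
      simp [g]
    have h3 : ∑ j, l j * (g l + ‖v j - c‖ ^ 2) ≤ ∑ j, l j * (4 * a ^ 2) :=
      Finset.sum_le_sum fun j _ => mul_le_mul_of_nonneg_left (h1 j) (hl.1 j)
    simp only [mul_add] at h3
    rw [Finset.sum_add_distrib, h2, ← Finset.sum_mul, ← Finset.sum_mul, hl.2] at h3
    linarith
  refine ⟨c, fun i => ?_⟩
  -- Moving the weights by `s` towards the point `i` changes the variance by s(n - g l) - s²n with n
  -- = ‖v i - c‖². At a maximum this is not positive, so n ≤ g l.
  have hkey : ‖v i - c‖ ^ 2 ≤ g l := by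
    have hs : ∀ s : ℝ, 0 < s → s ≤ 1 → ‖v i - c‖ ^ 2 - g l ≤ s * ‖v i - c‖ ^ 2 := by
      intro s hs0 hs1
      have hmem : (1 - s) • l + s • (Pi.single i 1 : ι → ℝ) ∈ stdSimplex ℝ ι :=
        convex_stdSimplex ℝ ι hl (single_mem_stdSimplex ℝ i) (sub_nonneg.2 hs1) hs0.le (by ring)
      have hle : g ((1 - s) • l + s • (Pi.single i 1 : ι → ℝ)) ≤ g l := hmax hmem
      have e1 : ∑ j, ((1 - s) • l + s • (Pi.single i 1 : ι → ℝ)) j * ‖v j‖ ^ 2 =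
          (1 - s) * ∑ j, l j * ‖v j‖ ^ 2 + s * ‖v i‖ ^ 2 := by
        simp [add_mul, Finset.sum_add_distrib, Finset.mul_sum, mul_assoc, Pi.single_apply]
      have e2 : ∑ j, ((1 - s) • l + s • (Pi.single i 1 : ι → ℝ)) j • v j = c + s • (v i - c) := by
        have : ∑ j, ((1 - s) • l + s • (Pi.single i 1 : ι → ℝ)) j • v j =
            (1 - s) • c + s • v i := by
          simp [add_smul, Finset.sum_add_distrib, Finset.smul_sum, mul_smul, Pi.single_apply, hc]
        rw [this]
        module
      have e3 : ‖v i‖ ^ 2 = ‖c‖ ^ 2 + 2 * inner ℝ c (v i - c) + ‖v i - c‖ ^ 2 := by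
        rw [← norm_add_sq_real, add_sub_cancel]
      simp only [g] at hle
      rw [e1, e2, norm_add_sq_real, real_inner_smul_right, norm_smul, Real.norm_eq_abs,
        abs_of_pos hs0, ← hc] at hle
      simp only [g]
      rw [← hc]
      have : s * (‖v i - c‖ ^ 2 - (∑ j, l j * ‖v j‖ ^ 2 - ‖c‖ ^ 2)) ≤ s * (s * ‖v i - c‖ ^ 2) := by
        nlinarith
      exact le_of_mul_le_mul_left this hs0
    by_contra! hlt
    have hd : 0 < ‖v i - c‖ ^ 2 - g l := by linarith
    have hn : 0 < ‖v i - c‖ ^ 2 := by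
      rcases (sq_nonneg ‖v i - c‖).eq_or_lt with h0 | h0
      · have := hs 1 one_pos le_rfl
        rw [← h0] at this hd
        linarith
      · exact h0
    -- With this step the quadratic term is at most half of the linear one, which contradicts
    -- maximality.
    have := hs (min 1 ((‖v i - c‖ ^ 2 - g l) / (2 * ‖v i - c‖ ^ 2)))
      (lt_min one_pos (by positivity)) (min_le_left _ _)
    have h4 : min 1 ((‖v i - c‖ ^ 2 - g l) / (2 * ‖v i - c‖ ^ 2)) * ‖v i - c‖ ^ 2 ≤
        (‖v i - c‖ ^ 2 - g l) / 2 := by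
      refine (mul_le_mul_of_nonneg_right (min_le_right _ _) hn.le).trans (le_of_eq ?_)
      rw [div_mul_eq_mul_div, mul_div_mul_right _ _ hn.ne']
    linarith
  rw [dist_comm, dist_eq_norm]
  refine abs_le_of_sq_le_sq' ?_ (by positivity) |>.2
  rw [mul_pow, Real.sq_sqrt zero_le_two]
  exact hkey.trans hbound

end Jung

/-! ### Vietoris-Rips complexes between Čech complexes. -/

section Rips

variable {X : Type u} [MetricSpace X]

theorem one_le_ripsConst : 1 ≤ ripsConst X := by
  rw [ripsConst]
  split_ifs
  · exact Real.one_le_sqrt.2 one_le_two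
  · exact one_le_two

theorem cech_le_rips (a : ℝ) (Q : Set X) : cech a Q ≤ rips a Q := by
  classical
  intro σ hσ
  refine ⟨hσ.1, hσ.2.1, fun v hv w hw => ?_⟩
  rw [mem_cech_iff] at hσ ⊢
  obtain ⟨-, h2, y, hy⟩ := hσ
  refine ⟨⟨v, by simp⟩, ?_, y, ?_⟩
  · intro z hz
    simp only [Finset.coe_insert, Finset.coe_singleton, mem_insert_iff, mem_singleton_iff] at hz
    rcases hz with rfl | rfl
    exacts [h2 hv, h2 hw]
  · intro z hz
    simp only [Finset.mem_insert, Finset.mem_singleton] at hz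
    rcases hz with rfl | rfl
    exacts [hy _ hv, hy _ hw]

/-- Vertices of a simplex are at mutual distance at most 2a. In the Euclidean case Jung's theorem
gives a ball of radius √2 a; otherwise any vertex is the centre of a ball of radius 2a. -/
theorem rips_le_cech (a : ℝ) (Q : Set X) : rips a Q ≤ cech (ripsConst X * a) Q := by
  classical
  rintro σ ⟨h1, h2, h3⟩
  have hd : ∀ v ∈ σ, ∀ w ∈ σ, dist v w ≤ 2 * a := by
    intro v hv w hw
    obtain ⟨-, -, y, hy⟩ := mem_cech_iff.1 (h3 v hv w hw)
    have := dist_triangle_left v w y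
    linarith [hy v (by simp), hy w (by simp)]
  refine mem_cech_iff.2 ⟨h1, h2, ?_⟩
  rw [ripsConst]
  split_ifs with hE
  · obtain ⟨n, ⟨e⟩⟩ := hE
    have : Nonempty σ := h1.to_subtype
    obtain ⟨c, hc⟩ := exists_dist_le_sqrt_two (fun v : σ => e v) (a := a) fun v w => by
      rw [e.dist_eq]
      exact hd _ v.2 _ w.2
    refine ⟨e.symm c, fun v hv => ?_⟩
    rw [← e.dist_eq, e.apply_symm_apply]
    exact hc ⟨v, hv⟩
  · obtain ⟨v, hv⟩ := h1
    exact ⟨v, hd v hv⟩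

end Rips

/-! ### Inclusion maps of pairs of spaces in terms of relative cycles. -/

section Inclusions

open FaceSystem

variable {X : Type u} [TopologicalSpace X]

/-- The homomorphism of relative homology groups induced by an inclusion of pairs. -/
noncomputable def inclMap (n : ℕ) {A U A' U' : Set X} (hA : A ⊆ A') (hU : U' ⊆ U) :
    RelH (singIn A) (singIn (A \ U)) n →ₗ[ℤ] RelH (singIn A') (singIn (A' \ U')) n :=
  (isPairMap_id (singIn_mono hA) (singIn_mono (sdiff_subset_sdiff hA hU))).relMap n

theorem inclMap_inclMap (n : ℕ) {A U A' U' A'' U'' : Set X} (hA : A ⊆ A') (hU : U' ⊆ U)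
    (hA' : A' ⊆ A'') (hU' : U'' ⊆ U') (y : RelH (singIn A) (singIn (A \ U)) n) :
    inclMap n hA' hU' (inclMap n hA hU y) = inclMap n (hA.trans hA') (hU'.trans hU) y := by
  obtain ⟨z, rfl⟩ := relClass_surjective _ _ _ y
  rfl

theorem inclMap_self (n : ℕ) {A U : Set X} (y : RelH (singIn A) (singIn (A \ U)) n) :
    inclMap n subset_rfl subset_rfl y = y := by
  obtain ⟨z, rfl⟩ := relClass_surjective _ _ _ y
  rfl

/-- Singular homology in terms of relative cycles. -/
noncomputable def spaceEquiv (n : ℕ) (A U : Set X) :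
    RelH (singIn A) (singIn (A \ U)) n ≃+ spaceH n A U :=
  (spacePairEmbedding A U).equiv n

theorem spaceHMap_spaceEquiv (n : ℕ) {A U A' U' : Set X} (hA : A ⊆ A') (hU : U' ⊆ U)
    (y : RelH (singIn A) (singIn (A \ U)) n) :
    spaceHMap n hA hU (spaceEquiv n A U y) = spaceEquiv n A' U' (inclMap n hA hU y) :=
  spaceHMap_equiv n hA hU y

theorem bijective_inclMap_of_inclusionIso {A U A' U' : Set X} (h : InclusionIso A U A' U') :
    ∃ (hA : A ⊆ A') (hU : U' ⊆ U), ∀ n, Function.Bijective (inclMap n hA hU) := by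
  obtain ⟨hA, hU, h⟩ := h
  refine ⟨hA, hU, fun n => ?_⟩
  have : spaceEquiv n A' U' ∘ inclMap n hA hU = spaceHMap n hA hU ∘ spaceEquiv n A U :=
    funext fun y => (spaceHMap_spaceEquiv n hA hU y).symm
  rw [← (AddEquiv.bijective (spaceEquiv n A' U')).of_comp_iff', this]
  exact (h n).comp (AddEquiv.bijective _)

end Inclusions

/-! ### The consequences of seemliness for inclusion maps. -/

section Diagonals

open FaceSystem

variable {X : Type u} [MetricSpace X] {K : Set X} {W : Option (WhitneyStratification X K)} {x : X}

theorem exists_inclMap_diagonal {e R r α : ℝ} (h : MemA K W x e R r α) :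
    ∃ (h₁ : Metric.cthickening 0 K ⊆ Metric.cthickening e K)
      (h₂ : Metric.cthickening e K ⊆ Metric.cthickening α K)
      (h₃ : Metric.ball x r ⊆ Metric.ball x R), ∀ n,
      Function.Injective (inclMap n h₂ h₃ ∘ inclMap n h₁ (subset_refl (Metric.ball x R))) ∧
      ∀ y, ∃ z, inclMap n h₂ h₃ (inclMap n h₁ (subset_refl (Metric.ball x R)) z) =
        inclMap n h₂ h₃ y := by
  obtain ⟨h₁, h₂, h₃, h⟩ := h.diagonal
  refine ⟨h₁, h₂, h₃, fun n => ?_⟩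
  obtain ⟨hi, hr⟩ := h n
  have key : ∀ z, spaceHMap n h₂ h₃ (spaceHMap n h₁ (subset_refl (Metric.ball x R))
      (spaceEquiv n _ _ z)) = spaceEquiv n _ _ (inclMap n h₂ h₃ (inclMap n h₁ subset_rfl z)) :=
    fun z => by rw [spaceHMap_spaceEquiv, spaceHMap_spaceEquiv]
  constructor
  · intro z z' hzz
    refine (spaceEquiv n _ _).injective (hi ?_)
    refine (key z).trans (Eq.trans ?_ (key z').symm)
    exact congrArg _ hzz
  · intro y
    have hy : spaceHMap n h₂ h₃ (spaceEquiv n _ _ y) ∈ range (spaceHMap n h₂ h₃) := ⟨_, rfl⟩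
    rw [← hr] at hy
    obtain ⟨w, hw⟩ := hy
    obtain ⟨z, rfl⟩ := (spaceEquiv n _ _).surjective w
    refine ⟨z, (spaceEquiv n _ _).injective ?_⟩
    rw [← key, ← spaceHMap_spaceEquiv]
    exact hw

/-- For α = e and equal radii j_* is the identity, so the diagonal condition says that i_* is
bijective. -/
theorem bijective_inclMap_of_memA {e R : ℝ} (h : MemA K W x e R R e) :
    ∃ h₁ : Metric.cthickening 0 K ⊆ Metric.cthickening e K, ∀ n,
      Function.Bijective (inclMap n h₁ (subset_refl (Metric.ball x R))) := by
  obtain ⟨h₁, h₂, h₃, h⟩ := exists_inclMap_diagonal h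
  refine ⟨h₁, fun n => ?_⟩
  obtain ⟨hi, hr⟩ := h n
  refine ⟨Function.Injective.of_comp hi, fun y => ?_⟩
  obtain ⟨z, hz⟩ := hr y
  exact ⟨z, by rwa [inclMap_self, inclMap_self] at hz⟩

/-- The homological consequences of seemliness. -/
theorem exists_inclMap_of_memA {e R b r β : ℝ} (hR : MemA K W x e R R β) (hb : MemA K W x e b b e)
    (hr : MemA K W x e r r β) (hr0 : 0 < r) (hrb : r ≤ b) (hbR : b ≤ R) :
    ∃ (h01 : Metric.cthickening 0 K ⊆ Metric.cthickening e K)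
      (h01' : Metric.ball x b ⊆ Metric.ball x R)
      (h12 : Metric.cthickening e K ⊆ Metric.cthickening β K)
      (h12' : Metric.ball x r ⊆ Metric.ball x b), ∀ n,
      Function.Bijective (inclMap n h01 h01') ∧ Function.Injective (inclMap n h12 h12') := by
  obtain ⟨hA, hU, bRb⟩ := bijective_inclMap_of_inclusionIso
    (hR.bottom_row b (hr0.trans_le hrb) hbR).1
  obtain ⟨hA', hU', bRr⟩ := bijective_inclMap_of_inclusionIso
    (hR.bottom_row r hr0 (hrb.trans hbR)).1
  obtain ⟨h01, b01⟩ := bijective_inclMap_of_memA hb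
  obtain ⟨h01', h12, hrr, hdiag⟩ := exists_inclMap_diagonal hr
  have hbr : Metric.ball x r ⊆ Metric.ball x b := Metric.ball_subset_ball hrb
  refine ⟨h01, hU, h12, hbr, fun n => ⟨?_, ?_⟩⟩
  -- The map factors as F(0, R) → F(0, b) → F(e, b), bijective by the bottom row and by seemliness
  -- at `b` with α = e.
  · have : ⇑(inclMap n h01 hU) = inclMap n h01 (subset_refl (Metric.ball x b)) ∘
        inclMap n hA hU := funext fun y => (inclMap_inclMap n _ _ _ _ y).symm
    rw [this]
    exact (b01 n).comp (bRb n)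
  · intro y y' hyy
    obtain ⟨z, rfl⟩ := ((b01 n).comp (bRb n)).2 y
    obtain ⟨z', rfl⟩ := ((b01 n).comp (bRb n)).2 y'
    -- Preceded by the isomorphism F(0, R) → F(e, b), the map to F(β, r) also factors through F(0,
    -- r), from which it is injective by the diagonal condition at `r`.
    have key := ((hdiag n).1.comp (bRr n).1)
    have : z = z' := by
      apply key
      simp only [Function.comp_apply, inclMap_inclMap] at hyy ⊢
      exact hyy
    rw [this]

end Diagonals

/-! ### Choice of the scales and proof of the theorem. -/

section Assembly

open FaceSystem

variable {X : Type u} [MetricSpace X] {K P : Set X}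

theorem exists_isNearest (hP : P.Finite) (hne : P.Nonempty) : ∃ q, IsNearest P q := by
  have : ∀ y : X, ∃ v ∈ P, ∀ w ∈ P, dist y v ≤ dist y w := fun y =>
    exists_min_image P (dist y) hP hne
  choose q h1 h2 using this
  exact ⟨q, h1, h2⟩

theorem exists_dist_lt_of_isSample {ε : ℝ} (hK : IsCompact K) (hKne : K.Nonempty)
    (h : IsSample ε K P) :
    (∀ k ∈ K, ∃ v ∈ P, dist k v < ε) ∧ ∀ v ∈ P, ∃ k ∈ K, dist v k < ε := by
  obtain ⟨-, hfin, hne, hd⟩ := h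
  have hfin' := Metric.hausdorffEDist_ne_top_of_nonempty_of_bounded hKne hne hK.isBounded
    hfin.isBounded
  refine ⟨fun k hk => Metric.exists_dist_lt_of_hausdorffDist_lt hk hd hfin', fun v hv => ?_⟩
  obtain ⟨k, hk, hk'⟩ := Metric.exists_dist_lt_of_hausdorffDist_lt' hv hd hfin'
  exact ⟨k, hk, by rwa [dist_comm]⟩

theorem noise_bounds {ε t : ℝ} {p x : X} (hK : IsCompact K) (hP : IsSample ε K P) (hp : p ∈ P)
    (hx : IsAssociated ε K P p x) (ht : t = noiseConst K P) :
    0 ≤ t ∧ dist x p ≤ t * ε ∧ ∀ v ∈ P, ∃ k ∈ K, dist v k ≤ t * ε := by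
  rw [noiseConst] at ht
  split_ifs at ht with h
  · subst ht
    refine ⟨le_rfl, ?_, fun v hv => ⟨v, h hv, by simp⟩⟩
    have := hx.2.1 h p (h hp)
    rw [dist_self] at this
    rw [dist_comm, zero_mul]
    exact this
  · subst ht
    refine ⟨zero_le_one, ?_, fun v hv => ?_⟩
    · rw [one_mul]
      exact (hx.2.2 h).le
    · obtain ⟨k, hk, hk'⟩ := (exists_dist_lt_of_isSample hK ⟨x, hx.1⟩ hP).2 v hv
      exact ⟨k, hk, by rw [one_mul]; exact hk'.le⟩

theorem IsNearest.dist_lt {q : X → X} (hq : IsNearest P q) (hK : IsCompact K) {ε δ : ℝ}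
    (h : ∀ k ∈ K, ∃ v ∈ P, dist k v < ε) (hδ : 0 ≤ δ) {y : X} (hy : y ∈ Metric.cthickening δ K) :
    dist y (q y) < δ + ε := by
  rw [hK.cthickening_eq_biUnion_closedBall hδ] at hy
  obtain ⟨k, hk, hky⟩ := mem_iUnion₂.1 hy
  obtain ⟨v, hv, hkv⟩ := h k hk
  calc dist y (q y) ≤ dist y v := hq.le y v hv
    _ ≤ dist y k + dist k v := dist_triangle _ _ _
    _ < δ + ε := add_lt_add_of_le_of_lt hky hkv

/-- The main result, for complexes `C` that are interleaved with Čech complexes. -/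
theorem nonempty_range_equiv_spaceH (hK : IsCompact K) (W : Option (WhitneyStratification X K))
    {ε : ℝ} (hP : IsSample ε K P) {p x : X} (hp : p ∈ P) (hx : IsAssociated ε K P p x)
    {εx : ℝ} {ρl : ℝ → ℝ → ℝ} {ρu : ℝ → ℝ → EReal} (hS : StronglySeemly K W x εx ρl ρu)
    {c t β : ℝ} (hc : 1 ≤ c) (ht : t = noiseConst K P) (hβ : β = scaleBeta c t ε) (hβx : β ≤ εx)
    (hconv : ((c * (1 + c + t) * ε : ℝ) : EReal) < conv P)
    {R' r' R r : ℝ} (hR'u : (R' : EReal) < ρu ((c + t) * ε) β)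
    (hr'l : ρl ((c + t) * ε) β < r') (hr'u : r' < R' - scaleGamma c t ε)
    (hRdef : R = R' - (1 + t) * ε) (hrdef : r = r' + β)
    (C : ℝ → Set X → PreAbstractSimplicialComplex X) (h1 : ∀ a Q, cech a Q ≤ C a Q)
    (h2 : ∀ a Q, C a Q ≤ cech (c * a) Q)
    (hdiff : ∀ a b, C a (P \ Metric.ball p b) ≤ C a P) :
    ∃ (hL : C ε (P \ Metric.ball p R) ≤ C ((1 + c + t) * ε) (P \ Metric.ball p r))
      (hM : C ε P ≤ C ((1 + c + t) * ε) P), ∀ n,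
      Nonempty (LinearMap.range (complexHMap n (hdiff ε R) (hdiff ((1 + c + t) * ε) r) hL hM)
        ≃ₗ[ℤ] spaceH n K {x}) := by
  have : Nonempty X := ⟨x⟩
  obtain ⟨ht0, hxp, hPK⟩ := noise_bounds hK hP hp hx ht
  have hKP := (exists_dist_lt_of_isSample hK ⟨x, hx.1⟩ hP).1
  obtain ⟨q, hq⟩ := exists_isNearest hP.2.1 hP.2.2.1
  have hε := hP.1
  rw [scaleBeta] at hβ
  rw [scaleGamma] at hr'u
  have hcε : ε ≤ c * ε := le_mul_of_one_le_left hε.le hc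
  have htε : 0 ≤ t * ε := mul_nonneg ht0 hε.le
  have htcε : 0 ≤ t * c * ε := mul_nonneg (mul_nonneg ht0 (by linarith)) hε.le
  have hccε : 0 ≤ c ^ 2 * ε := by positivity
  have he0 : 0 < (c + t) * ε := by linarith
  have heβ : (c + t) * ε ≤ β := by linarith
  set e := (c + t) * ε with he
  have heI : e ∈ Icc 0 εx := ⟨he0.le, heβ.trans hβx⟩
  have hβI : β ∈ Icc e εx := ⟨heβ, hβx⟩
  have heeI : e ∈ Icc e εx := ⟨le_rfl, heI.2⟩
  have hr'0 : 0 < r' := (hS.rho_nonneg e heI β hβI).trans_lt hr'l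
  obtain ⟨hmono1, hmono2⟩ := hS.rho_mono_alpha e heI e heeI β hβI heβ
  -- Points within cε of a sample point outside B_R(p) are outside B_b(x), as d(x, p) ≤ tε.
  set b := R - c * ε - t * ε with hb
  have hrb : r' ≤ b := by linarith
  have hbR : b ≤ R' := by linarith
  have hcoe : ∀ {y z : ℝ}, y ≤ z → (y : EReal) ≤ z := fun h => EReal.coe_le_coe_iff.2 h
  obtain ⟨h01, h01', h12, h12', hincl⟩ := exists_inclMap_of_memA
    (hS.mem e heI he0 β hβI R' (by linarith) hR'u.le)
    (hS.mem e heI he0 e heeI b (by linarith) ((hcoe hbR).trans (hR'u.le.trans hmono2)))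
    (hS.mem e heI he0 β hβI r' hr'l.le ((hcoe (hrb.trans hbR)).trans hR'u.le)) hr'0 hrb hbR
  obtain ⟨hsub, hsub', hiso⟩ := ((hS.mem e heI he0 β hβI R' (by linarith) hR'u.le).bottom_row R'
    (by linarith) le_rfl).2
  have hthick : ∀ {a : ℝ} {v y : X}, v ∈ P → dist y v ≤ a → y ∈ Metric.cthickening (a + t * ε) K := by
    intro a v y hv hy
    obtain ⟨k, hk, hk'⟩ := hPK v hv
    exact Metric.mem_cthickening_of_dist_le y k _ K hk ((dist_triangle y v k).trans (add_le_add hy hk'))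
  have hup : ∀ {a d d' : ℝ} {v y : X}, v ∈ P \ Metric.ball p d → dist y v ≤ a → d' + a + t * ε ≤ d →
      y ∉ Metric.ball x d' := by
    intro a d d' v y hv hy hd hyx
    have h1 : d ≤ dist v p := not_lt.1 hv.2
    have h2 : dist y x < d' := hyx
    have := dist_triangle4 v y x p
    rw [dist_comm v y] at this
    linarith
  have hdown : ∀ {a d d' : ℝ} {y : X}, y ∉ Metric.ball x d → dist y (q y) ≤ a → d' + a + t * ε ≤ d →
      q y ∈ P \ Metric.ball p d' := by
    intro a d d' y hy hqy hd
    refine ⟨hq.mem y, fun hlt => hy ?_⟩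
    have h2 : dist (q y) p < d' := hlt
    have := dist_triangle4 y (q y) p x
    rw [dist_comm p x] at this
    change dist y x < d
    linarith
  have ha₁ : c * ε < (1 + c + t) * ε := by linarith
  have ha₂ : (1 + c + t) * ε ≤ c * ((1 + c + t) * ε) :=
    le_mul_of_one_le_left (by linarith) hc
  have hrR : Metric.ball p r ⊆ Metric.ball p R := Metric.ball_subset_ball (by linarith)
  -- Monotonicity of `C` in the scale is obtained from the Čech complexes in between, because cε <
  -- (1 + c + t)ε.
  have hcechM : ∀ {Q Q' : Set X}, Q ⊆ Q' → C ε Q ≤ C ((1 + c + t) * ε) Q' := by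
    intro Q Q' hQ σ hσ
    refine h1 _ _ ?_
    obtain ⟨n1, n2, y, n3⟩ := mem_cech_iff.1 (h2 _ _ hσ)
    exact mem_cech_iff.2 ⟨n1, n2.trans hQ, y, fun v hv => (n3 v hv).trans ha₁.le⟩
  have hL := hcechM (sdiff_subset_sdiff (subset_refl P) hrR)
  have hM := hcechM (subset_refl P)
  refine ⟨hL, hM, fun n => ?_⟩
  have hfam : ∀ a Q m, cechFam a Q m ⊆ complexFam (C a Q) m ∧
      complexFam (C a Q) m ⊆ cechFam (c * a) Q m := fun a Q m => by
    rw [← complexFam_cech, ← complexFam_cech]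
    exact ⟨complexFam_mono (h1 a Q) m, complexFam_mono (h2 a Q) m⟩
  -- Balls of radii cε and c(1 + c + t)ε around sample points lie in D_e(K) and D_β(K), and points
  -- of D_e(K) are within (1 + c + t)ε of the sample.
  have hbe : c * ε + t * ε = e := by rw [he]; ring
  have hβe : c * ((1 + c + t) * ε) + t * ε = β := by rw [hβ]; ring
  have hE : e + ε = (1 + c + t) * ε := by rw [he]; ring
  obtain ⟨Θ⟩ := nonempty_range_equiv hq hε.le hcε ha₁ ha₂
    (fun v hv => lt_of_lt_of_le (by rwa [← mul_assoc]) (iInf₂_le v hv))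
    (hfam ε P) (hfam ε (P \ Metric.ball p R)) (hfam _ P) (hfam _ (P \ Metric.ball p r))
    (complexFam_mono hM) (complexFam_mono hL) sdiff_subset sdiff_subset
    (fun v hv v' hv' hd => ⟨hv', fun hlt => by
      have h3 : R ≤ dist v p := not_lt.1 hv.2
      have h4 : dist v' p < r := hlt
      have := dist_triangle v v' p
      linarith⟩)
    (sdiff_subset : Metric.cthickening 0 K \ Metric.ball x R' ⊆ _)
    (sdiff_subset : Metric.cthickening e K \ Metric.ball x b ⊆ _)
    (fun y hy => by simpa using hq.dist_lt hK hKP le_rfl hy)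
    (fun y hy => hdown hy.2 (hq.dist_lt hK hKP le_rfl hy.1).le (by linarith))
    (fun y hy => hE ▸ hq.dist_lt hK hKP he0.le hy)
    -- Here γ is used in full: the inequality r + (1 + c + 2t)ε ≤ b amounts to r' ≤ R' - γ.
    (fun y hy => hdown hy.2 (hq.dist_lt hK hKP he0.le hy.1).le (by linarith))
    (fun v hv y hy => hbe ▸ hthick hv hy)
    (fun v hv y hy => ⟨hbe ▸ hthick hv.1 hy, hup hv hy (by linarith)⟩)
    (A₂' := Metric.cthickening β K \ Metric.ball x r')
    (fun v hv y hy => hβe ▸ hthick hv hy)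
    -- This accounts for the shift by β, which equals c(1 + c + t)ε + tε.
    (fun v hv y hy => ⟨hβe ▸ hthick hv.1 hy, hup hv hy (by linarith)⟩)
    h01 (sdiff_subset_sdiff h01 h01') h12 (sdiff_subset_sdiff h12 h12') (hincl n).1 (hincl n).2
  let eB := (complexPairEmbedding (hdiff ε R)).equiv n
  let eD := (complexPairEmbedding (hdiff ((1 + c + t) * ε) r)).equiv n
  have hcomm := complexHMap_equiv n (hdiff ε R) (hdiff ((1 + c + t) * ε) r) hL hM
  set g := (isPairMap_id (complexFam_mono hM) (complexFam_mono hL)).relMap n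
  let Ψ : LinearMap.range g →+
      LinearMap.range (complexHMap n (hdiff ε R) (hdiff ((1 + c + t) * ε) r) hL hM) :=
    { toFun := fun y => ⟨eD y, by
        obtain ⟨_, ⟨z, rfl⟩⟩ := y
        exact ⟨eB z, hcomm z⟩⟩
      map_zero' := Subtype.ext (map_zero eD)
      map_add' := fun y y' => Subtype.ext (map_add eD _ _) }
  have hΨ : Function.Bijective Ψ := by
    constructor
    · intro y y' h
      exact Subtype.ext (eD.injective (congrArg Subtype.val h))
    · rintro ⟨_, ⟨z, rfl⟩⟩
      refine ⟨⟨g (eB.symm z), _, rfl⟩, Subtype.ext ?_⟩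
      refine (hcomm (eB.symm z)).symm.trans ?_
      exact congrArg _ (eB.apply_symm_apply z)
  exact ⟨AddEquiv.toIntLinear (((AddEquiv.ofBijective Ψ hΨ).symm.trans Θ.toAddEquiv).trans
    ((spaceEquiv n _ _).trans
      (LinearEquiv.ofBijective _ (hiso n)).toAddEquiv))⟩

end Assembly

theorem mainTheorem9 {X : Type u} [MetricSpace X] [CompleteSpace X] [LocallyCompactSpace X]
    (hmid : ∀ a b : X, ∃ z : X, dist a b = 2 * dist a z ∧ dist a b = 2 * dist b z)
    (hX : LocallyStronglyConvex X)
    (K : Set X) (hK : IsCompact K) (W : Option (WhitneyStratification X K))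
    (P : Set X) (ε : ℝ) (hP : IsSample ε K P)
    (p x : X) (hp : p ∈ P) (hx : IsAssociated ε K P p x)
    (εx : ℝ) (ρl : ℝ → ℝ → ℝ) (ρu : ℝ → ℝ → EReal) (hS : StronglySeemly K W x εx ρl ρu)
    (c t β γ : ℝ) (hc : c = 1 ∨ c = ripsConst X) (ht : t = noiseConst K P)
    (hβ : β = scaleBeta c t ε) (hγ : γ = scaleGamma c t ε) (hβx : β ≤ εx)
    (rbar : ℝ) (Rbar : EReal)
    (hr : rbar = ρl ((c + t) * ε) β) (hR : Rbar = ρu ((c + t) * ε) β)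
    (hconv : ((c * (1 + c + t) * ε : ℝ) : EReal) < conv P)
    (hτ : (γ : EReal) < Rbar - (rbar : EReal))
    (R' r' R r : ℝ) (hR'l : rbar + γ < R') (hR'u : (R' : EReal) < Rbar)
    (hr'l : rbar < r') (hr'u : r' < R' - γ)
    (hRdef : R = R' - (1 + t) * ε) (hrdef : r = r' + β) :
    (c = 1 →
      ∃ (hL : cech ε (P \ Metric.ball p R) ≤ cech ((1 + c + t) * ε) (P \ Metric.ball p r))
        (hM : cech ε P ≤ cech ((1 + c + t) * ε) P), ∀ n,
        Nonempty (LinearMap.range (complexHMap n (cech_diff_le P p ε R)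
          (cech_diff_le P p ((1 + c + t) * ε) r) hL hM) ≃ₗ[ℤ] spaceH n K {x})) ∧
    (c = ripsConst X →
      ∃ (hL : rips ε (P \ Metric.ball p R) ≤ rips ((1 + c + t) * ε) (P \ Metric.ball p r))
        (hM : rips ε P ≤ rips ((1 + c + t) * ε) P), ∀ n,
        Nonempty (LinearMap.range (complexHMap n (rips_diff_le P p ε R)
          (rips_diff_le P p ((1 + c + t) * ε) r) hL hM) ≃ₗ[ℤ] spaceH n K {x})) := by
  subst hr hR
  have h1s := one_le_ripsConst (X := X)
  have hc1 : 1 ≤ c := by rcases hc with rfl | rfl <;> first | exact le_rfl | exact h1s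
  subst hγ
  constructor
  · rintro rfl
    exact nonempty_range_equiv_spaceH hK W hP hp hx hS hc1 ht hβ hβx hconv hR'u hr'l hr'u hRdef
      hrdef cech (fun _ _ => le_rfl) (fun a Q => by rw [one_mul]) (cech_diff_le P p)
  · rintro rfl
    exact nonempty_range_equiv_spaceH hK W hP hp hx hS hc1 ht hβ hβx hconv hR'u hr'l hr'u hRdef
      hrdef rips cech_le_rips rips_le_cech (rips_diff_le P p)
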